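/- **Lemma 2.3.** For $r>0$ let $\Psi(r,s)=\frac{1}{4\pi^{3/2}s^{1/2}}\,\frac1r\int_0^r e^{-\rho^2/(4s)}\,d\rho$ if $s>0$ (extended continuously to $r=0$) and $\Psi(r,s)=0$ if $s\le 0$, and let $\Gamma_{ij}(\xi,s)=-\delta_{ij}\Delta_\xi\Psi(|\xi|,s)+\partial_{\xi_i}\partial_{\xi_j}\Psi(|\xi|,s)$ be the Oseen fundamental tensor in $\mathbb R^3$. Let $t_1<t_2$ be real and $\mathcal R=\mathbb R^3\times(t_1,t_2)$. Let $F=\{F_{\ell j}\}_{\ell,j=1}^3$ be a real tensor field that is continuous in $\mathcal R$, differentiable in $x$, and Hölder continuous in $x\in\mathbb R^3$ together with its first spatial derivatives, with exponent in $(0,1]$ and constant independent of $t\in(t_1,t_2)$; suppose the spatial support of $F(\cdot,t)$ lies in a ball independent of $t$. Define (summing over repeated indices) $$v_i(x,t)=\int_{t_1}^t\int_{\mathbb R^3}\partial_{x_\ell}\big[\Gamma_{ij}(x-y,t-\tau)\big]\,F_{\ell j}(y,\tau)\,dy\,d\tau,\qquad (x,t)\in\mathcal R,\ i=1,2,3 .$$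 (i) The integral converges absolutely for every $(x,t)\in\mathcal R$; $v$ is twice continuously differentiable in $x$ and differentiable in $t$, with $v$, $\partial_x v$, $\partial_x^2 v$ and $\partial_t v$ continuous in $\mathcal R$; and there is a scalar field $\Phi$, differentiable in $x$, with $\Phi$ and $\nabla\Phi$ continuous in $\mathcal R$, such that $$\partial_t v=\Delta v+\nabla\Phi+\operatorname{div}F,\qquad \operatorname{div}v=0\qquad\text{in }\mathcal R,$$ where $(\operatorname{div}F)_i=\partial_\ell F_{\ell i}$. (ii) Write $\|f\|_{L^{a,b}(\mathcal R)}=\big(\int_{t_1}^{t_2}\|f(\cdot,t)\|_{L^b(\mathbb R^3)}^a\,dt\big)^{1/a}$. Let $q,r\in(3,\infty)$ and $q',r'$ be real numbers with $$\frac2{q'}+\frac3q=1,\qquad \frac2{r'}+\frac3r=1,\qquad 2r\ge q>\frac{6r}{3+r}.$$ Then there is a constant $c>0$, depending only on these exponents (not on $t_1,t_2,F$), such that $F\in L^{q'/2,q/2}(\mathcal R)$ implies $v\in L^{r',r}(\mathcal R)$ and $$\|v\|_{L^{r',r}(\mathcal R)}\le c\,\|F\|_{L^{q'/2,q/2}(\mathcal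 R)} .$$ -/

import Mathlib

open MeasureTheory Set

noncomputable section

namespace Oseen

/-- Euclidean three-space. -/
abbrev E3 : Type := EuclideanSpace ℝ (Fin 3)

/-- Second-order tensors `(A_{ℓ j})`, with the Euclidean (Frobenius) norm. -/
abbrev Tensor3 : Type := EuclideanSpace ℝ (Fin 3 × Fin 3)

/-- The partial derivative `∂_i f (x)` of a scalar function. -/
def pd (i : Fin 3) (f : E3 → ℝ) (x : E3) : ℝ :=
  fderiv ℝ f x (EuclideanSpace.single i 1)

/-- The radial profile `Ψ(r, s) = (4 π^{3/2} s^{1/2})⁻¹ r⁻¹ ∫₀^r exp (-ρ²/(4 s)) dρ` for `s > 0`,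
and `0` for `s ≤ 0`. The mean value over `[0, r]` is written with `ρ = r σ`, `σ ∈ [0, 1]`, so that
the value at `r = 0` is the continuous extension; see `psi_eq`. -/
def psi (r s : ℝ) : ℝ :=
  if 0 < s then
    1 / (4 * Real.pi ^ (3 / 2 : ℝ) * s ^ (1 / 2 : ℝ)) *
      ∫ σ in (0 : ℝ)..1, Real.exp (-(r * σ) ^ 2 / (4 * s))
  else 0

theorem psi_eq {r s : ℝ} (hr : 0 < r) (hs : 0 < s) :
    psi r s = 1 / (4 * Real.pi ^ (3 / 2 : ℝ) * s ^ (1 / 2 : ℝ)) *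
      (1 / r * ∫ ρ in (0 : ℝ)..r, Real.exp (-ρ ^ 2 / (4 * s))) := by
  have h := intervalIntegral.integral_comp_mul_left (a := 0) (b := 1)
    (fun ρ : ℝ => Real.exp (-ρ ^ 2 / (4 * s))) hr.ne'
  rw [psi, if_pos hs, h]
  simp

/-- The Oseen fundamental tensor
`Γ_{ij}(ξ, s) = -δ_{ij} Δ_ξ Ψ(|ξ|, s) + ∂_{ξ_i} ∂_{ξ_j} Ψ(|ξ|, s)`. -/
def Gam (i j : Fin 3) (ξ : E3) (s : ℝ) : ℝ :=
  -(if i = j then Laplacian.laplacian (fun z : E3 => psi ‖z‖ s) ξ else 0) +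
    pd i (pd j (fun z : E3 => psi ‖z‖ s)) ξ

/-- The integrand `∂_{x_ℓ} [Γ_{ij}(x - y, t - τ)] F_{ℓ j}(y, τ)`, summed over `ℓ` and `j`. -/
def integrand (F : E3 → ℝ → Tensor3) (i : Fin 3) (x : E3) (t : ℝ) (y : E3) (τ : ℝ) : ℝ :=
  ∑ ℓ : Fin 3, ∑ j : Fin 3, pd ℓ (fun z : E3 => Gam i j (z - y) (t - τ)) x * F y τ (ℓ, j)

/-- The Oseen potential with density `F` and initial time `t₁`. -/
def potential (t₁ : ℝ) (F : E3 → ℝ → Tensor3) (x : E3) (t : ℝ) : E3 :=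
  WithLp.toLp 2 fun i : Fin 3 => ∫ τ in t₁..t, ∫ y : E3, integrand F i x t y τ

/-- The slab `ℝ³ × (t₁, t₂)`. -/
def slab (t₁ t₂ : ℝ) : Set (E3 × ℝ) := univ ×ˢ Ioo t₁ t₂

/-- `F` is continuous in the slab; it is differentiable in `x`, and `F` and its first
`x`-derivatives are Hölder continuous in `x`, uniformly in `t`; the spatial support of `F(·, t)`
is contained in a ball that does not depend on `t`. -/
structure Admissible (t₁ t₂ : ℝ) (F : E3 → ℝ → Tensor3) : Prop where
  continuousOn : ContinuousOn (fun p : E3 × ℝ => F p.1 p.2) (slab t₁ t₂)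
  differentiable : ∀ t ∈ Ioo t₁ t₂, Differentiable ℝ (fun x => F x t)
  holder : ∃ C α : NNReal, 0 < α ∧ α ≤ 1 ∧ ∀ t ∈ Ioo t₁ t₂,
    HolderWith C α (fun x => F x t) ∧ HolderWith C α (fderiv ℝ (fun x => F x t))
  support : ∃ R : ℝ, ∀ t ∈ Ioo t₁ t₂, ∀ x : E3, R < ‖x‖ → F x t = 0

/-- `f` is `n` times differentiable in the space variables, and all its space derivatives of order
at most `n` (including `f` itself) are continuous in the slab. -/
def SpaceRegular {V : Type*} [NormedAddCommGroup V] [NormedSpace ℝ V]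
    (n : ℕ) (t₁ t₂ : ℝ) (f : E3 → ℝ → V) : Prop :=
  (∀ t ∈ Ioo t₁ t₂, ContDiff ℝ n (fun x => f x t)) ∧
  ∀ k : ℕ, k ≤ n →
    ContinuousOn (fun p : E3 × ℝ => iteratedFDeriv ℝ k (fun x => f x p.2) p.1) (slab t₁ t₂)

/-- `f` is differentiable in time, with time derivative continuous in the slab. -/
def TimeRegular {V : Type*} [NormedAddCommGroup V] [NormedSpace ℝ V]
    (t₁ t₂ : ℝ) (f : E3 → ℝ → V) : Prop :=
  (∀ x : E3, ∀ t ∈ Ioo t₁ t₂, DifferentiableAt ℝ (f x) t) ∧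
  ContinuousOn (fun p : E3 × ℝ => deriv (f p.1) p.2) (slab t₁ t₂)

/-- `∂_t v = Δ v + ∇ Φ + div F` and `div v = 0` in the slab,
where `(div F)_i = ∑_ℓ ∂_ℓ F_{ℓ i}`. -/
def SolvesStokes (t₁ t₂ : ℝ) (v : E3 → ℝ → E3) (Φ : E3 → ℝ → ℝ) (F : E3 → ℝ → Tensor3) : Prop :=
  ∀ x : E3, ∀ t ∈ Ioo t₁ t₂,
    (∀ i : Fin 3, deriv (fun s => v x s i) t =
      Laplacian.laplacian (fun y => v y t i) x + pd i (fun y => Φ y t) x +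
        ∑ ℓ : Fin 3, pd ℓ (fun y => F y t (ℓ, i)) x) ∧
    ∑ i : Fin 3, pd i (fun y => v y t i) x = 0

/-- The norm of `L^{a,b}(ℝ³ × (t₁, t₂))`, with exponent `a` in time and `b` in space:
`(∫_{t₁}^{t₂} ‖f(·, t)‖_b^a dt)^{1/a}`. -/
def mixedNorm {V : Type*} [NormedAddCommGroup V]
    (a b t₁ t₂ : ℝ) (f : E3 → ℝ → V) : ENNReal :=
  (∫⁻ t in Ioo t₁ t₂, eLpNorm (fun x => f x t) (ENNReal.ofReal b) volume ^ a) ^ (1 / a)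

/-- Membership in `L^{a,b}(ℝ³ × (t₁, t₂))`. -/
def MemMixed {V : Type*} [NormedAddCommGroup V]
    (a b t₁ t₂ : ℝ) (f : E3 → ℝ → V) : Prop :=
  AEStronglyMeasurable (fun p : E3 × ℝ => f p.1 p.2) (volume.restrict (slab t₁ t₂)) ∧
    mixedNorm a b t₁ t₂ f < ⊤

end Oseen

end

/-! ### Gaussian moments and the radial building blocks of `Ψ` -/

noncomputable section

namespace Oseen

/-! Part (i). All derivatives of `Ψ(|z|, s)` are polynomials in the coordinates times the functions
`radial n`, which are built from Gaussian moments. The moment recurrence yields both the heat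
equation for `Ψ` and its derivatives and the bound of a derivative of order `k` by a multiple of
`(|z|² + s)^(-(k+1)/2)`. The kernel `∂Γ` therefore has order 4, and its spatial `L¹` norm is
`O(s^(-1/2))`, which is integrable in time. With one more derivative the order is 5 and the norm is
`O(s⁻¹)`, which just fails; but such kernels have mean zero, and against a Hölder density of
exponent `α` the convolution improves to `O(s^(α/2-1))` (`exists_abs_cv_sub_le`). Writing `∂³Ψ * f =
∂²Ψ * ∂f` lets two further derivatives fall on the potential at the price of one Hölder derivative
of `F`.

For the time derivative, the heat equation gives `∂²Ψ(s) * ∂f = N + ∫₀ˢ ∂²ΔΨ(σ) * ∂f dσ`, where `N`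
(`newton`) is the limit as `s → 0`. After an exchange of integrals the Duhamel integral is a
primitive in `t` (`hasDerivAt_duhamel`), so each building block satisfies `∂ₜu = Δu + N`. Since
`-ΔΨ` is the heat kernel, the trace of `newton` is minus the identity (`sum_newton_eq`); this
produces `div F`. The symmetry of `∂³Ψ` turns the remaining terms into the gradient of `pressure`
and makes the divergence cancel (`solvesStokes_potential`).

Part (ii). Only `|∂Γ| ≤ C (|z|² + s)⁻²` matters. Minkowski's inequality in time and Young's in space
bound the `L^r` norm of `v(t)` by `∫ (t-τ)^(-lam) ‖F(τ)‖_{q/2} dτ` with `lam = 1/2 + 3/q - 3/(2r)`.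
The Hardy–Littlewood–Sobolev inequality on the line then closes the estimate, the two scaling
relations being exactly its exponent condition. The hypothesis `q ≤ 2r` is what Young's inequality
needs, and `q > 6r/(3+r)` says `lam < 1`. The one-dimensional inequality is obtained from layer
cakes: a bilinear form is integrated over pairs of level sets, and the plane of levels is cut along
a power curve (`lintegral_riesz_bilinear_le`). -/

/-- The moments `∫₀¹ σ²ⁿ exp (-u σ²) dσ`. -/
def gaussMoment (n : ℕ) (u : ℝ) : ℝ := ∫ σ in (0 : ℝ)..1, σ ^ (2 * n) * Real.exp (-(u * σ ^ 2))

theorem hasDerivAt_gaussMoment (n : ℕ) (u : ℝ) :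
    HasDerivAt (gaussMoment n) (-gaussMoment (n + 1) u) u := by
  have h := intervalIntegral.hasDerivAt_integral_of_dominated_loc_of_deriv_le
    (F := fun v σ : ℝ => σ ^ (2 * n) * Real.exp (-(v * σ ^ 2)))
    (F' := fun v σ : ℝ => -(σ ^ (2 * (n + 1)) * Real.exp (-(v * σ ^ 2))))
    (x₀ := u) (s := Metric.ball u 1) (a := 0) (b := 1) (μ := volume)
    (bound := fun _ => Real.exp (|u| + 1)) (Metric.ball_mem_nhds u one_pos)
    (Filter.Eventually.of_forall fun v =>
      (by fun_prop : Continuous fun σ : ℝ =>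
        σ ^ (2 * n) * Real.exp (-(v * σ ^ 2))).aestronglyMeasurable)
    ((by fun_prop : Continuous fun σ : ℝ =>
        σ ^ (2 * n) * Real.exp (-(u * σ ^ 2))).intervalIntegrable _ _)
    ((by fun_prop : Continuous fun σ : ℝ =>
        -(σ ^ (2 * (n + 1)) * Real.exp (-(u * σ ^ 2)))).aestronglyMeasurable)
    (Filter.Eventually.of_forall fun σ hσ v hv => ?_) (by simp)
    (Filter.Eventually.of_forall fun σ _ v _ => ?_)
  · refine h.2.congr_deriv ?_
    simp [gaussMoment, intervalIntegral.integral_neg]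
  · rw [uIoc_of_le zero_le_one] at hσ
    rw [norm_neg, norm_mul, Real.norm_eq_abs, Real.norm_eq_abs, Real.abs_exp,
      abs_of_nonneg (by positivity [hσ.1.le])]
    have h1 : σ ^ (2 * (n + 1)) ≤ 1 := pow_le_one₀ hσ.1.le hσ.2
    have h2 : σ ^ 2 ≤ 1 := pow_le_one₀ hσ.1.le hσ.2
    have h3 : |v - u| < 1 := hv
    have h4 : -(v * σ ^ 2) ≤ |u| + 1 := by
      have h5 : |v| ≤ |u| + 1 := by
        have := abs_sub_abs_le_abs_sub v u
        linarith
      calc -(v * σ ^ 2) ≤ |v * σ ^ 2| := neg_le_abs _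
        _ = |v| * σ ^ 2 := by rw [abs_mul, abs_of_nonneg (sq_nonneg σ)]
        _ ≤ |v| * 1 := by gcongr
        _ ≤ _ := by linarith
    calc σ ^ (2 * (n + 1)) * Real.exp (-(v * σ ^ 2)) ≤ 1 * Real.exp (|u| + 1) := by gcongr
      _ = _ := one_mul _
  · have h1 : HasDerivAt (fun v : ℝ => Real.exp (-(v * σ ^ 2)))
        (Real.exp (-(v * σ ^ 2)) * (-(1 * σ ^ 2))) v :=
      (((hasDerivAt_id v).mul_const (σ ^ 2)).neg).exp
    refine (h1.const_mul (σ ^ (2 * n))).congr_deriv ?_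
    ring

theorem continuous_gaussMoment (n : ℕ) : Continuous (gaussMoment n) :=
  continuous_iff_continuousAt.2 fun u => (hasDerivAt_gaussMoment n u).continuousAt

/-- The fundamental theorem of calculus for `σ^(2n+1) exp(-uσ²)` on `[0, 1]`. This identity is the
source of the decay of the moments, of the heat equation, and of the Gaussian form of `ΔΨ`. -/
theorem gaussMoment_recurrence (n : ℕ) (u : ℝ) :
    (2 * n + 1) * gaussMoment n u - 2 * u * gaussMoment (n + 1) u = Real.exp (-u) := by
  have h := intervalIntegral.integral_eq_sub_of_hasDerivAt (a := 0) (b := 1)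
    (f := fun σ : ℝ => σ ^ (2 * n + 1) * Real.exp (-(u * σ ^ 2)))
    (f' := fun σ : ℝ => (2 * n + 1) * (σ ^ (2 * n) * Real.exp (-(u * σ ^ 2))) -
      2 * u * (σ ^ (2 * (n + 1)) * Real.exp (-(u * σ ^ 2)))) (fun σ _ => ?_)
    ((by fun_prop : Continuous _).intervalIntegrable _ _)
  · rw [intervalIntegral.integral_sub
      ((by fun_prop : Continuous _).intervalIntegrable _ _)
      ((by fun_prop : Continuous _).intervalIntegrable _ _),
      intervalIntegral.integral_const_mul, intervalIntegral.integral_const_mul] at h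
    simpa [gaussMoment] using h
  · have h1 : HasDerivAt (fun σ : ℝ => Real.exp (-(u * σ ^ 2)))
        (Real.exp (-(u * σ ^ 2)) * (-(u * (((2 : ℕ) : ℝ) * σ ^ (2 - 1))))) σ :=
      (((hasDerivAt_pow 2 σ).const_mul u).neg).exp
    refine ((hasDerivAt_pow (2 * n + 1) σ).mul h1).congr_deriv ?_
    push_cast
    ring

theorem gaussMoment_nonneg (n : ℕ) (u : ℝ) : 0 ≤ gaussMoment n u :=
  intervalIntegral.integral_nonneg zero_le_one fun σ hσ => by positivity [hσ.1]

theorem gaussMoment_succ_le (n : ℕ) (u : ℝ) : gaussMoment (n + 1) u ≤ gaussMoment n u := by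
  refine intervalIntegral.integral_mono_on zero_le_one
    ((by fun_prop : Continuous _).intervalIntegrable _ _)
    ((by fun_prop : Continuous _).intervalIntegrable _ _) fun σ hσ => ?_
  exact mul_le_mul_of_nonneg_right (pow_le_pow_of_le_one hσ.1 hσ.2 (by omega)) (Real.exp_nonneg _)

/-- For small `u` the integrand is at most 1; for large `u` the integral is dominated by the full
Gaussian `√(π/u)`. The constant 4 covers both ranges. -/
theorem gaussMoment_zero_le {u : ℝ} (hu : 0 ≤ u) :
    gaussMoment 0 u ≤ 4 * (1 + u) ^ (-(1 / 2) : ℝ) := by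
  have hone : gaussMoment 0 u ≤ 1 := by
    have : gaussMoment 0 u ≤ ∫ σ in (0 : ℝ)..1, (1 : ℝ) :=
      intervalIntegral.integral_mono_on zero_le_one
        ((by fun_prop : Continuous _).intervalIntegrable _ _) (by simp) fun σ hσ => by
          simp only [mul_zero, pow_zero, one_mul]
          exact Real.exp_le_one_iff.2 (by have := sq_nonneg σ; nlinarith)
    simpa using this
  rw [Real.rpow_neg (by linarith), ← Real.sqrt_eq_rpow, ← div_eq_mul_inv,
    le_div_iff₀ (Real.sqrt_pos.2 (by linarith))]
  rcases le_or_gt u 1 with h1 | h1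
  · have : √(1 + u) ≤ 2 := by
      rw [Real.sqrt_le_left (by norm_num)]
      linarith
    nlinarith [gaussMoment_nonneg 0 u, Real.sqrt_nonneg (1 + u)]
  · have h2 : gaussMoment 0 u ≤ √(Real.pi / u) := by
      rw [← integral_gaussian u, gaussMoment, intervalIntegral.integral_of_le zero_le_one]
      have hint := integrable_exp_neg_mul_sq (b := u) (by linarith)
      calc ∫ σ in Ioc (0 : ℝ) 1, σ ^ (2 * 0) * Real.exp (-(u * σ ^ 2))
          = ∫ σ in Ioc (0 : ℝ) 1, Real.exp (-u * σ ^ 2) := by simp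
        _ ≤ _ := setIntegral_le_integral hint (Filter.Eventually.of_forall fun σ => by positivity)
    calc gaussMoment 0 u * √(1 + u) ≤ √(Real.pi / u) * √(1 + u) := by gcongr
      _ = √(Real.pi / u * (1 + u)) := by rw [Real.sqrt_mul (by positivity)]
      _ ≤ 4 := by
        rw [Real.sqrt_le_left (by norm_num), div_mul_eq_mul_div, div_le_iff₀ (by linarith)]
        nlinarith [Real.pi_le_four, Real.pi_pos]

/-- Dropping the exponential in the recurrence bounds `u M_{n+1}` by `(n + 1/2) M_n`, and `M_{n+1} ≤
M_n` supplies the part near `u = 0`. Together each step of the induction gains one factor `1 + u`.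
-/
theorem exists_gaussMoment_le (n : ℕ) : ∃ C : ℝ, 0 ≤ C ∧ ∀ u : ℝ, 0 ≤ u →
    gaussMoment n u ≤ C * (1 + u) ^ (-(n : ℝ) - 1 / 2) := by
  induction n with
  | zero => exact ⟨4, by norm_num, fun u hu => by simpa using gaussMoment_zero_le hu⟩
  | succ n ih =>
    obtain ⟨C, hC, h⟩ := ih
    refine ⟨C * (n + 3 / 2), by positivity, fun u hu => ?_⟩
    have h1 : 0 < 1 + u := by linarith
    have h2 : (1 + u) * gaussMoment (n + 1) u ≤ (n + 3 / 2) * gaussMoment n u := by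
      have := gaussMoment_recurrence n u
      have := gaussMoment_succ_le n u
      have := Real.exp_nonneg (-u)
      nlinarith
    have h3 : (1 + u) ^ (-((n + 1 : ℕ) : ℝ) - 1 / 2) = (1 + u) ^ (-(n : ℝ) - 1 / 2) / (1 + u) := by
      rw [← Real.rpow_sub_one h1.ne']
      congr 1
      push_cast
      ring
    rw [h3, mul_div_assoc', le_div_iff₀ h1]
    calc gaussMoment (n + 1) u * (1 + u) ≤ (n + 3 / 2) * gaussMoment n u := by linarith
      _ ≤ (n + 3 / 2) * (C * (1 + u) ^ (-(n : ℝ) - 1 / 2)) := by gcongr; exact h u hu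
      _ = _ := by ring

/-- The radial building blocks of the derivatives of `Ψ(|z|, s)`: `radial 0` is `Ψ` and
`∂ₘ (radial n) = zₘ • radial (n + 1)`. -/
def radial (n : ℕ) (z : E3) (s : ℝ) : ℝ :=
  1 / (4 * Real.pi ^ (3 / 2 : ℝ)) * (-1 / 2) ^ n * s ^ (-(n : ℝ) - 1 / 2) *
    gaussMoment n (‖z‖ ^ 2 / (4 * s))

theorem psi_eq_radial (z : E3) {s : ℝ} (hs : 0 < s) : psi ‖z‖ s = radial 0 z s := by
  rw [psi, if_pos hs, radial, gaussMoment]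
  congr 1
  · rw [one_div, one_div, mul_inv, pow_zero, mul_one, ← Real.rpow_neg hs.le]
    norm_num
  · refine intervalIntegral.integral_congr fun σ _ => ?_
    simp only [mul_zero, pow_zero, one_mul]
    congr 1
    ring

theorem hasFDerivAt_radial (n : ℕ) (z : E3) {s : ℝ} (hs : 0 < s) :
    HasFDerivAt (fun z => radial n z s) (radial (n + 1) z s • innerSL ℝ z) z := by
  have h1 : HasFDerivAt (fun z : E3 => ‖z‖ ^ 2 / (4 * s)) ((1 / (4 * s)) • (2 • innerSL ℝ z)) z := by
    simpa [div_eq_inv_mul] using (hasStrictFDerivAt_norm_sq z).hasFDerivAt.const_mul (1 / (4 * s))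
  have h2 := ((hasDerivAt_gaussMoment n (‖z‖ ^ 2 / (4 * s))).comp_hasFDerivAt z h1).const_mul
    (1 / (4 * Real.pi ^ (3 / 2 : ℝ)) * (-1 / 2) ^ n * s ^ (-(n : ℝ) - 1 / 2))
  refine h2.congr_fderiv ?_
  ext v
  have h3 : s ^ (-((n + 1 : ℕ) : ℝ) - 1 / 2) = s ^ (-(n : ℝ) - 1 / 2) / s := by
    rw [← Real.rpow_sub_one hs.ne']
    congr 1
    push_cast
    ring
  simp only [radial, h3, smul_apply, smul_eq_mul, pow_succ, nsmul_eq_mul]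
  field_simp
  push_cast
  ring

/-- A radial heat equation in dimension `2n + 3`: the right-hand side is what the gradient rule for
`radial` gives for the Laplacian in that dimension. It holds because the recurrences at `n` and `n +
1` have the same right-hand side. The cases `n = 1, 2` feed `hasDerivAt_psi2`. -/
theorem hasDerivAt_radial (n : ℕ) (z : E3) {s : ℝ} (hs : 0 < s) :
    HasDerivAt (fun s => radial n z s)
      ((2 * n + 3) * radial (n + 1) z s + ‖z‖ ^ 2 * radial (n + 2) z s) s := by
  have h1 : HasDerivAt (fun s : ℝ => ‖z‖ ^ 2 / (4 * s)) (-(‖z‖ ^ 2 / (4 * s)) / s) s := by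
    have := ((hasDerivAt_inv hs.ne').const_mul (‖z‖ ^ 2 / 4))
    convert! this using 1
    · ext s; field_simp
    · field_simp
  have h2 := (hasDerivAt_gaussMoment n (‖z‖ ^ 2 / (4 * s))).comp s h1
  have h3 := ((Real.hasDerivAt_rpow_const (x := s) (p := -(n : ℝ) - 1 / 2)
    (Or.inl hs.ne')).mul h2).const_mul (1 / (4 * Real.pi ^ (3 / 2 : ℝ)) * (-1 / 2) ^ n)
  have e1 : s ^ (-((n + 1 : ℕ) : ℝ) - 1 / 2) = s ^ (-(n : ℝ) - 1 / 2) / s := by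
    rw [← Real.rpow_sub_one hs.ne']
    congr 1
    push_cast
    ring
  have e2 : s ^ (-((n + 2 : ℕ) : ℝ) - 1 / 2) = s ^ (-(n : ℝ) - 1 / 2) / s / s := by
    rw [← Real.rpow_sub_one hs.ne', ← Real.rpow_sub_one hs.ne']
    congr 1
    push_cast
    ring
  have e3 : s ^ (-(n : ℝ) - 1 / 2 - 1) = s ^ (-(n : ℝ) - 1 / 2) / s := Real.rpow_sub_one hs.ne' _
  convert! h3 using 1
  · ext s; simp only [radial, Function.comp, Pi.mul_apply]; ring
  · have r1 := gaussMoment_recurrence n (‖z‖ ^ 2 / (4 * s))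
    have r2 := gaussMoment_recurrence (n + 1) (‖z‖ ^ 2 / (4 * s))
    simp only [radial, e1, e2, e3, pow_succ (-1 / 2 : ℝ), Function.comp]
    set u := ‖z‖ ^ 2 / (4 * s) with hu
    have hz : ‖z‖ ^ 2 = 4 * s * u := by rw [hu]; field_simp
    rw [hz]
    push_cast at r1 r2 ⊢
    have r3 : (2 * n + 3) * gaussMoment (n + 1) u - 2 * u * gaussMoment (n + 2) u =
        (2 * n + 1) * gaussMoment n u - 2 * u * gaussMoment (n + 1) u := by
      rw [r1, ← r2]; ring
    field_simp
    linear_combination (-2) * r3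

/-- The factor `s^(-n-1/2)` and the moment decay combine into a power of `s (1 + |z|²/(4s)) = s +
|z|²/4`, which is comparable to `|z|² + s`. The singularity at `s = 0` is thus confined to `z = 0`.
-/
theorem exists_abs_radial_le (n : ℕ) : ∃ C : ℝ, 0 ≤ C ∧ ∀ (z : E3) (s : ℝ), 0 < s →
    |radial n z s| ≤ C * (‖z‖ ^ 2 + s) ^ (-((2 * n + 1 : ℕ) : ℝ) / 2) := by
  obtain ⟨C, hC, h⟩ := exists_gaussMoment_le n
  refine ⟨1 / (4 * Real.pi ^ (3 / 2 : ℝ)) * (1 / 2) ^ n * (4 ^ ((n : ℝ) + 1 / 2) * C),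
    by positivity, fun z s hs => ?_⟩
  have h1 := h (‖z‖ ^ 2 / (4 * s)) (by positivity)
  have e : -((2 * n + 1 : ℕ) : ℝ) / 2 = -(n : ℝ) - 1 / 2 := by push_cast; ring
  rw [e, radial, abs_mul, abs_mul, abs_mul, abs_of_nonneg (gaussMoment_nonneg _ _), abs_pow,
    abs_of_nonneg (by positivity : 0 ≤ s ^ (-(n : ℝ) - 1 / 2)),
    abs_of_nonneg (by positivity : 0 ≤ 1 / (4 * Real.pi ^ (3 / 2 : ℝ)))]
  have e2 : |(-1 / 2 : ℝ)| = 1 / 2 := by norm_num [abs_div]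
  rw [e2, mul_assoc, mul_assoc (_ * _) _ ((_ : ℝ) ^ (_ : ℝ))]
  refine mul_le_mul_of_nonneg_left ?_ (by positivity)
  calc s ^ (-(n : ℝ) - 1 / 2) * gaussMoment n (‖z‖ ^ 2 / (4 * s))
      ≤ s ^ (-(n : ℝ) - 1 / 2) * (C * (1 + ‖z‖ ^ 2 / (4 * s)) ^ (-(n : ℝ) - 1 / 2)) := by gcongr
    _ = C * (s * (1 + ‖z‖ ^ 2 / (4 * s))) ^ (-(n : ℝ) - 1 / 2) := by
      rw [Real.mul_rpow hs.le (by positivity)]; ring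
    _ ≤ C * ((‖z‖ ^ 2 + s) / 4) ^ (-(n : ℝ) - 1 / 2) := by
      refine mul_le_mul_of_nonneg_left (Real.rpow_le_rpow_of_nonpos ?_ ?_ ?_) hC
      · positivity
      · field_simp; nlinarith [sq_nonneg ‖z‖]
      · have : (0 : ℝ) ≤ n := n.cast_nonneg
        linarith
    _ = 4 ^ ((n : ℝ) + 1 / 2) * C * (‖z‖ ^ 2 + s) ^ (-(n : ℝ) - 1 / 2) := by
      rw [Real.div_rpow (by positivity) (by norm_num), div_eq_mul_inv, ← Real.rpow_neg (by norm_num)]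
      rw [show -(-(n : ℝ) - 1 / 2) = n + 1 / 2 by ring]
      ring

theorem continuousOn_radial (n : ℕ) :
    ContinuousOn (fun p : E3 × ℝ => radial n p.1 p.2) (univ ×ˢ Ioi 0) := by
  intro p hp
  have hs : p.2 ≠ 0 := (mem_Ioi.1 hp.2).ne'
  refine ContinuousAt.continuousWithinAt ?_
  unfold radial
  refine (ContinuousAt.mul continuousAt_const ?_).mul ?_
  · exact continuousAt_snd.rpow_const (Or.inl hs)
  · refine (continuous_gaussMoment n).continuousAt.comp (ContinuousAt.div ?_ ?_ ?_)
    · fun_prop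
    · fun_prop
    · simpa using hs

end Oseen

end

/-! ### Parabolic kernels and the derivatives of `Ψ` up to order four -/

noncomputable section

namespace Oseen

/-- A kernel `k(z, s)`, continuous for `s > 0` and bounded by a multiple of the parabolic distance
to the power `-m`. -/
structure IsKer (m : ℕ) (k : E3 → ℝ → ℝ) : Prop where
  cont : ContinuousOn (fun p : E3 × ℝ => k p.1 p.2) (univ ×ˢ Ioi 0)
  bound : ∃ C : ℝ, 0 ≤ C ∧ ∀ (z : E3) (s : ℝ), 0 < s →
    |k z s| ≤ C * (‖z‖ ^ 2 + s) ^ (-(m : ℝ) / 2)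

theorem isKer_radial (n : ℕ) : IsKer (2 * n + 1) (radial n) :=
  ⟨continuousOn_radial n, exists_abs_radial_le n⟩

theorem abs_coord_le (z : E3) (a : Fin 3) : |z a| ≤ ‖z‖ := by
  simpa using EuclideanSpace.norm_eq z ▸ Real.abs_le_sqrt
    (Finset.single_le_sum (f := fun i => ‖z i‖ ^ 2) (fun i _ => by positivity) (Finset.mem_univ a)
      |>.trans_eq' (by simp))

/-- A coordinate is at most the parabolic distance `(|z|² + s)^(1/2)`, so it lowers the order by
one. Orders of the derivatives of `Ψ` can then be read off from their formulas. -/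
theorem IsKer.coord_mul {m : ℕ} {k : E3 → ℝ → ℝ} (h : IsKer (m + 1) k) (a : Fin 3) :
    IsKer m (fun z s => z a * k z s) := by
  refine ⟨ContinuousOn.mul (by fun_prop) h.cont, ?_⟩
  obtain ⟨C, hC, hb⟩ := h.bound
  refine ⟨C, hC, fun z s hs => ?_⟩
  have h0 : 0 < ‖z‖ ^ 2 + s := by positivity
  have e : (‖z‖ ^ 2 + s) ^ (-(m : ℝ) / 2) =
      (‖z‖ ^ 2 + s) ^ (1 / 2 : ℝ) * (‖z‖ ^ 2 + s) ^ (-((m + 1 : ℕ) : ℝ) / 2) := by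
    rw [← Real.rpow_add h0]
    congr 1
    push_cast
    ring
  have h1 : |z a| ≤ (‖z‖ ^ 2 + s) ^ (1 / 2 : ℝ) := by
    rw [← Real.sqrt_eq_rpow]
    exact (abs_coord_le z a).trans (Real.le_sqrt_of_sq_le (by linarith))
  rw [abs_mul, e]
  calc |z a| * |k z s| ≤ (‖z‖ ^ 2 + s) ^ (1 / 2 : ℝ) *
      (C * (‖z‖ ^ 2 + s) ^ (-((m + 1 : ℕ) : ℝ) / 2)) := by gcongr; exact hb z s hs
    _ = _ := by ring

theorem IsKer.const_mul {m : ℕ} {k : E3 → ℝ → ℝ} (h : IsKer m k) (a : ℝ) :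
    IsKer m (fun z s => a * k z s) := by
  refine ⟨continuousOn_const.mul h.cont, ?_⟩
  obtain ⟨C, hC, hb⟩ := h.bound
  refine ⟨|a| * C, by positivity, fun z s hs => ?_⟩
  rw [abs_mul, mul_assoc]
  exact mul_le_mul_of_nonneg_left (hb z s hs) (abs_nonneg a)

theorem IsKer.add {m : ℕ} {k l : E3 → ℝ → ℝ} (h : IsKer m k) (h' : IsKer m l) :
    IsKer m (fun z s => k z s + l z s) := by
  refine ⟨h.cont.add h'.cont, ?_⟩
  obtain ⟨C, hC, hb⟩ := h.bound
  obtain ⟨C', hC', hb'⟩ := h'.bound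
  refine ⟨C + C', by positivity, fun z s hs => ?_⟩
  rw [add_mul]
  exact (abs_add_le _ _).trans (add_le_add (hb z s hs) (hb' z s hs))

theorem IsKer.sum {m : ℕ} {k : Fin 3 → E3 → ℝ → ℝ} (h : ∀ a, IsKer m (k a)) :
    IsKer m (fun z s => ∑ a, k a z s) := by
  simpa only [Fin.sum_univ_three] using ((h 0).add (h 1)).add (h 2)

/-- The Kronecker symbol. -/
def kd (a b : Fin 3) : ℝ := if a = b then 1 else 0

theorem kd_comm (a b : Fin 3) : kd a b = kd b a := by simp [kd, eq_comm]

/-- The linear functional with the given coefficients. -/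
def covec (a : Fin 3 → ℝ) : E3 →L[ℝ] ℝ := ∑ c, a c • (EuclideanSpace.proj c : E3 →L[ℝ] ℝ)

theorem covec_apply (a : Fin 3 → ℝ) (v : E3) : covec a v = ∑ c, a c * v c := by
  simp [covec]

@[simp] theorem covec_single (a : Fin 3 → ℝ) (c : Fin 3) :
    covec a (EuclideanSpace.single c 1) = a c := by
  rw [covec_apply]; simp

theorem continuous_covec : Continuous covec := by
  unfold covec; fun_prop

/-- `k'` lists the partial derivatives of the kernel `k` in the space variables. -/
def HasGrad (k : E3 → ℝ → ℝ) (k' : Fin 3 → E3 → ℝ → ℝ) : Prop :=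
  ∀ (z : E3) (s : ℝ), 0 < s → HasFDerivAt (fun z => k z s) (covec fun c => k' c z s) z

/-- The second derivatives of `Ψ`. -/
def psi2 (a b : Fin 3) (z : E3) (s : ℝ) : ℝ :=
  kd a b * radial 1 z s + z a * (z b * radial 2 z s)

/-- The third derivatives of `Ψ`. -/
def psi3 (a b c : Fin 3) (z : E3) (s : ℝ) : ℝ :=
  kd a b * (z c * radial 2 z s) + kd a c * (z b * radial 2 z s) + kd b c * (z a * radial 2 z s) +
    z a * (z b * (z c * radial 3 z s))

/-- The fourth derivatives of `Ψ`. -/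
def psi4 (a b c d : Fin 3) (z : E3) (s : ℝ) : ℝ :=
  (kd a b * kd c d + kd a c * kd b d + kd b c * kd a d) * radial 2 z s +
    kd a b * (z c * (z d * radial 3 z s)) + kd a c * (z b * (z d * radial 3 z s)) +
    kd b c * (z a * (z d * radial 3 z s)) + kd a d * (z b * (z c * radial 3 z s)) +
    kd b d * (z a * (z c * radial 3 z s)) + kd c d * (z a * (z b * radial 3 z s)) +
    z a * (z b * (z c * (z d * radial 4 z s)))

/-- The time derivatives of `psi2`. -/
def psi2t (a b : Fin 3) (z : E3) (s : ℝ) : ℝ := ∑ m, psi4 a b m m z s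

theorem isKer_psi2 (a b : Fin 3) : IsKer 3 (psi2 a b) :=
  ((isKer_radial 1).const_mul _).add (((isKer_radial 2).coord_mul b).coord_mul a)

theorem isKer_psi3 (a b c : Fin 3) : IsKer 4 (psi3 a b c) :=
  ((((((isKer_radial 2).coord_mul c).const_mul _).add
    (((isKer_radial 2).coord_mul b).const_mul _)).add
    (((isKer_radial 2).coord_mul a).const_mul _))).add
    ((((isKer_radial 3).coord_mul c).coord_mul b).coord_mul a)

theorem isKer_psi4 (a b c d : Fin 3) : IsKer 5 (psi4 a b c d) := by
  have h2 (x y : Fin 3) (r : ℝ) : IsKer 5 (fun z s => r * (z x * (z y * radial 3 z s))) :=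
    (((isKer_radial 3).coord_mul y).coord_mul x).const_mul r
  exact (((((((((isKer_radial 2).const_mul _).add (h2 c d _)).add (h2 b d _)).add
    (h2 a d _)).add (h2 b c _)).add (h2 a c _)).add (h2 a b _))).add
    (((((isKer_radial 4).coord_mul d).coord_mul c).coord_mul b).coord_mul a)

theorem isKer_psi2t (a b : Fin 3) : IsKer 5 (psi2t a b) :=
  IsKer.sum fun m => isKer_psi4 a b m m

theorem hasFDerivAt_coord (a : Fin 3) (z : E3) :
    HasFDerivAt (fun z : E3 => z a) (EuclideanSpace.proj a : E3 →L[ℝ] ℝ) z :=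
  (EuclideanSpace.proj a : E3 →L[ℝ] ℝ).hasFDerivAt

theorem coord_eq_sum_kd (a : Fin 3) (v : E3) :
    v a = kd a 0 * v 0 + kd a 1 * v 1 + kd a 2 * v 2 := by
  fin_cases a <;> simp [kd]

theorem inner_eq_sum_coord (z v : E3) : inner ℝ z v = z 0 * v 0 + z 1 * v 1 + z 2 * v 2 := by
  simp [PiLp.inner_apply, Fin.sum_univ_three, mul_comm]

theorem hasGrad_radial (n : ℕ) : HasGrad (radial n) (fun c z s => z c * radial (n + 1) z s) := by
  intro z s hs
  refine (hasFDerivAt_radial n z hs).congr_fderiv ?_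
  ext v
  simp only [covec_apply, Fin.sum_univ_three, smul_apply, innerSL_apply_apply, inner_eq_sum_coord,
    smul_eq_mul]
  ring

theorem HasGrad.coord_mul {k : E3 → ℝ → ℝ} {k' : Fin 3 → E3 → ℝ → ℝ} (h : HasGrad k k')
    (a : Fin 3) :
    HasGrad (fun z s => z a * k z s) (fun c z s => kd a c * k z s + z a * k' c z s) := by
  intro z s hs
  refine ((hasFDerivAt_coord a z).mul (h z s hs)).congr_fderiv ?_
  ext v
  simp only [covec_apply, Fin.sum_univ_three, smul_apply, add_apply, smul_eq_mul]
  rw [show (EuclideanSpace.proj a : E3 →L[ℝ] ℝ) v = v a from rfl, coord_eq_sum_kd a v]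
  ring

theorem HasGrad.const_mul {k : E3 → ℝ → ℝ} {k' : Fin 3 → E3 → ℝ → ℝ} (h : HasGrad k k')
    (a : ℝ) : HasGrad (fun z s => a * k z s) (fun c z s => a * k' c z s) := by
  intro z s hs
  refine ((h z s hs).const_mul a).congr_fderiv ?_
  ext v
  simp only [covec_apply, Fin.sum_univ_three, smul_apply, smul_eq_mul]
  ring

theorem HasGrad.add {k l : E3 → ℝ → ℝ} {k' l' : Fin 3 → E3 → ℝ → ℝ} (h : HasGrad k k')
    (h' : HasGrad l l') : HasGrad (fun z s => k z s + l z s) (fun c z s => k' c z s + l' c z s) := by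
  intro z s hs
  refine ((h z s hs).add (h' z s hs)).congr_fderiv ?_
  ext v
  simp only [covec_apply, Fin.sum_univ_three, add_apply]
  ring

theorem HasGrad.congr {k : E3 → ℝ → ℝ} {k' l' : Fin 3 → E3 → ℝ → ℝ} (h : HasGrad k k')
    (h' : ∀ c z s, l' c z s = k' c z s) : HasGrad k l' := by
  have : l' = k' := by ext c z s; exact h' c z s
  rwa [this]

theorem HasGrad.sum {k : Fin 3 → E3 → ℝ → ℝ} {k' : Fin 3 → Fin 3 → E3 → ℝ → ℝ}
    (h : ∀ m, HasGrad (k m) (k' m)) :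
    HasGrad (fun z s => ∑ m, k m z s) (fun c z s => ∑ m, k' m c z s) := by
  simpa only [Fin.sum_univ_three] using ((h 0).add (h 1)).add (h 2)

theorem hasGrad_psi1 (a : Fin 3) :
    HasGrad (fun z s => z a * radial 1 z s) (fun c => psi2 a c) :=
  ((hasGrad_radial 1).coord_mul a).congr fun c z s => by rw [psi2]

theorem hasGrad_psi2 (a b : Fin 3) : HasGrad (psi2 a b) (fun c => psi3 a b c) :=
  (((hasGrad_radial 1).const_mul _).add (((hasGrad_radial 2).coord_mul b).coord_mul a)).congr
    fun c z s => by rw [psi3]; ring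

theorem hasGrad_psi3 (a b c : Fin 3) : HasGrad (psi3 a b c) (fun d => psi4 a b c d) :=
  ((((((((hasGrad_radial 2).coord_mul c).const_mul _).add
    (((hasGrad_radial 2).coord_mul b).const_mul _)).add
    (((hasGrad_radial 2).coord_mul a).const_mul _))).add
    ((((hasGrad_radial 3).coord_mul c).coord_mul b).coord_mul a))).congr
    fun d z s => by rw [psi4]; ring

theorem norm_sq_eq_sum_coord (z : E3) : ‖z‖ ^ 2 = z 0 ^ 2 + z 1 ^ 2 + z 2 ^ 2 := by
  rw [EuclideanSpace.norm_sq_eq, Fin.sum_univ_three]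
  simp

/-- The heat equation for the second derivatives of `Ψ`: `psi2t` is defined as a spatial Laplacian,
and the radial time derivatives are matched with it algebraically, by expanding every index through
Kronecker symbols. -/
theorem hasDerivAt_psi2 (a b : Fin 3) (z : E3) {s : ℝ} (hs : 0 < s) :
    HasDerivAt (fun s => psi2 a b z s) (psi2t a b z s) s := by
  refine (((hasDerivAt_radial 1 z hs).const_mul (kd a b)).add
    (((hasDerivAt_radial 2 z hs).const_mul (z b)).const_mul (z a))).congr_deriv ?_
  simp only [psi2t, psi4, Fin.sum_univ_three, norm_sq_eq_sum_coord]
  have h1 := coord_eq_sum_kd a z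
  have h2 := coord_eq_sum_kd b z
  have h3 : kd a b = kd a 0 * kd b 0 + kd a 1 * kd b 1 + kd a 2 * kd b 2 := by
    fin_cases a <;> fin_cases b <;> simp [kd]
  have h4 : kd 0 0 = 1 ∧ kd 1 1 = 1 ∧ kd 2 2 = 1 := by simp [kd]
  rw [h4.1, h4.2.1, h4.2.2]
  push_cast
  linear_combination (2 * radial 2 z s) * h3 + 2 * radial 3 z s * z b * h1 +
    2 * radial 3 z s * z a * h2

/-- Commutation of third derivatives, read off the explicit formula. It is responsible both for `div
v = 0` and for the gradient form of the pressure term. -/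
theorem psi3_perm (a b c : Fin 3) : psi3 a b c = psi3 b a c ∧ psi3 a b c = psi3 a c b := by
  constructor <;> ext z s <;> simp only [psi3]
  · rw [kd_comm a b]; ring
  · rw [kd_comm b c]; ring

theorem psi2_comm (a b : Fin 3) : psi2 a b = psi2 b a := by
  ext z s
  rw [psi2, psi2, kd_comm a b]
  ring

theorem pd_eq_of_hasFDerivAt {f : E3 → ℝ} {a : Fin 3 → ℝ} {x : E3}
    (h : HasFDerivAt f (covec a) x) (c : Fin 3) : pd c f x = a c := by
  rw [pd, h.fderiv, covec_single]

theorem laplacian_eq_sum_of_hasFDerivAt {f : E3 → ℝ} {f' : Fin 3 → E3 → ℝ}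
    {f'' : Fin 3 → Fin 3 → ℝ} {x : E3} (h : ∀ y, HasFDerivAt f (covec fun c => f' c y) y)
    (h' : ∀ c, HasFDerivAt (f' c) (covec (f'' c)) x) :
    Laplacian.laplacian f x = ∑ m, f'' m m := by
  rw [congrFun (InnerProductSpace.laplacian_eq_iteratedFDeriv_orthonormalBasis f
    (EuclideanSpace.basisFun (Fin 3) ℝ)) x]
  refine Finset.sum_congr rfl fun m _ => ?_
  rw [iteratedFDeriv_two_apply]
  have e : fderiv ℝ f = fun y => covec fun c => f' c y := funext fun y => (h y).fderiv
  have h2 : HasFDerivAt (fun y => covec fun c => f' c y)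
      (∑ c, (covec (f'' c)).smulRight (EuclideanSpace.proj c : E3 →L[ℝ] ℝ)) x := by
    unfold covec at h' ⊢
    exact HasFDerivAt.fun_sum fun c _ =>
      (h' c).smul_const (EuclideanSpace.proj c : E3 →L[ℝ] ℝ)
  rw [e, h2.fderiv]
  simp

theorem pd_psi (j : Fin 3) {s : ℝ} (hs : 0 < s) :
    pd j (fun z : E3 => psi ‖z‖ s) = fun z => z j * radial 1 z s := by
  have e : (fun z : E3 => psi ‖z‖ s) = fun z => radial 0 z s :=
    funext fun z => psi_eq_radial z hs
  ext z
  rw [e]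
  exact pd_eq_of_hasFDerivAt (hasGrad_radial 0 z s hs) j

theorem Gam_eq (i j : Fin 3) (z : E3) {s : ℝ} (hs : 0 < s) :
    Gam i j z s = -(kd i j * ∑ m, psi2 m m z s) + psi2 i j z s := by
  have e : (fun z : E3 => psi ‖z‖ s) = fun z => radial 0 z s :=
    funext fun z => psi_eq_radial z hs
  have e2 : pd i (fun z => z j * radial 1 z s) z = psi2 i j z s := by
    rw [psi2_comm i j]
    exact pd_eq_of_hasFDerivAt (hasGrad_psi1 j z s hs) i
  rw [Gam, pd_psi j hs, e2, e,
    laplacian_eq_sum_of_hasFDerivAt (f'' := fun a b => psi2 a b z s)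
      (fun y => hasGrad_radial 0 y s hs) (fun c => hasGrad_psi1 c z s hs), kd]
  split_ifs <;> simp

/-- The derivative `∂_ℓ Γ_{ij}`. -/
def gamD (ℓ i j : Fin 3) (z : E3) (s : ℝ) : ℝ :=
  -(kd i j) * ∑ m, psi3 m m ℓ z s + psi3 i j ℓ z s

theorem hasGrad_Gam (i j : Fin 3) :
    HasGrad (fun z s => -(kd i j) * ∑ m, psi2 m m z s + psi2 i j z s) (fun ℓ => gamD ℓ i j) :=
  ((HasGrad.sum fun m => hasGrad_psi2 m m).const_mul _).add (hasGrad_psi2 i j)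

theorem isKer_gamD (ℓ i j : Fin 3) : IsKer 4 (gamD ℓ i j) :=
  ((IsKer.sum fun m => isKer_psi3 m m ℓ).const_mul _).add (isKer_psi3 i j ℓ)

theorem pd_Gam (ℓ i j : Fin 3) (x y : E3) {s : ℝ} (hs : 0 < s) :
    pd ℓ (fun z : E3 => Gam i j (z - y) s) x = gamD ℓ i j (x - y) s := by
  have h := hasGrad_Gam i j (x - y) s hs
  have h2 := (h.comp x ((hasFDerivAt_id x).sub_const y))
  rw [ContinuousLinearMap.comp_id] at h2
  have e : (fun z : E3 => Gam i j (z - y) s) =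
      (fun z => -(kd i j) * ∑ m, psi2 m m z s + psi2 i j z s) ∘ fun z => id z - y := by
    ext z
    rw [Gam_eq i j _ hs]
    simp
  rw [e]
  exact pd_eq_of_hasFDerivAt h2 ℓ

theorem integrand_eq (F : E3 → ℝ → Tensor3) (i : Fin 3) (x y : E3) {t τ : ℝ} (h : τ < t) :
    integrand F i x t y τ = ∑ ℓ, ∑ j, gamD ℓ i j (x - y) (t - τ) * F y τ (ℓ, j) := by
  simp only [integrand, pd_Gam _ _ _ _ _ (sub_pos.2 h)]

end Oseen

end

/-! ### Spatial convolutions of kernels with densities -/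

noncomputable section

namespace Oseen

open Filter Topology

section ParabolicPowers

theorem integrable_parabolic {γ s : ℝ} (hγ : 3 < γ) (hs : 0 < s) :
    Integrable (fun z : E3 => (‖z‖ ^ 2 + s) ^ (-γ / 2)) := by
  have h := integrable_rpow_neg_one_add_norm_sq (E := E3) (μ := volume) (r := γ) (by simpa using hγ)
  have h2 := (h.comp_smul (R := (√s)⁻¹) (by positivity)).const_mul (s ^ (-γ / 2))
  refine h2.congr (Eventually.of_forall fun z => ?_)
  simp only
  rw [← Real.mul_rpow hs.le (by positivity), norm_smul, mul_pow, Real.norm_eq_abs, sq_abs, inv_pow,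
    Real.sq_sqrt hs.le]
  congr 1
  field_simp
  ring

/-- The substitution `z = √s w`. The power `(3 - γ)/2` decides which orders give a time-integrable
singularity: those with `γ < 5`. -/
theorem integral_parabolic {γ s : ℝ} (hs : 0 < s) :
    ∫ z : E3, (‖z‖ ^ 2 + s) ^ (-γ / 2) =
      s ^ ((3 - γ) / 2) * ∫ z : E3, (1 + ‖z‖ ^ 2) ^ (-γ / 2) := by
  have h := Measure.integral_comp_smul (volume : Measure E3)
    (fun z : E3 => (1 + ‖z‖ ^ 2) ^ (-γ / 2)) (√s)⁻¹
  have e : ∀ z : E3, (‖z‖ ^ 2 + s) ^ (-γ / 2) =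
      s ^ (-γ / 2) * (1 + ‖(√s)⁻¹ • z‖ ^ 2) ^ (-γ / 2) := fun z => by
    rw [← Real.mul_rpow hs.le (by positivity), norm_smul, mul_pow, Real.norm_eq_abs, sq_abs,
      inv_pow, Real.sq_sqrt hs.le]
    congr 1
    field_simp
    ring
  simp_rw [e]
  rw [integral_const_mul, h, smul_eq_mul, ← mul_assoc]
  congr 1
  rw [finrank_euclideanSpace_fin, inv_pow, inv_inv, abs_of_nonneg (by positivity),
    Real.sqrt_eq_rpow, ← Real.rpow_natCast, ← Real.rpow_mul hs.le, ← Real.rpow_add hs]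
  congr 1
  push_cast
  ring

end ParabolicPowers

section KernelBounds

variable {m : ℕ} {k : E3 → ℝ → ℝ}

theorem IsKer.continuous (h : IsKer m k) {s : ℝ} (hs : 0 < s) : Continuous fun z => k z s :=
  h.cont.comp_continuous (f := fun z : E3 => (z, s)) (by fun_prop) fun z => ⟨mem_univ _, hs⟩

theorem IsKer.continuousAt (h : IsKer m k) (z : E3) {s : ℝ} (hs : 0 < s) :
    ContinuousAt (fun p : E3 × ℝ => k p.1 p.2) (z, s) :=
  h.cont.continuousAt ((isOpen_univ.prod isOpen_Ioi).mem_nhds ⟨mem_univ _, hs⟩)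

theorem IsKer.bound_time (h : IsKer m k) : ∃ C : ℝ, 0 ≤ C ∧ ∀ (z : E3) (s s₀ : ℝ), 0 < s₀ →
    s₀ ≤ s → |k z s| ≤ C * s₀ ^ (-(m : ℝ) / 2) := by
  obtain ⟨C, hC, hb⟩ := h.bound
  refine ⟨C, hC, fun z s s₀ hs₀ hs => (hb z s (hs₀.trans_le hs)).trans ?_⟩
  refine mul_le_mul_of_nonneg_left (Real.rpow_le_rpow_of_nonpos hs₀ ?_ ?_) hC
  · nlinarith [sq_nonneg ‖z‖]
  · have : (0 : ℝ) ≤ m := m.cast_nonneg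
    linarith

theorem IsKer.integrable (h : IsKer m k) (hm : 3 < m) {s : ℝ} (hs : 0 < s) :
    Integrable fun z => k z s := by
  obtain ⟨C, hC, hb⟩ := h.bound
  refine ((integrable_parabolic (γ := m) (by exact_mod_cast hm) hs).const_mul C).mono'
    (h.continuous hs).aestronglyMeasurable (Eventually.of_forall fun z => hb z s hs)

/-- Integration by parts against the constant function 1; both orders exceed 3, so everything is
integrable and no boundary term arises. -/
theorem integral_grad_eq_zero {m' : ℕ} {k' : Fin 3 → E3 → ℝ → ℝ} (h : IsKer m k) (hm : 3 < m)
    (hg : HasGrad k k') {c : Fin 3} (h' : IsKer m' (k' c)) (hm' : 3 < m') {s : ℝ} (hs : 0 < s) :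
    ∫ z, k' c z s = 0 := by
  have := integral_bilinear_hasLineDerivAt_right_eq_neg_left_of_integrable (μ := volume)
    (f := fun _ : E3 => (1 : ℝ)) (f' := fun _ => 0) (g := fun z => k z s) (g' := fun z => k' c z s)
    (v := EuclideanSpace.single c 1) (B := ContinuousLinearMap.mul ℝ ℝ)
    (by simp) (by simpa using h'.integrable hm' hs) (by simpa using h.integrable hm hs)
    (fun x _ => by
      simpa using (hasFDerivAt_const (1 : ℝ) x).hasLineDerivAt (EuclideanSpace.single c (1 : ℝ)))
    (fun x _ => by simpa using (hg x s hs).hasLineDerivAt (EuclideanSpace.single c (1 : ℝ)))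
  simpa using this

end KernelBounds

/-- A density: continuous in the slab, bounded, with spatial support in a fixed ball. -/
structure IsDens (t₁ t₂ : ℝ) (G : E3 → ℝ → ℝ) : Prop where
  cont : ContinuousOn (fun p : E3 × ℝ => G p.1 p.2) (slab t₁ t₂)
  bound : ∃ M : ℝ, 0 ≤ M ∧ ∀ t ∈ Ioo t₁ t₂, ∀ x, |G x t| ≤ M
  support : ∃ R : ℝ, ∀ t ∈ Ioo t₁ t₂, ∀ x : E3, R < ‖x‖ → G x t = 0

/-- Hölder continuity in the space variable, uniformly in time. -/
def IsHolder (t₁ t₂ : ℝ) (G : E3 → ℝ → ℝ) : Prop :=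
  ∃ H α : ℝ, 0 ≤ H ∧ 0 < α ∧ α ≤ 1 ∧ ∀ t ∈ Ioo t₁ t₂, ∀ x y, |G x t - G y t| ≤ H * ‖x - y‖ ^ α

/-- The convolution of a kernel with a density in the space variable. -/
def cv (k : E3 → ℝ → ℝ) (G : E3 → ℝ → ℝ) (x : E3) (s τ : ℝ) : ℝ := ∫ y, k (x - y) s * G y τ

section Convolution

variable {t₁ t₂ : ℝ} {m : ℕ} {k : E3 → ℝ → ℝ} {G : E3 → ℝ → ℝ}

theorem IsDens.continuous (hG : IsDens t₁ t₂ G) {τ : ℝ} (hτ : τ ∈ Ioo t₁ t₂) :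
    Continuous fun y => G y τ :=
  hG.cont.comp_continuous (f := fun y : E3 => (y, τ)) (by fun_prop) fun y => ⟨mem_univ _, hτ⟩

theorem isOpen_slab : IsOpen (slab t₁ t₂) := isOpen_univ.prod isOpen_Ioo

theorem IsDens.continuousAt (hG : IsDens t₁ t₂ G) (y : E3) {τ : ℝ} (hτ : τ ∈ Ioo t₁ t₂) :
    ContinuousAt (fun p : E3 × ℝ => G p.1 p.2) (y, τ) :=
  hG.cont.continuousAt (isOpen_slab.mem_nhds ⟨mem_univ _, hτ⟩)

theorem continuous_conv_integrand (hk : IsKer m k) (hG : IsDens t₁ t₂ G) (x : E3) {s τ : ℝ}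
    (hs : 0 < s) (hτ : τ ∈ Ioo t₁ t₂) : Continuous fun y => k (x - y) s * G y τ :=
  ((hk.continuous hs).comp (continuous_const.sub continuous_id)).mul (hG.continuous hτ)

/-- Away from `s = 0` the kernel is bounded uniformly in space, and the density is bounded with
support in a fixed ball. One dominating function therefore serves all `x`, `τ` and `s ≥ s₀`, which
is what continuity and differentiation under the integral need. -/
theorem exists_conv_dominating (hk : IsKer m k) (hG : IsDens t₁ t₂ G) {s₀ : ℝ} (hs₀ : 0 < s₀) :
    ∃ b : E3 → ℝ, Integrable b ∧ ∀ x s τ, s₀ ≤ s → τ ∈ Ioo t₁ t₂ → ∀ y,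
      ‖k (x - y) s * G y τ‖ ≤ b y := by
  obtain ⟨C, hC, hb⟩ := hk.bound_time
  obtain ⟨M, hM, hbM⟩ := hG.bound
  obtain ⟨R, hR⟩ := hG.support
  refine ⟨(Metric.closedBall 0 R).indicator fun _ => C * s₀ ^ (-(m : ℝ) / 2) * M,
    (integrable_indicator_iff Metric.isClosed_closedBall.measurableSet).2
      (integrableOn_const (isCompact_closedBall _ _).measure_lt_top.ne), fun x s τ hs hτ y => ?_⟩
  by_cases hy : y ∈ Metric.closedBall (0 : E3) R
  · rw [indicator_of_mem hy, norm_mul]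
    exact mul_le_mul (hb _ _ _ hs₀ hs) (hbM τ hτ y) (norm_nonneg _) (by positivity)
  · rw [indicator_of_notMem hy, hR τ hτ y (by simpa using hy), mul_zero, norm_zero]

theorem integrable_conv_integrand (hk : IsKer m k) (hG : IsDens t₁ t₂ G) (x : E3) {s τ : ℝ}
    (hs : 0 < s) (hτ : τ ∈ Ioo t₁ t₂) : Integrable fun y => k (x - y) s * G y τ := by
  obtain ⟨b, hb, hb'⟩ := exists_conv_dominating hk hG hs
  exact hb.mono' (continuous_conv_integrand hk hG x hs hτ).aestronglyMeasurable
    (Eventually.of_forall (hb' x s τ le_rfl hτ))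

theorem continuousOn_cv (hk : IsKer m k) (hG : IsDens t₁ t₂ G) :
    ContinuousOn (fun p : E3 × ℝ × ℝ => cv k G p.1 p.2.1 p.2.2)
      (univ ×ˢ Ioi 0 ×ˢ Ioo t₁ t₂) := by
  rintro ⟨x, s, τ⟩ ⟨-, hs, hτ⟩
  refine ContinuousAt.continuousWithinAt ?_
  have hs : 0 < s := hs
  obtain ⟨b, hb, hb'⟩ := exists_conv_dominating hk hG (half_pos hs)
  have hev : ∀ᶠ p : E3 × ℝ × ℝ in 𝓝 (x, s, τ), s / 2 < p.2.1 ∧ p.2.2 ∈ Ioo t₁ t₂ := by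
    have : univ ×ˢ Ioi (s / 2) ×ˢ Ioo t₁ t₂ ∈ 𝓝 (x, s, τ) :=
      (isOpen_univ.prod (isOpen_Ioi.prod isOpen_Ioo)).mem_nhds
        ⟨mem_univ _, half_lt_self hs, hτ⟩
    filter_upwards [this] with p hp using hp.2
  refine continuousAt_of_dominated (bound := b) ?_ ?_ hb (Eventually.of_forall fun y => ?_)
  · filter_upwards [hev] with p hp
    exact (continuous_conv_integrand hk hG _ ((half_pos hs).trans hp.1) hp.2).aestronglyMeasurable
  · filter_upwards [hev] with p hp
    exact Eventually.of_forall (hb' _ _ _ hp.1.le hp.2)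
  · refine ContinuousAt.mul ?_ ?_
    · exact ContinuousAt.comp (f := fun p : E3 × ℝ × ℝ => (p.1 - y, p.2.1)) (x := (x, s, τ))
        (hk.continuousAt (x - y) hs) (by fun_prop)
    · exact ContinuousAt.comp (f := fun p : E3 × ℝ × ℝ => (y, p.2.2)) (x := (x, s, τ))
        (hG.continuousAt y hτ) (by fun_prop)

theorem norm_covec_le (a : Fin 3 → ℝ) : ‖covec a‖ ≤ ∑ c, |a c| := by
  refine (norm_sum_le _ _).trans (Finset.sum_le_sum fun c _ => ?_)
  rw [norm_smul]
  refine mul_le_of_le_one_right (abs_nonneg _) ?_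
  exact ContinuousLinearMap.opNorm_le_bound _ zero_le_one fun v => by
    simpa using abs_coord_le v c

theorem integral_covec {X : Type*} [MeasurableSpace X] {μ : Measure X} {f : Fin 3 → X → ℝ}
    (hf : ∀ c, Integrable (f c) μ) :
    ∫ y, covec (fun c => f c y) ∂μ = covec fun c => ∫ y, f c y ∂μ := by
  simp only [covec]
  rw [integral_finsetSum _ fun c _ => (hf c).smul_const _]
  simp_rw [integral_smul_const]

theorem hasFDerivAt_cv {m' : ℕ} {k' : Fin 3 → E3 → ℝ → ℝ} (hk : IsKer m k) (hg : HasGrad k k')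
    (hk' : ∀ c, IsKer m' (k' c)) (hG : IsDens t₁ t₂ G) (x : E3) {s τ : ℝ} (hs : 0 < s)
    (hτ : τ ∈ Ioo t₁ t₂) :
    HasFDerivAt (fun x => cv k G x s τ) (covec fun c => cv (k' c) G x s τ) x := by
  choose b hb hb' using fun c => exists_conv_dominating (hk' c) hG hs
  have h := hasFDerivAt_integral_of_dominated_of_fderiv_le (μ := volume)
    (F := fun (x y : E3) => k (x - y) s * G y τ)
    (F' := fun (x y : E3) => covec fun c => k' c (x - y) s * G y τ) (x₀ := x) (s := univ)
    (bound := fun y => ∑ c, b c y) univ_mem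
    (Eventually.of_forall fun x =>
      (continuous_conv_integrand hk hG x hs hτ).aestronglyMeasurable)
    (integrable_conv_integrand hk hG x hs hτ)
    (continuous_covec.comp (continuous_pi fun c =>
      continuous_conv_integrand (hk' c) hG x hs hτ)).aestronglyMeasurable
    (Eventually.of_forall fun y x _ => (norm_covec_le _).trans
      (Finset.sum_le_sum fun c _ => hb' c x s τ le_rfl hτ y))
    (integrable_finsetSum _ fun c _ => hb c)
    (Eventually.of_forall fun y x _ => ?_)
  · refine h.congr_fderiv ?_
    rw [integral_covec fun c => integrable_conv_integrand (hk' c) hG x hs hτ]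
    rfl
  · have h1 := (hg (x - y) s hs).comp x ((hasFDerivAt_id x).sub_const y)
    rw [ContinuousLinearMap.comp_id] at h1
    refine (h1.mul_const (G y τ)).congr_fderiv ?_
    ext v
    simp only [smul_apply, covec_apply, smul_eq_mul, Finset.mul_sum]
    exact Finset.sum_congr rfl fun c _ => by ring

theorem hasDerivAt_cv {m' : ℕ} {kt : E3 → ℝ → ℝ} (hk : IsKer m k)
    (hd : ∀ (z : E3) (s : ℝ), 0 < s → HasDerivAt (fun s => k z s) (kt z s) s)
    (hk' : IsKer m' kt) (hG : IsDens t₁ t₂ G) (x : E3) {s τ : ℝ} (hs : 0 < s)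
    (hτ : τ ∈ Ioo t₁ t₂) :
    HasDerivAt (fun s => cv k G x s τ) (cv kt G x s τ) s := by
  obtain ⟨b, hb, hb'⟩ := exists_conv_dominating hk' hG (half_pos hs)
  have hev : Ioi (s / 2) ∈ 𝓝 s := Ioi_mem_nhds (half_lt_self hs)
  refine (hasDerivAt_integral_of_dominated_loc_of_deriv_le (μ := volume)
    (F := fun (s : ℝ) (y : E3) => k (x - y) s * G y τ)
    (F' := fun (s : ℝ) (y : E3) => kt (x - y) s * G y τ) (x₀ := s) (s := Ioi (s / 2))
    (bound := b) hev ?_ (integrable_conv_integrand hk hG x hs hτ)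
    (continuous_conv_integrand hk' hG x hs hτ).aestronglyMeasurable
    (Eventually.of_forall fun y r hr => hb' x r τ (le_of_lt hr) hτ y) hb
    (Eventually.of_forall fun y r hr => ?_)).2
  · filter_upwards [hev] with r hr
    exact (continuous_conv_integrand hk hG x ((half_pos hs).trans hr) hτ).aestronglyMeasurable
  · exact (hd (x - y) r ((half_pos hs).trans hr)).mul_const _

/-- Integration by parts moves a derivative from the kernel to the density. The two minus signs, one
from the parts and one from the argument `x - y`, cancel. -/
theorem cv_grad_eq {m' : ℕ} {k' : Fin 3 → E3 → ℝ → ℝ} (hk : IsKer m k) (hg : HasGrad k k')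
    {c : Fin 3} (hk' : IsKer m' (k' c)) (hG : IsDens t₁ t₂ G)
    (hd : ∀ t ∈ Ioo t₁ t₂, Differentiable ℝ fun y => G y t)
    (hG' : IsDens t₁ t₂ fun y t => pd c (fun y => G y t) y) (x : E3) {s τ : ℝ} (hs : 0 < s)
    (hτ : τ ∈ Ioo t₁ t₂) :
    cv (k' c) G x s τ = cv k (fun y t => pd c (fun y => G y t) y) x s τ := by
  have := integral_bilinear_hasLineDerivAt_right_eq_neg_left_of_integrable (μ := volume)
    (f := fun y : E3 => k (x - y) s) (f' := fun y => -k' c (x - y) s) (g := fun y => G y τ)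
    (g' := fun y => pd c (fun y => G y τ) y)
    (v := EuclideanSpace.single c 1) (B := ContinuousLinearMap.mul ℝ ℝ)
    (by simpa using (integrable_conv_integrand hk' hG x hs hτ))
    (by simpa using (integrable_conv_integrand hk hG' x hs hτ))
    (by simpa using (integrable_conv_integrand hk hG x hs hτ))
    (fun y _ => by
      have h1 : HasFDerivAt (fun y => k (x - y) s) _ y :=
        (hg (x - y) s hs).comp y ((hasFDerivAt_id y).const_sub x)
      simpa using h1.hasLineDerivAt (EuclideanSpace.single c (1 : ℝ)))
    (fun y _ => (hd τ hτ y).hasFDerivAt.hasLineDerivAt (EuclideanSpace.single c (1 : ℝ)))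
  simp only [ContinuousLinearMap.mul_apply', neg_mul, integral_neg, neg_neg] at this
  exact this.symm

/-- The absolute value stays inside the integral, because this bound also gives absolute convergence
on the slab. For order 4 the right-hand side is `D s^(-1/2)`. -/
theorem exists_abs_cv_le (hk : IsKer m k) (hm : 3 < m) (hG : IsDens t₁ t₂ G) :
    ∃ D : ℝ, 0 ≤ D ∧ ∀ x s τ, 0 < s → τ ∈ Ioo t₁ t₂ →
      ∫ y, |k (x - y) s * G y τ| ≤ D * s ^ ((3 - m : ℝ) / 2) := by
  obtain ⟨C, hC, hb⟩ := hk.bound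
  obtain ⟨M, hM, hbM⟩ := hG.bound
  have hm' : (3 : ℝ) < m := by exact_mod_cast hm
  refine ⟨C * M * ∫ z : E3, (1 + ‖z‖ ^ 2) ^ (-(m : ℝ) / 2),
    mul_nonneg (by positivity) (integral_nonneg fun z => by positivity),
    fun x s τ hs hτ => ?_⟩
  calc ∫ y, |k (x - y) s * G y τ|
      ≤ ∫ y, C * M * (‖x - y‖ ^ 2 + s) ^ (-(m : ℝ) / 2) := by
        refine integral_mono_of_nonneg (Eventually.of_forall fun y => abs_nonneg _)
          (((integrable_parabolic hm' hs).comp_sub_left x).const_mul _)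
          (Eventually.of_forall fun y => ?_)
        simp only [abs_mul]
        calc |k (x - y) s| * |G y τ| ≤ C * (‖x - y‖ ^ 2 + s) ^ (-(m : ℝ) / 2) * M := by
              gcongr
              · exact hb _ s hs
              · exact hbM τ hτ y
          _ = _ := by ring
    _ = _ := by
      rw [integral_const_mul, integral_sub_left_eq_self
        (fun z : E3 => (‖z‖ ^ 2 + s) ^ (-(m : ℝ) / 2)) volume x, integral_parabolic hs]
      ring

theorem exists_abs_cv_le' (hk : IsKer m k) (hm : 3 < m) (hG : IsDens t₁ t₂ G) :
    ∃ D : ℝ, 0 ≤ D ∧ ∀ x s τ, 0 < s → τ ∈ Ioo t₁ t₂ →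
      |cv k G x s τ| ≤ D * s ^ ((3 - m : ℝ) / 2) := by
  obtain ⟨D, hD, h⟩ := exists_abs_cv_le hk hm hG
  exact ⟨D, hD, fun x s τ hs hτ => abs_integral_le_integral_abs.trans (h x s τ hs hτ)⟩

/-- Subtracting `G x τ` inside the integral leaves a Hölder increment, and `|x - y|^α` is at most
the parabolic distance to the power `α`. The effective order drops to `5 - α`, so the borderline
singularity `s⁻¹` becomes `s^(α/2-1)`. The mean of the kernel is kept, so that the lemma serves
mean-zero kernels and the heat kernel alike. -/
theorem exists_abs_cv_sub_le (hk : IsKer 5 k) (hG : IsDens t₁ t₂ G) (hH : IsHolder t₁ t₂ G) :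
    ∃ D β : ℝ, 0 ≤ D ∧ 0 < β ∧ ∀ x s τ, 0 < s → τ ∈ Ioo t₁ t₂ →
      |cv k G x s τ - (∫ z, k z s) * G x τ| ≤ D * s ^ (β - 1) := by
  obtain ⟨C, hC, hb⟩ := hk.bound
  obtain ⟨H, α, hH0, hα, hα1, hH⟩ := hH
  have h5 : (3 : ℝ) < 5 - α := by linarith
  refine ⟨C * H * ∫ z : E3, (1 + ‖z‖ ^ 2) ^ (-(5 - α) / 2), α / 2,
    mul_nonneg (by positivity) (integral_nonneg fun z => by positivity), by positivity,
    fun x s τ hs hτ => ?_⟩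
  have e1 : (∫ z, k z s) * G x τ = ∫ y, k (x - y) s * G x τ := by
    rw [integral_mul_const, integral_sub_left_eq_self (fun z : E3 => k z s) volume x]
  rw [e1, cv, ← integral_sub (integrable_conv_integrand hk hG x hs hτ)
    (((hk.integrable (by norm_num) hs).comp_sub_left x).mul_const _)]
  refine abs_integral_le_integral_abs.trans ?_
  calc ∫ y, |k (x - y) s * G y τ - k (x - y) s * G x τ|
      ≤ ∫ y, C * H * (‖x - y‖ ^ 2 + s) ^ (-(5 - α) / 2) := by
        refine integral_mono_of_nonneg (Eventually.of_forall fun y => abs_nonneg _)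
          (((integrable_parabolic h5 hs).comp_sub_left x).const_mul _)
          (Eventually.of_forall fun y => ?_)
        simp only [← mul_sub, abs_mul]
        have h0 : 0 < ‖x - y‖ ^ 2 + s := by positivity
        have h1 : ‖x - y‖ ^ α ≤ (‖x - y‖ ^ 2 + s) ^ (α / 2) := by
          calc ‖x - y‖ ^ α = (‖x - y‖ ^ 2) ^ (α / 2) := by
                rw [← Real.rpow_natCast, ← Real.rpow_mul (norm_nonneg _)]
                congr 1
                push_cast
                ring
            _ ≤ _ := by gcongr; linarith
        calc |k (x - y) s| * |G y τ - G x τ|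
            ≤ C * (‖x - y‖ ^ 2 + s) ^ (-((5 : ℕ) : ℝ) / 2) *
              (H * (‖x - y‖ ^ 2 + s) ^ (α / 2)) := by
              gcongr
              · exact hb _ s hs
              · rw [abs_sub_comm]
                exact (hH τ hτ x y).trans (by gcongr)
          _ = C * H * ((‖x - y‖ ^ 2 + s) ^ (-((5 : ℕ) : ℝ) / 2) *
              (‖x - y‖ ^ 2 + s) ^ (α / 2)) := by ring
          _ = _ := by
              rw [← Real.rpow_add h0]
              congr 2
              push_cast
              ring
    _ = _ := by
      rw [integral_const_mul, integral_sub_left_eq_self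
        (fun z : E3 => (‖z‖ ^ 2 + s) ^ (-(5 - α) / 2)) volume x, integral_parabolic hs]
      rw [show (3 - (5 - α)) / 2 = α / 2 - 1 by ring]
      ring

end Convolution

theorem integral_psi4_eq_zero (a b c d : Fin 3) {s : ℝ} (hs : 0 < s) : ∫ z, psi4 a b c d z s = 0 :=
  integral_grad_eq_zero (isKer_psi3 a b c) (by norm_num) (hasGrad_psi3 a b c)
    (isKer_psi4 a b c d) (by norm_num) hs

theorem integral_psi2t_eq_zero (a b : Fin 3) {s : ℝ} (hs : 0 < s) : ∫ z, psi2t a b z s = 0 := by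
  simp only [psi2t]
  rw [integral_finsetSum _ fun m _ => (isKer_psi4 a b m m).integrable (by norm_num) hs]
  simp [integral_psi4_eq_zero _ _ _ _ hs]

end Oseen

end

/-! ### Time integrals with an integrable singularity -/

noncomputable section

namespace Oseen

open Filter Topology

/-- A function of `(x, s, τ)`, continuous for `s > 0` and `τ ∈ (t₁, t₂)`, with an integrable
singularity at `s = 0`. -/
structure IsField (t₁ t₂ : ℝ) (W : E3 → ℝ → ℝ → ℝ) : Prop where
  cont : ContinuousOn (fun p : E3 × ℝ × ℝ => W p.1 p.2.1 p.2.2) (univ ×ˢ Ioi 0 ×ˢ Ioo t₁ t₂)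
  bound : ∃ D β : ℝ, 0 ≤ D ∧ 0 < β ∧ ∀ x s τ, 0 < s → τ ∈ Ioo t₁ t₂ → |W x s τ| ≤ D * s ^ (β - 1)

/-- The Duhamel integral. -/
def duhamel (t₁ : ℝ) (W : E3 → ℝ → ℝ → ℝ) (x : E3) (t : ℝ) : ℝ := ∫ τ in t₁..t, W x (t - τ) τ

/-- The integral over `s ∈ (0, 1)`. -/
def unitInt (W : E3 → ℝ → ℝ → ℝ) (x : E3) (t : ℝ) : ℝ := ∫ s in (0 : ℝ)..1, W x s t

section

variable {t₁ t₂ : ℝ} {W : E3 → ℝ → ℝ → ℝ}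

theorem integrableOn_rpow_Ioo {β : ℝ} (hβ : 0 < β) (L : ℝ) :
    IntegrableOn (fun s : ℝ => s ^ (β - 1)) (Ioo 0 L) := by
  rcases le_or_gt L 0 with h | h
  · simp [Ioo_eq_empty (not_lt.2 h)]
  · have := (intervalIntegral.intervalIntegrable_rpow' (a := 0) (b := L) (r := β - 1)
      (by linarith))
    rw [intervalIntegrable_iff_integrableOn_Ioo_of_le h.le] at this
    exact this

theorem integrableOn_rpow_sub_Ioo {β : ℝ} (hβ : 0 < β) (a t : ℝ) :
    IntegrableOn (fun τ : ℝ => (t - τ) ^ (β - 1)) (Ioo a t) := by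
  have h := ((integrable_indicator_iff measurableSet_Ioo).2
    (integrableOn_rpow_Ioo hβ (t - a))).comp_sub_left t
  rw [← integrable_indicator_iff measurableSet_Ioo]
  refine h.congr (Eventually.of_forall fun τ => ?_)
  simp only [indicator, mem_Ioo]
  refine if_congr ?_ rfl rfl
  constructor <;> rintro ⟨h1, h2⟩ <;> constructor <;> linarith

theorem IsField.comp_continuousOn (hW : IsField t₁ t₂ W) {X : Type*} [TopologicalSpace X]
    {S : Set X} {ξ : X → E3} {σ θ : X → ℝ} (hξ : ContinuousOn ξ S) (hσ : ContinuousOn σ S)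
    (hθ : ContinuousOn θ S)
    (hpos : ∀ r ∈ S, 0 < σ r) (hmem : ∀ r ∈ S, θ r ∈ Ioo t₁ t₂) :
    ContinuousOn (fun r => W (ξ r) (σ r) (θ r)) S :=
  hW.cont.comp (f := fun r => (ξ r, σ r, θ r)) (hξ.prodMk (hσ.prodMk hθ))
    fun r hr => ⟨mem_univ _, hpos r hr, hmem r hr⟩

theorem IsField.continuousAt_comp (hW : IsField t₁ t₂ W) {X : Type*} [TopologicalSpace X]
    {ξ : X → E3} {σ θ : X → ℝ} {r : X} (hξ : ContinuousAt ξ r) (hσ : ContinuousAt σ r)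
    (hθ : ContinuousAt θ r) (hpos : 0 < σ r) (hmem : θ r ∈ Ioo t₁ t₂) :
    ContinuousAt (fun r => W (ξ r) (σ r) (θ r)) r :=
  ContinuousAt.comp (f := fun r => (ξ r, σ r, θ r)) (x := r)
    (hW.cont.continuousAt ((isOpen_univ.prod (isOpen_Ioi.prod isOpen_Ioo)).mem_nhds
      ⟨mem_univ _, hpos, hmem⟩)) (hξ.prodMk (hσ.prodMk hθ))

/-- The curve `(σ, θ)` is left general to treat two cases at once: `(t - τ, τ)` for Duhamel
integrals, and `(s, t)` with fixed `t` for integrals over the kernel time alone. -/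
theorem IsField.integrableOn_along (hW : IsField t₁ t₂ W) {S : Set ℝ} (hS : MeasurableSet S)
    {σ θ : ℝ → ℝ} (hσ : Continuous σ) (hθ : Continuous θ) (hpos : ∀ r ∈ S, 0 < σ r)
    (hmem : ∀ r ∈ S, θ r ∈ Ioo t₁ t₂)
    (hint : ∀ β : ℝ, 0 < β → IntegrableOn (fun r => σ r ^ (β - 1)) S) (x : E3) :
    IntegrableOn (fun r => W x (σ r) (θ r)) S := by
  obtain ⟨D, β, hD, hβ, hb⟩ := hW.bound
  refine ((hint β hβ).const_mul D).mono' ?_ ?_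
  · exact (hW.comp_continuousOn continuousOn_const hσ.continuousOn hθ.continuousOn hpos
      hmem).aestronglyMeasurable hS
  · exact (ae_restrict_iff' hS).2 (Eventually.of_forall fun r hr => hb x _ _ (hpos r hr) (hmem r hr))

theorem IsField.hasFDerivAt_along {W' : Fin 3 → E3 → ℝ → ℝ → ℝ} (hW : IsField t₁ t₂ W)
    (hW' : ∀ c, IsField t₁ t₂ (W' c))
    (hg : ∀ x s τ, 0 < s → τ ∈ Ioo t₁ t₂ →
      HasFDerivAt (fun x => W x s τ) (covec fun c => W' c x s τ) x)
    {S : Set ℝ} (hS : MeasurableSet S)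
    {σ θ : ℝ → ℝ} (hσ : Continuous σ) (hθ : Continuous θ) (hpos : ∀ r ∈ S, 0 < σ r)
    (hmem : ∀ r ∈ S, θ r ∈ Ioo t₁ t₂)
    (hint : ∀ β : ℝ, 0 < β → IntegrableOn (fun r => σ r ^ (β - 1)) S) (x : E3) :
    HasFDerivAt (fun x => ∫ r in S, W x (σ r) (θ r))
      (covec fun c => ∫ r in S, W' c x (σ r) (θ r)) x := by
  choose D β hD hβ hb using fun c => (hW' c).bound
  have hmeas {V : E3 → ℝ → ℝ → ℝ} (hV : IsField t₁ t₂ V) (x : E3) :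
      AEStronglyMeasurable (fun r => V x (σ r) (θ r)) (volume.restrict S) :=
    (hV.comp_continuousOn continuousOn_const hσ.continuousOn hθ.continuousOn hpos
      hmem).aestronglyMeasurable hS
  have h := hasFDerivAt_integral_of_dominated_of_fderiv_le (μ := volume.restrict S)
    (F := fun (x : E3) (r : ℝ) => W x (σ r) (θ r))
    (F' := fun (x : E3) (r : ℝ) => covec fun c => W' c x (σ r) (θ r)) (x₀ := x) (s := univ)
    (bound := fun r => ∑ c, D c * σ r ^ (β c - 1)) univ_mem
    (Eventually.of_forall fun x => hmeas hW x)
    (hW.integrableOn_along hS hσ hθ hpos hmem hint x)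
    (continuous_covec.comp_aestronglyMeasurable
      (aemeasurable_pi_lambda _ fun c => (hmeas (hW' c) x).aemeasurable).aestronglyMeasurable)
    ((ae_restrict_iff' hS).2 (Eventually.of_forall fun r hr x _ => (norm_covec_le _).trans
      (Finset.sum_le_sum fun c _ => hb c x _ _ (hpos r hr) (hmem r hr))))
    (integrable_finsetSum _ fun c _ => (hint _ (hβ c)).const_mul _)
    ((ae_restrict_iff' hS).2 (Eventually.of_forall fun r hr x _ =>
      hg x _ _ (hpos r hr) (hmem r hr)))
  refine h.congr_fderiv ?_
  rw [integral_covec fun c => (hW' c).integrableOn_along hS hσ hθ hpos hmem hint x]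

theorem duhamel_eq {x : E3} {t : ℝ} (ht : t₁ < t) :
    duhamel t₁ W x t = ∫ τ in Ioo t₁ t, W x (t - τ) τ := by
  rw [duhamel, intervalIntegral.integral_of_le ht.le, integral_Ioc_eq_integral_Ioo]

theorem unitInt_eq {x : E3} {t : ℝ} : unitInt W x t = ∫ s in Ioo (0 : ℝ) 1, W x s t := by
  rw [unitInt, intervalIntegral.integral_of_le zero_le_one, integral_Ioc_eq_integral_Ioo]

theorem IsField.integrableOn_duhamel (hW : IsField t₁ t₂ W) (x : E3) {t : ℝ} (ht : t ∈ Ioo t₁ t₂) :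
    IntegrableOn (fun τ => W x (t - τ) τ) (Ioo t₁ t) :=
  hW.integrableOn_along measurableSet_Ioo (by fun_prop) continuous_id
    (fun r hr => sub_pos.2 hr.2) (fun r hr => ⟨hr.1, hr.2.trans ht.2⟩)
    (fun β hβ => integrableOn_rpow_sub_Ioo hβ t₁ t) x

theorem IsField.integrableOn_initial (hW : IsField t₁ t₂ W) (x : E3) {t : ℝ} (ht : t ∈ Ioo t₁ t₂)
    (L : ℝ) : IntegrableOn (fun s => W x s t) (Ioo 0 L) :=
  hW.integrableOn_along measurableSet_Ioo continuous_id continuous_const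
    (fun _ hr => hr.1) (fun _ _ => ht) (fun _ hβ => integrableOn_rpow_Ioo hβ L) x

theorem IsField.hasFDerivAt_duhamel {W' : Fin 3 → E3 → ℝ → ℝ → ℝ} (hW : IsField t₁ t₂ W)
    (hW' : ∀ c, IsField t₁ t₂ (W' c))
    (hg : ∀ x s τ, 0 < s → τ ∈ Ioo t₁ t₂ →
      HasFDerivAt (fun x => W x s τ) (covec fun c => W' c x s τ) x) (x : E3) {t : ℝ}
    (ht : t ∈ Ioo t₁ t₂) :
    HasFDerivAt (fun x => duhamel t₁ W x t) (covec fun c => duhamel t₁ (W' c) x t) x := by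
  simp only [duhamel_eq ht.1]
  exact hW.hasFDerivAt_along hW' hg measurableSet_Ioo (by fun_prop) continuous_id
    (fun r hr => sub_pos.2 hr.2) (fun r hr => ⟨hr.1, hr.2.trans ht.2⟩)
    (fun β hβ => integrableOn_rpow_sub_Ioo hβ t₁ t) x

theorem IsField.hasFDerivAt_unitInt {W' : Fin 3 → E3 → ℝ → ℝ → ℝ} (hW : IsField t₁ t₂ W)
    (hW' : ∀ c, IsField t₁ t₂ (W' c))
    (hg : ∀ x s τ, 0 < s → τ ∈ Ioo t₁ t₂ →
      HasFDerivAt (fun x => W x s τ) (covec fun c => W' c x s τ) x) (x : E3) {t : ℝ}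
    (ht : t ∈ Ioo t₁ t₂) :
    HasFDerivAt (fun x => unitInt W x t) (covec fun c => unitInt (W' c) x t) x := by
  simp only [unitInt_eq]
  exact hW.hasFDerivAt_along hW' hg measurableSet_Ioo continuous_id continuous_const
    (fun r hr => hr.1) (fun r hr => ht) (fun β hβ => integrableOn_rpow_Ioo hβ 1) x

theorem IsField.continuousOn_unitInt (hW : IsField t₁ t₂ W) :
    ContinuousOn (fun p : E3 × ℝ => unitInt W p.1 p.2) (slab t₁ t₂) := by
  rintro ⟨x, t⟩ ⟨-, ht⟩
  refine ContinuousAt.continuousWithinAt ?_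
  simp only [unitInt_eq]
  obtain ⟨D, β, hD, hβ, hb⟩ := hW.bound
  have hev : ∀ᶠ p : E3 × ℝ in 𝓝 (x, t), p.2 ∈ Ioo t₁ t₂ := by
    filter_upwards [isOpen_slab.mem_nhds (show (x, t) ∈ slab t₁ t₂ from ⟨mem_univ _, ht⟩)]
      with p hp using hp.2
  refine continuousAt_of_dominated (bound := fun s => D * s ^ (β - 1)) ?_ ?_
    ((integrableOn_rpow_Ioo hβ 1).const_mul D) ?_
  · filter_upwards [hev] with p hp
    exact (hW.integrableOn_initial p.1 hp 1).aestronglyMeasurable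
  · filter_upwards [hev] with p hp
    exact (ae_restrict_iff' measurableSet_Ioo).2 (Eventually.of_forall fun s hs => hb _ _ _ hs.1 hp)
  · exact (ae_restrict_iff' measurableSet_Ioo).2 (Eventually.of_forall fun s hs =>
      hW.continuousAt_comp (ξ := fun p : E3 × ℝ => p.1) (σ := fun _ => s) (θ := fun p => p.2)
        (by fun_prop) (by fun_prop) (by fun_prop) hs.1 ht)

theorem IsField.continuousOn_duhamel (hW : IsField t₁ t₂ W) :
    ContinuousOn (fun p : E3 × ℝ => duhamel t₁ W p.1 p.2) (slab t₁ t₂) := by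
  rintro ⟨x, t⟩ ⟨-, ht⟩
  refine ContinuousAt.continuousWithinAt ?_
  obtain ⟨D, β, hD, hβ, hb⟩ := hW.bound
  have hev : ∀ᶠ p : E3 × ℝ in 𝓝 (x, t), p.2 ∈ Ioo t₁ t₂ := by
    filter_upwards [isOpen_slab.mem_nhds (show (x, t) ∈ slab t₁ t₂ from ⟨mem_univ _, ht⟩)]
      with p hp using hp.2
  -- In the variable `s = t - τ` the singularity sits at `s = 0` for every `t`, so a single
  -- dominating function works near the given point.
  have hrw : ∀ p : E3 × ℝ, duhamel t₁ W p.1 p.2 = ∫ s in (0 : ℝ)..(p.2 - t₁),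
      W p.1 s (p.2 - s) := fun p => by
    have := intervalIntegral.integral_comp_sub_left (a := t₁) (b := p.2)
      (fun s => W p.1 s (p.2 - s)) p.2
    simpa [duhamel] using this
  have hJ : (fun p : E3 × ℝ => duhamel t₁ W p.1 p.2) =ᶠ[𝓝 (x, t)] fun p =>
      ∫ s, (Ioo 0 (p.2 - t₁)).indicator (fun s => W p.1 s (p.2 - s)) s := by
    filter_upwards [hev] with p hp
    rw [hrw, intervalIntegral.integral_of_le (by linarith [hp.1]), integral_Ioc_eq_integral_Ioo,
      integral_indicator measurableSet_Ioo]
  refine ContinuousAt.congr ?_ hJ.symm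
  refine continuousAt_of_dominated
    (bound := (Ioo 0 (t₂ - t₁)).indicator fun s => D * s ^ (β - 1)) ?_ ?_
    ((integrable_indicator_iff measurableSet_Ioo).2
      ((integrableOn_rpow_Ioo hβ _).const_mul D)) ?_
  · filter_upwards [hev] with p hp
    refine (aestronglyMeasurable_indicator_iff measurableSet_Ioo).2
      (ContinuousOn.aestronglyMeasurable ?_ measurableSet_Ioo)
    exact hW.comp_continuousOn (ξ := fun _ => p.1) (σ := fun s => s) (θ := fun s => p.2 - s)
      (by fun_prop) (by fun_prop) (by fun_prop) (fun s hs => hs.1)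
      (fun s hs => ⟨by linarith [hs.2], by linarith [hs.1, hp.2]⟩)
  · filter_upwards [hev] with p hp
    refine Eventually.of_forall fun s => ?_
    by_cases hs : s ∈ Ioo 0 (p.2 - t₁)
    · have hs' : s ∈ Ioo 0 (t₂ - t₁) := ⟨hs.1, by linarith [hs.2, hp.2]⟩
      rw [indicator_of_mem hs, indicator_of_mem hs']
      exact hb _ _ _ hs.1 ⟨by linarith [hs.2], by linarith [hs.1, hp.2]⟩
    · rw [indicator_of_notMem hs, norm_zero]
      exact indicator_nonneg (fun s hs => mul_nonneg hD (Real.rpow_nonneg hs.1.le _)) _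
  -- The domain of integration moves with `t`; its indicator is continuous in `t` except when `s`
  -- equals the moving endpoint, a null set.
  · have hne : ∀ᵐ s : ℝ, s ≠ 0 ∧ s ≠ t - t₁ := by
      filter_upwards [Measure.ae_ne volume (0 : ℝ), Measure.ae_ne volume (t - t₁)]
        with s h1 h2 using ⟨h1, h2⟩
    filter_upwards [hne] with s hs
    have hzero (h : ∀ᶠ p : E3 × ℝ in 𝓝 (x, t), s ∉ Ioo 0 (p.2 - t₁)) :
        ContinuousAt (fun p : E3 × ℝ =>
          (Ioo 0 (p.2 - t₁)).indicator (fun s => W p.1 s (p.2 - s)) s) (x, t) := by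
      refine (continuousAt_const (y := (0 : ℝ))).congr ?_
      filter_upwards [h] with p hp
      rw [indicator_of_notMem hp]
    rcases lt_or_gt_of_ne hs.1 with h0 | h0
    · exact hzero (Eventually.of_forall fun p hp => (hp.1.trans h0).false)
    have htend : ContinuousAt (fun p : E3 × ℝ => p.2 - t₁) (x, t) := by fun_prop
    rcases lt_or_gt_of_ne hs.2 with h1 | h1
    · refine ContinuousAt.congr (hW.continuousAt_comp (ξ := fun p : E3 × ℝ => p.1)
        (σ := fun _ => s) (θ := fun p => p.2 - s) (r := (x, t))
        (by fun_prop) (by fun_prop) (by fun_prop) h0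
        ⟨by simp only; linarith, by simp only; linarith [ht.2]⟩) ?_
      filter_upwards [htend.eventually (Ioi_mem_nhds h1)] with p hp
      rw [indicator_of_mem (show s ∈ Ioo 0 (p.2 - t₁) from ⟨h0, hp⟩)]
    · refine hzero ?_
      filter_upwards [htend.eventually (Iio_mem_nhds h1)] with p hp
      exact fun h => (h.2.trans hp).false

/-- On the triangle the integrand is dominated by the integrand of a convolution of two integrable
functions, a constant on `(t₁, t)` and `s^(β-1)` on `(0, t - t₁)`. -/
theorem IsField.integrable_triangle (hW : IsField t₁ t₂ W) (x : E3) {t : ℝ} (ht : t ∈ Ioo t₁ t₂) :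
    Integrable (fun p : ℝ × ℝ =>
      {p : ℝ × ℝ | t₁ < p.2 ∧ p.2 < p.1 ∧ p.1 < t}.indicator
        (fun p => W x (p.1 - p.2) p.2) p) (volume.prod volume) := by
  obtain ⟨D, β, hD, hβ, hb⟩ := hW.bound
  have hopen : IsOpen {p : ℝ × ℝ | t₁ < p.2 ∧ p.2 < p.1 ∧ p.1 < t} :=
    (isOpen_lt continuous_const continuous_snd).and
      ((isOpen_lt continuous_snd continuous_fst).and (isOpen_lt continuous_fst continuous_const))
  have h1 : Integrable ((Ioo t₁ t).indicator fun _ => D) :=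
    (integrable_indicator_iff measurableSet_Ioo).2 (integrableOn_const measure_Ioo_lt_top.ne)
  have h2 := (integrable_indicator_iff measurableSet_Ioo).2 (integrableOn_rpow_Ioo hβ (t - t₁))
  refine (h1.convolution_integrand (ContinuousLinearMap.mul ℝ ℝ) h2).mono' ?_
    (Eventually.of_forall fun p => ?_)
  · refine (aestronglyMeasurable_indicator_iff hopen.measurableSet).2
      (ContinuousOn.aestronglyMeasurable ?_ hopen.measurableSet)
    exact hW.comp_continuousOn (ξ := fun _ => x) (σ := fun p : ℝ × ℝ => p.1 - p.2)
      (θ := fun p => p.2) (by fun_prop) (by fun_prop) (by fun_prop) (fun p hp => sub_pos.2 hp.2.1)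
      (fun p hp => ⟨hp.1, (hp.2.1.trans hp.2.2).trans ht.2⟩)
  · by_cases hp : p ∈ {p : ℝ × ℝ | t₁ < p.2 ∧ p.2 < p.1 ∧ p.1 < t}
    · obtain ⟨h3, h4, h5⟩ := id hp
      rw [indicator_of_mem hp, ContinuousLinearMap.mul_apply',
        indicator_of_mem (show p.2 ∈ Ioo t₁ t from ⟨h3, h4.trans h5⟩),
        indicator_of_mem (show p.1 - p.2 ∈ Ioo 0 (t - t₁) from ⟨by linarith, by linarith⟩)]
      exact hb _ _ _ (by linarith) ⟨h3, by linarith [ht.2]⟩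
    · rw [indicator_of_notMem hp, norm_zero, ContinuousLinearMap.mul_apply']
      exact mul_nonneg (indicator_nonneg (fun _ _ => hD) _)
        (indicator_nonneg (fun s hs => Real.rpow_nonneg hs.1.le _) _)

/-- Fubini on the triangle `t₁ < τ < σ < t`, where the inner variable on the left is the shift `σ -
τ`. -/
theorem duhamel_primitive {q : E3 → ℝ → ℝ → ℝ} (hq : IsField t₁ t₂ q) (x : E3) {t : ℝ}
    (ht : t ∈ Ioo t₁ t₂) :
    IntegrableOn (fun σ => duhamel t₁ q x σ) (Ioo t₁ t) ∧
    IntegrableOn (fun τ => ∫ σ in (0 : ℝ)..(t - τ), q x σ τ) (Ioo t₁ t) ∧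
    ∫ τ in t₁..t, ∫ σ in (0 : ℝ)..(t - τ), q x σ τ = ∫ σ in t₁..t, duhamel t₁ q x σ := by
  have hint := hq.integrable_triangle x ht
  set T := {p : ℝ × ℝ | t₁ < p.2 ∧ p.2 < p.1 ∧ p.1 < t} with hT
  have e1 : (fun σ => ∫ τ, T.indicator (fun p => q x (p.1 - p.2) p.2) (σ, τ)) =
      (Ioo t₁ t).indicator fun σ => duhamel t₁ q x σ := by
    ext σ
    by_cases hσ : σ ∈ Ioo t₁ t
    · rw [indicator_of_mem hσ, duhamel_eq hσ.1, ← integral_indicator measurableSet_Ioo]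
      refine integral_congr_ae (Eventually.of_forall fun τ => ?_)
      simp only [indicator, hT, mem_ofPred_eq, mem_Ioo]
      refine if_congr ?_ rfl rfl
      exact ⟨fun h => ⟨h.1, h.2.1⟩, fun h => ⟨h.1, h.2, hσ.2⟩⟩
    · rw [indicator_of_notMem hσ]
      refine integral_eq_zero_of_ae (Eventually.of_forall fun τ => ?_)
      exact indicator_of_notMem (fun h => hσ ⟨h.1.trans h.2.1, h.2.2⟩) _
  have e2 : (fun τ => ∫ σ, T.indicator (fun p => q x (p.1 - p.2) p.2) (σ, τ)) =
      (Ioo t₁ t).indicator fun τ => ∫ σ in (0 : ℝ)..(t - τ), q x σ τ := by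
    ext τ
    by_cases hτ : τ ∈ Ioo t₁ t
    · have h3 := intervalIntegral.integral_comp_sub_right (a := τ) (b := t)
        (fun σ => q x σ τ) τ
      rw [indicator_of_mem hτ]
      rw [sub_self] at h3
      rw [← h3, intervalIntegral.integral_of_le hτ.2.le, integral_Ioc_eq_integral_Ioo,
        ← integral_indicator measurableSet_Ioo]
      refine integral_congr_ae (Eventually.of_forall fun σ => ?_)
      simp only [indicator, hT, mem_ofPred_eq, mem_Ioo]
      refine if_congr ?_ rfl rfl
      exact ⟨fun h => h.2, fun h => ⟨hτ.1, h⟩⟩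
    · rw [indicator_of_notMem hτ]
      refine integral_eq_zero_of_ae (Eventually.of_forall fun σ => ?_)
      exact indicator_of_notMem (fun h => hτ ⟨h.1, h.2.1.trans h.2.2⟩) _
  have i1 := hint.integral_prod_left
  have i2 := hint.integral_prod_right
  have hsw := integral_integral_swap (f := fun σ τ =>
    T.indicator (fun p => q x (p.1 - p.2) p.2) (σ, τ)) hint
  rw [e1] at i1
  rw [e2] at i2
  rw [e1, e2, integral_indicator measurableSet_Ioo, integral_indicator measurableSet_Ioo] at hsw
  refine ⟨(integrable_indicator_iff measurableSet_Ioo).1 i1,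
    (integrable_indicator_iff measurableSet_Ioo).1 i2, ?_⟩
  rw [intervalIntegral.integral_of_le ht.1.le, intervalIntegral.integral_of_le ht.1.le,
    integral_Ioc_eq_integral_Ioo, integral_Ioc_eq_integral_Ioo, hsw]

/-- The integrand is singular at the moving endpoint, so Leibniz' rule is avoided: by
`duhamel_primitive` the integral is itself a primitive of a continuous function, and the fundamental
theorem of calculus applies. The term `N` is the boundary contribution at `s = 0`. -/
theorem hasDerivAt_duhamel {q : E3 → ℝ → ℝ → ℝ} {N : E3 → ℝ → ℝ} (hq : IsField t₁ t₂ q)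
    (hN : ContinuousOn (fun p : E3 × ℝ => N p.1 p.2) (slab t₁ t₂))
    (hNb : ∃ M : ℝ, ∀ x, ∀ t ∈ Ioo t₁ t₂, |N x t| ≤ M)
    (heq : ∀ x s τ, 0 < s → τ ∈ Ioo t₁ t₂ → W x s τ = N x τ + ∫ σ in (0 : ℝ)..s, q x σ τ)
    (x : E3) {t : ℝ} (ht : t ∈ Ioo t₁ t₂) :
    HasDerivAt (fun t => duhamel t₁ W x t) (N x t + duhamel t₁ q x t) t := by
  obtain ⟨M, hM⟩ := hNb
  have hNc : ContinuousOn (fun σ => N x σ) (Ioo t₁ t₂) :=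
    hN.comp (f := fun σ : ℝ => (x, σ)) (by fun_prop) fun σ hσ => ⟨mem_univ _, hσ⟩
  have hqc : ContinuousOn (fun σ => duhamel t₁ q x σ) (Ioo t₁ t₂) :=
    hq.continuousOn_duhamel.comp (f := fun σ : ℝ => (x, σ)) (by fun_prop)
      fun σ hσ => ⟨mem_univ _, hσ⟩
  have hNi : ∀ t ∈ Ioo t₁ t₂, IntegrableOn (fun σ => N x σ) (Ioo t₁ t) := fun t ht =>
    Integrable.mono' (g := fun _ => M) (integrableOn_const measure_Ioo_lt_top.ne)
      ((hNc.mono (Ioo_subset_Ioo_right ht.2.le)).aestronglyMeasurable measurableSet_Ioo)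
      ((ae_restrict_iff' measurableSet_Ioo).2 (Eventually.of_forall fun σ hσ =>
        hM x σ ⟨hσ.1, hσ.2.trans ht.2⟩))
  have hprim : ∀ t ∈ Ioo t₁ t₂, duhamel t₁ W x t = ∫ σ in t₁..t, (N x σ + duhamel t₁ q x σ) := by
    intro t ht
    obtain ⟨h1, h2, h3⟩ := duhamel_primitive hq x ht
    rw [← intervalIntegrable_iff_integrableOn_Ioo_of_le ht.1.le] at h1 h2
    have h4 := hNi t ht
    rw [← intervalIntegrable_iff_integrableOn_Ioo_of_le ht.1.le] at h4
    rw [intervalIntegral.integral_add h4 h1, ← h3, ← intervalIntegral.integral_add h4 h2,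
      duhamel, intervalIntegral.integral_of_le ht.1.le, intervalIntegral.integral_of_le ht.1.le,
      integral_Ioc_eq_integral_Ioo, integral_Ioc_eq_integral_Ioo]
    refine setIntegral_congr_fun measurableSet_Ioo fun τ hτ => ?_
    exact heq x (t - τ) τ (sub_pos.2 hτ.2) ⟨hτ.1, hτ.2.trans ht.2⟩
  have hnhds : Ioo t₁ t₂ ∈ 𝓝 t := Ioo_mem_nhds ht.1 ht.2
  have hd : HasDerivAt (fun t => ∫ σ in t₁..t, (N x σ + duhamel t₁ q x σ))
      (N x t + duhamel t₁ q x t) t := by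
    refine intervalIntegral.integral_hasDerivAt_right ?_ ?_ ?_
    · rw [intervalIntegrable_iff_integrableOn_Ioo_of_le ht.1.le]
      exact (hNi t ht).add (duhamel_primitive hq x ht).1
    · exact (hNc.add hqc).stronglyMeasurableAtFilter isOpen_Ioo t ht
    · exact (hNc.add hqc).continuousAt hnhds
  refine hd.congr_of_eventuallyEq ?_
  filter_upwards [hnhds] with s hs using hprim s hs

end

end Oseen

end

/-! ### Joint regularity in the slab and the elementary potentials -/

noncomputable section

namespace Oseen

open Filter Topology

section SpaceRegularity

variable {V V' : Type*} [NormedAddCommGroup V] [NormedSpace ℝ V] [NormedAddCommGroup V']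
  [NormedSpace ℝ V'] {t₁ t₂ : ℝ} {n : ℕ}

theorem SpaceRegular.zero {f : E3 → ℝ → V}
    (hf : ContinuousOn (fun p : E3 × ℝ => f p.1 p.2) (slab t₁ t₂)) : SpaceRegular 0 t₁ t₂ f := by
  refine ⟨fun t ht => ?_, fun k hk => ?_⟩
  · exact contDiff_zero.2 (hf.comp_continuous (f := fun x : E3 => (x, t)) (by fun_prop)
      fun x => ⟨mem_univ _, ht⟩)
  · obtain rfl : k = 0 := by omega
    exact (continuousMultilinearCurryFin0 ℝ E3 V).symm.continuous.comp_continuousOn hf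

theorem SpaceRegular.continuousOn {f : E3 → ℝ → V} (hf : SpaceRegular n t₁ t₂ f) :
    ContinuousOn (fun p : E3 × ℝ => f p.1 p.2) (slab t₁ t₂) :=
  ((continuousMultilinearCurryFin0 ℝ E3 V).continuous.comp_continuousOn
    (hf.2 0 (Nat.zero_le n))).congr fun p _ => by simp

theorem SpaceRegular.congr {f g : E3 → ℝ → V} (hf : SpaceRegular n t₁ t₂ f)
    (h : ∀ t ∈ Ioo t₁ t₂, ∀ x, g x t = f x t) : SpaceRegular n t₁ t₂ g := by
  have h' : ∀ t ∈ Ioo t₁ t₂, (fun x => g x t) = fun x => f x t := fun t ht => funext (h t ht)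
  refine ⟨fun t ht => (h' t ht) ▸ hf.1 t ht, fun k hk => (hf.2 k hk).congr fun p hp => ?_⟩
  simp only [h' p.2 hp.2]

/-- The inductive step for regularity: a jointly continuous function gains one order as soon as its
spatial derivative is known explicitly. -/
theorem SpaceRegular.succ {f : E3 → ℝ → V} {g : E3 → ℝ → E3 →L[ℝ] V}
    (hf : ContinuousOn (fun p : E3 × ℝ => f p.1 p.2) (slab t₁ t₂))
    (hd : ∀ t ∈ Ioo t₁ t₂, ∀ x, HasFDerivAt (fun x => f x t) (g x t) x)
    (hg : SpaceRegular n t₁ t₂ g) : SpaceRegular (n + 1) t₁ t₂ f := by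
  have e : ∀ t ∈ Ioo t₁ t₂, fderiv ℝ (fun x => f x t) = fun x => g x t := fun t ht =>
    funext fun x => (hd t ht x).fderiv
  refine ⟨fun t ht => ?_, fun k hk => ?_⟩
  · rw [Nat.cast_add, Nat.cast_one, contDiff_succ_iff_fderiv]
    refine ⟨fun x => (hd t ht x).differentiableAt, by simp, ?_⟩
    rw [e t ht]
    exact hg.1 t ht
  · cases k with
    | zero => exact (SpaceRegular.zero hf).2 0 le_rfl
    | succ k =>
      refine ((continuousMultilinearCurryRightEquiv' ℝ k E3 V).symm.continuous.comp_continuousOn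
        (hg.2 k (by omega))).congr fun p hp => ?_
      rw [iteratedFDeriv_succ_eq_comp_right]
      simp only [Function.comp, e p.2 hp.2]

theorem SpaceRegular.clm_comp {f : E3 → ℝ → V} (hf : SpaceRegular n t₁ t₂ f) (L : V →L[ℝ] V') :
    SpaceRegular n t₁ t₂ fun x t => L (f x t) := by
  refine ⟨fun t ht => L.contDiff.comp (hf.1 t ht), fun k hk => ?_⟩
  refine ((ContinuousLinearMap.compContinuousMultilinearMapL ℝ (fun _ : Fin k => E3) V V'
    L).continuous.comp_continuousOn (hf.2 k hk)).congr fun p hp => ?_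
  exact L.iteratedFDeriv_comp_left (hf.1 p.2 hp.2).contDiffAt (by exact_mod_cast hk)

theorem SpaceRegular.add {f g : E3 → ℝ → V} (hf : SpaceRegular n t₁ t₂ f)
    (hg : SpaceRegular n t₁ t₂ g) : SpaceRegular n t₁ t₂ fun x t => f x t + g x t := by
  refine ⟨fun t ht => (hf.1 t ht).add (hg.1 t ht), fun k hk => ?_⟩
  refine ((hf.2 k hk).add (hg.2 k hk)).congr fun p hp => ?_
  have hk' : (k : WithTop ℕ∞) ≤ n := by exact_mod_cast hk
  exact iteratedFDeriv_add_apply ((hf.1 p.2 hp.2).of_le hk').contDiffAt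
    ((hg.1 p.2 hp.2).of_le hk').contDiffAt

theorem SpaceRegular.const_mul {f : E3 → ℝ → ℝ} (hf : SpaceRegular n t₁ t₂ f) (a : ℝ) :
    SpaceRegular n t₁ t₂ fun x t => a * f x t :=
  hf.clm_comp (a • ContinuousLinearMap.id ℝ ℝ)

theorem SpaceRegular.sum {f : Fin 3 → E3 → ℝ → V} (hf : ∀ c, SpaceRegular n t₁ t₂ (f c)) :
    SpaceRegular n t₁ t₂ fun x t => ∑ c, f c x t := by
  simpa only [Fin.sum_univ_three] using ((hf 0).add (hf 1)).add (hf 2)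

theorem SpaceRegular.succ_covec {f : E3 → ℝ → ℝ} {f' : Fin 3 → E3 → ℝ → ℝ}
    (hf : ContinuousOn (fun p : E3 × ℝ => f p.1 p.2) (slab t₁ t₂))
    (hd : ∀ t ∈ Ioo t₁ t₂, ∀ x, HasFDerivAt (fun x => f x t) (covec fun c => f' c x t) x)
    (hg : ∀ c, SpaceRegular n t₁ t₂ (f' c)) : SpaceRegular (n + 1) t₁ t₂ f :=
  SpaceRegular.succ hf hd <| SpaceRegular.sum fun c => (hg c).clm_comp
    (ContinuousLinearMap.toSpanSingleton ℝ (EuclideanSpace.proj c : E3 →L[ℝ] ℝ))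

theorem SpaceRegular.toE3 {f : Fin 3 → E3 → ℝ → ℝ} (hf : ∀ c, SpaceRegular n t₁ t₂ (f c)) :
    SpaceRegular n t₁ t₂ fun x t => (WithLp.toLp 2 fun c => f c x t : E3) := by
  refine (SpaceRegular.sum fun c => (hf c).clm_comp (ContinuousLinearMap.toSpanSingleton ℝ
    (EuclideanSpace.single c (1 : ℝ) : E3))).congr fun t _ x => ?_
  ext c
  simp [Pi.single_apply]

end SpaceRegularity

/-- The partial derivative of a density in space. -/
def dd (c : Fin 3) (f : E3 → ℝ → ℝ) (y : E3) (t : ℝ) : ℝ := pd c (fun y => f y t) y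

/-- A density that is Hölder continuous together with its first space derivatives. -/
structure IsSmoothDens (t₁ t₂ : ℝ) (f : E3 → ℝ → ℝ) : Prop where
  dens : IsDens t₁ t₂ f
  holder : IsHolder t₁ t₂ f
  diff : ∀ t ∈ Ioo t₁ t₂, Differentiable ℝ fun y => f y t
  dens_dd : ∀ c, IsDens t₁ t₂ (dd c f)
  holder_dd : ∀ c, IsHolder t₁ t₂ (dd c f)

/-- A kernel with a gradient of the next order. -/
def IsDiffKer (m : ℕ) (k : E3 → ℝ → ℝ) : Prop :=
  IsKer m k ∧ ∃ k', HasGrad k k' ∧ ∀ c, IsKer (m + 1) (k' c)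

theorem isDiffKer_radial (n : ℕ) : IsDiffKer (2 * n + 1) (radial n) :=
  ⟨isKer_radial n, _, hasGrad_radial n, fun c => (isKer_radial (n + 1)).coord_mul c⟩

theorem IsDiffKer.coord_mul {m : ℕ} {k : E3 → ℝ → ℝ} (h : IsDiffKer (m + 1) k) (a : Fin 3) :
    IsDiffKer m fun z s => z a * k z s := by
  obtain ⟨hk, k', hg, hk'⟩ := h
  exact ⟨hk.coord_mul a, _, hg.coord_mul a, fun c =>
    (hk.const_mul _).add ((hk' c).coord_mul a)⟩

theorem IsDiffKer.const_mul {m : ℕ} {k : E3 → ℝ → ℝ} (h : IsDiffKer m k) (a : ℝ) :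
    IsDiffKer m fun z s => a * k z s := by
  obtain ⟨hk, k', hg, hk'⟩ := h
  exact ⟨hk.const_mul a, _, hg.const_mul a, fun c => (hk' c).const_mul a⟩

theorem IsDiffKer.add {m : ℕ} {k l : E3 → ℝ → ℝ} (h : IsDiffKer m k) (h' : IsDiffKer m l) :
    IsDiffKer m fun z s => k z s + l z s := by
  obtain ⟨hk, k', hg, hk'⟩ := h
  obtain ⟨hl, l', hgl, hl'⟩ := h'
  exact ⟨hk.add hl, _, hg.add hgl, fun c => (hk' c).add (hl' c)⟩

/-- Only the existence and order of a fifth derivative of `Ψ` are needed, to move an `x`-derivative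
onto the density when differentiating the pressure, so no formula for it is written. -/
theorem isDiffKer_psi4 (a b c d : Fin 3) : IsDiffKer 5 (psi4 a b c d) := by
  have h2 (x y : Fin 3) (r : ℝ) : IsDiffKer 5 (fun z s => r * (z x * (z y * radial 3 z s))) :=
    (((isDiffKer_radial 3).coord_mul y).coord_mul x).const_mul r
  exact (((((((((isDiffKer_radial 2).const_mul _).add (h2 c d _)).add (h2 b d _)).add
    (h2 a d _)).add (h2 b c _)).add (h2 a c _)).add (h2 a b _))).add
    (((((isDiffKer_radial 4).coord_mul d).coord_mul c).coord_mul b).coord_mul a)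

theorem isDiffKer_psi2t (a b : Fin 3) : IsDiffKer 5 (psi2t a b) := by
  unfold psi2t
  simp only [Fin.sum_univ_three]
  exact ((isDiffKer_psi4 _ _ _ _).add (isDiffKer_psi4 _ _ _ _)).add (isDiffKer_psi4 _ _ _ _)

section

variable {t₁ t₂ : ℝ} {m : ℕ} {k G f : E3 → ℝ → ℝ}

theorem hasFDerivAt_cv_dd (hk : IsDiffKer m k) (hf : IsSmoothDens t₁ t₂ f) (x : E3) {s τ : ℝ}
    (hs : 0 < s) (hτ : τ ∈ Ioo t₁ t₂) :
    HasFDerivAt (fun x => cv k f x s τ) (covec fun c => cv k (dd c f) x s τ) x := by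
  obtain ⟨hk, k', hg, hk'⟩ := hk
  refine (hasFDerivAt_cv hk hg hk' hf.dens x hs hτ).congr_fderiv ?_
  congr 1
  ext c
  exact cv_grad_eq hk hg (hk' c) hf.dens hf.diff (hf.dens_dd c) x hs hτ

theorem isField_cv_four (hk : IsKer 4 k) (hG : IsDens t₁ t₂ G) : IsField t₁ t₂ (cv k G) := by
  refine ⟨continuousOn_cv hk hG, ?_⟩
  obtain ⟨D, hD, h⟩ := exists_abs_cv_le' hk (by norm_num) hG
  refine ⟨D, 1 / 2, hD, by norm_num, fun x s τ hs hτ => (h x s τ hs hτ).trans_eq ?_⟩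
  norm_num

/-- Order 5 is the borderline case; the vanishing mean removes the non-integrable part and Hölder
continuity controls the rest. -/
theorem isField_cv_five (hk : IsKer 5 k) (h0 : ∀ s, 0 < s → ∫ z, k z s = 0)
    (hG : IsDens t₁ t₂ G) (hH : IsHolder t₁ t₂ G) : IsField t₁ t₂ (cv k G) := by
  refine ⟨continuousOn_cv hk hG, ?_⟩
  obtain ⟨D, β, hD, hβ, h⟩ := exists_abs_cv_sub_le hk hG hH
  refine ⟨D, β, hD, hβ, fun x s τ hs hτ => ?_⟩
  simpa [h0 s hs] using h x s τ hs hτ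

theorem isField_cv_psi4 (a b c d : Fin 3) (hG : IsDens t₁ t₂ G) (hH : IsHolder t₁ t₂ G) :
    IsField t₁ t₂ (cv (psi4 a b c d) G) :=
  isField_cv_five (isKer_psi4 a b c d) (fun _ hs => integral_psi4_eq_zero a b c d hs) hG hH

theorem isField_cv_psi2t (a b : Fin 3) (hG : IsDens t₁ t₂ G) (hH : IsHolder t₁ t₂ G) :
    IsField t₁ t₂ (cv (psi2t a b) G) :=
  isField_cv_five (isKer_psi2t a b) (fun _ hs => integral_psi2t_eq_zero a b hs) hG hH

theorem cv_psi3_eq (a b c : Fin 3) (hf : IsSmoothDens t₁ t₂ f) (x : E3) {s τ : ℝ} (hs : 0 < s)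
    (hτ : τ ∈ Ioo t₁ t₂) : cv (psi3 a b c) f x s τ = cv (psi2 a b) (dd c f) x s τ :=
  cv_grad_eq (isKer_psi2 a b) (hasGrad_psi2 a b) (isKer_psi3 a b c) hf.dens hf.diff (hf.dens_dd c)
    x hs hτ

theorem hasFDerivAt_cv_psi2 (a b : Fin 3) (hG : IsDens t₁ t₂ G) (x : E3) {s τ : ℝ} (hs : 0 < s)
    (hτ : τ ∈ Ioo t₁ t₂) :
    HasFDerivAt (fun x => cv (psi2 a b) G x s τ) (covec fun m => cv (psi3 a b m) G x s τ) x :=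
  hasFDerivAt_cv (isKer_psi2 a b) (hasGrad_psi2 a b) (fun c => isKer_psi3 a b c) hG x hs hτ

theorem hasFDerivAt_cv_psi3 (a b c : Fin 3) (hG : IsDens t₁ t₂ G) (x : E3) {s τ : ℝ} (hs : 0 < s)
    (hτ : τ ∈ Ioo t₁ t₂) :
    HasFDerivAt (fun x => cv (psi3 a b c) G x s τ) (covec fun m => cv (psi4 a b c m) G x s τ) x :=
  hasFDerivAt_cv (isKer_psi3 a b c) (hasGrad_psi3 a b c) (fun d => isKer_psi4 a b c d) hG x hs hτ

/-- The potential with kernel `psi3 a b c`. -/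
def pot (a b c : Fin 3) (t₁ : ℝ) (f : E3 → ℝ → ℝ) : E3 → ℝ → ℝ := duhamel t₁ (cv (psi3 a b c) f)

/-- The derivative with index `c` is first moved onto `f`, and the new one then falls on `psi2`. The
kernel stays at order 4, so no Hölder argument is needed yet. -/
theorem hasFDerivAt_pot (a b c : Fin 3) (hf : IsSmoothDens t₁ t₂ f) (x : E3) {t : ℝ}
    (ht : t ∈ Ioo t₁ t₂) :
    HasFDerivAt (fun x => pot a b c t₁ f x t)
      (covec fun m => pot a b m t₁ (dd c f) x t) x := by
  refine (isField_cv_four (isKer_psi3 a b c) hf.dens).hasFDerivAt_duhamel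
    (fun m => isField_cv_four (isKer_psi3 a b m) (hf.dens_dd c)) (fun x s τ hs hτ => ?_) x ht
  simp only [cv_psi3_eq a b c hf _ hs hτ]
  exact hasFDerivAt_cv_psi2 a b (hf.dens_dd c) x hs hτ

/-- Here the derivative does fall on the order 4 kernel, and the result converges only through the
cancellation in `isField_cv_psi4`. -/
theorem hasFDerivAt_pot' (a b m : Fin 3) (hG : IsDens t₁ t₂ G) (hH : IsHolder t₁ t₂ G) (x : E3)
    {t : ℝ} (ht : t ∈ Ioo t₁ t₂) :
    HasFDerivAt (fun x => pot a b m t₁ G x t)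
      (covec fun n => duhamel t₁ (cv (psi4 a b m n) G) x t) x :=
  (isField_cv_four (isKer_psi3 a b m) hG).hasFDerivAt_duhamel
    (fun n => isField_cv_psi4 a b m n hG hH)
    (fun x _ _ hs hτ => hasFDerivAt_cv_psi3 a b m hG x hs hτ) x ht

theorem spaceRegular_pot (a b c : Fin 3) (hf : IsSmoothDens t₁ t₂ f) :
    SpaceRegular 2 t₁ t₂ (pot a b c t₁ f) := by
  refine SpaceRegular.succ_covec
    (isField_cv_four (isKer_psi3 a b c) hf.dens).continuousOn_duhamel
    (fun t ht x => hasFDerivAt_pot a b c hf x ht) fun m => SpaceRegular.succ_covec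
      (isField_cv_four (isKer_psi3 a b m) (hf.dens_dd c)).continuousOn_duhamel
      (fun t ht x => hasFDerivAt_pot' a b m (hf.dens_dd c) (hf.holder_dd c) x ht) fun n =>
        SpaceRegular.zero
          (isField_cv_psi4 a b m n (hf.dens_dd c) (hf.holder_dd c)).continuousOn_duhamel

theorem cv_psi2t_eq_sum (a b : Fin 3) (hG : IsDens t₁ t₂ G) (x : E3) {s τ : ℝ} (hs : 0 < s)
    (hτ : τ ∈ Ioo t₁ t₂) : cv (psi2t a b) G x s τ = ∑ m, cv (psi4 a b m m) G x s τ := by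
  simp only [cv, psi2t, Finset.sum_mul]
  exact integral_finsetSum _ fun m _ => integrable_conv_integrand (isKer_psi4 a b m m) hG x hs hτ

theorem laplacian_pot (a b c : Fin 3) (hf : IsSmoothDens t₁ t₂ f) (x : E3) {t : ℝ}
    (ht : t ∈ Ioo t₁ t₂) :
    Laplacian.laplacian (fun x => pot a b c t₁ f x t) x =
      duhamel t₁ (cv (psi2t a b) (dd c f)) x t := by
  rw [laplacian_eq_sum_of_hasFDerivAt
    (f'' := fun m n => duhamel t₁ (cv (psi4 a b m n) (dd c f)) x t)
    (fun y => hasFDerivAt_pot a b c hf y ht)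
    (fun m => hasFDerivAt_pot' a b m (hf.dens_dd c) (hf.holder_dd c) x ht)]
  simp only [duhamel_eq ht.1]
  rw [← integral_finsetSum _ fun m _ =>
    (isField_cv_psi4 a b m m (hf.dens_dd c) (hf.holder_dd c)).integrableOn_duhamel x ht]
  refine setIntegral_congr_fun measurableSet_Ioo fun τ hτ => ?_
  exact (cv_psi2t_eq_sum a b (hf.dens_dd c) x (sub_pos.2 hτ.2) ⟨hτ.1, hτ.2.trans ht.2⟩).symm

/-- The limit as `s → 0` of the convolution with `psi2 a b`. -/
def newton (a b : Fin 3) (G : E3 → ℝ → ℝ) (x : E3) (t : ℝ) : ℝ :=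
  cv (psi2 a b) G x 1 t - unitInt (cv (psi2t a b) G) x t

/-- The time derivative of the convolution has an integrable singularity at 0, so the convolution
extends to `s = 0`; `newton` is that value computed from `s = 1`. -/
theorem cv_psi2_eq_newton (a b : Fin 3) (hG : IsDens t₁ t₂ G) (hH : IsHolder t₁ t₂ G) (x : E3)
    {s τ : ℝ} (hs : 0 < s) (hτ : τ ∈ Ioo t₁ t₂) :
    cv (psi2 a b) G x s τ = newton a b G x τ + ∫ σ in (0 : ℝ)..s, cv (psi2t a b) G x σ τ := by
  have hF := isField_cv_psi2t a b hG hH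
  have hii : ∀ L : ℝ, 0 < L → IntervalIntegrable (fun σ => cv (psi2t a b) G x σ τ) volume 0 L :=
    fun L hL => by
      rw [intervalIntegrable_iff_integrableOn_Ioo_of_le hL.le]
      exact hF.integrableOn_initial x hτ L
  -- The fundamental theorem is used between 1 and `s`, an interval that avoids the singular time.
  have h := intervalIntegral.integral_eq_sub_of_hasDerivAt (a := 1) (b := s)
    (f := fun σ => cv (psi2 a b) G x σ τ) (f' := fun σ => cv (psi2t a b) G x σ τ)
    (fun σ hσ => hasDerivAt_cv (isKer_psi2 a b) (fun z s hs => hasDerivAt_psi2 a b z hs)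
      (isKer_psi2t a b) hG x (lt_of_lt_of_le (lt_min one_pos hs) hσ.1) hτ)
    ((hii 1 one_pos).symm.trans (hii s hs))
  have h2 := intervalIntegral.integral_add_adjacent_intervals (hii 1 one_pos)
    ((hii 1 one_pos).symm.trans (hii s hs))
  rw [newton, unitInt]
  linarith

theorem continuousOn_newton (a b : Fin 3) (hG : IsDens t₁ t₂ G) (hH : IsHolder t₁ t₂ G) :
    ContinuousOn (fun p : E3 × ℝ => newton a b G p.1 p.2) (slab t₁ t₂) := by
  refine ContinuousOn.sub ?_ (isField_cv_psi2t a b hG hH).continuousOn_unitInt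
  exact (continuousOn_cv (isKer_psi2 a b) hG).comp (f := fun p : E3 × ℝ => (p.1, (1 : ℝ), p.2))
    (by fun_prop) fun p hp => ⟨mem_univ _, by simp, hp.2⟩

theorem exists_abs_newton_le (a b : Fin 3) (hG : IsDens t₁ t₂ G) (hH : IsHolder t₁ t₂ G) :
    ∃ M : ℝ, ∀ x, ∀ t ∈ Ioo t₁ t₂, |newton a b G x t| ≤ M := by
  obtain ⟨g, hg, hg'⟩ := exists_conv_dominating (isKer_psi2 a b) hG one_pos
  have hF := isField_cv_psi2t a b hG hH
  obtain ⟨D, β, hD, hβ, hb⟩ := hF.bound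
  refine ⟨(∫ y, g y) + ∫ s in Ioo (0 : ℝ) 1, D * s ^ (β - 1), fun x t ht => ?_⟩
  refine (abs_sub _ _).trans (add_le_add ?_ ?_)
  · exact norm_integral_le_of_norm_le hg (Eventually.of_forall (hg' x 1 t le_rfl ht))
  · rw [unitInt_eq]
    exact norm_integral_le_of_norm_le (f := fun s => cv (psi2t a b) G x s t)
      ((integrableOn_rpow_Ioo hβ 1).const_mul D)
      ((ae_restrict_iff' measurableSet_Ioo).2 (Eventually.of_forall fun s hs => hb x s t hs.1 ht))

/-- The second summand is the Laplacian of the potential by `laplacian_pot`, so the potential solves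
a heat equation with source `newton`. -/
theorem hasDerivAt_pot (a b c : Fin 3) (hf : IsSmoothDens t₁ t₂ f) (x : E3) {t : ℝ}
    (ht : t ∈ Ioo t₁ t₂) :
    HasDerivAt (fun t => pot a b c t₁ f x t)
      (newton a b (dd c f) x t + duhamel t₁ (cv (psi2t a b) (dd c f)) x t) t :=
  hasDerivAt_duhamel (isField_cv_psi2t a b (hf.dens_dd c) (hf.holder_dd c))
    (continuousOn_newton a b (hf.dens_dd c) (hf.holder_dd c))
    (exists_abs_newton_le a b (hf.dens_dd c) (hf.holder_dd c))
    (fun x s τ hs hτ => by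
      rw [cv_psi3_eq a b c hf x hs hτ,
        cv_psi2_eq_newton a b (hf.dens_dd c) (hf.holder_dd c) x hs hτ]) x ht

theorem hasFDerivAt_newton (a b : Fin 3) (hf : IsSmoothDens t₁ t₂ f) (x : E3) {t : ℝ}
    (ht : t ∈ Ioo t₁ t₂) :
    HasFDerivAt (fun x => newton a b f x t) (covec fun c => newton a b (dd c f) x t) x := by
  have h1 := hasFDerivAt_cv_psi2 a b hf.dens x one_pos ht
  have h2 := (isField_cv_psi2t a b hf.dens hf.holder).hasFDerivAt_unitInt
    (fun c => isField_cv_psi2t a b (hf.dens_dd c) (hf.holder_dd c))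
    (fun x s τ hs hτ => hasFDerivAt_cv_dd (isDiffKer_psi2t a b) hf x hs hτ) x ht
  refine (h1.sub h2).congr_fderiv ?_
  ext v
  simp only [covec_apply, sub_apply, newton, ← Finset.sum_sub_distrib, ← sub_mul,
    cv_psi3_eq a b _ hf x one_pos ht]

end

end Oseen

end

/-! ### The limit of the kernels as the time tends to zero -/

noncomputable section

namespace Oseen

open Filter Topology

section HeatLimit

variable {t₁ t₂ : ℝ} {f G : E3 → ℝ → ℝ}

/-- This is the moment recurrence at `n + 1` after rescaling: the combination appearing in
`hasDerivAt_radial` collapses to a pure Gaussian. -/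
theorem radial_heat (n : ℕ) (z : E3) {s : ℝ} (hs : 0 < s) :
    (2 * n + 3) * radial (n + 1) z s + ‖z‖ ^ 2 * radial (n + 2) z s =
      1 / (4 * Real.pi ^ (3 / 2 : ℝ)) * (-1 / 2) ^ (n + 1) * s ^ (-(n : ℝ) - 3 / 2) *
        Real.exp (-(1 / (4 * s)) * ‖z‖ ^ 2) := by
  have e1 : s ^ (-((n + 1 : ℕ) : ℝ) - 1 / 2) = s ^ (-(n : ℝ) - 3 / 2) := by
    congr 1
    push_cast
    ring
  have e2 : s ^ (-((n + 2 : ℕ) : ℝ) - 1 / 2) = s ^ (-(n : ℝ) - 3 / 2) / s := by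
    rw [← Real.rpow_sub_one hs.ne']
    congr 1
    push_cast
    ring
  have r := gaussMoment_recurrence (n + 1) (‖z‖ ^ 2 / (4 * s))
  rw [show -(1 / (4 * s)) * ‖z‖ ^ 2 = -(‖z‖ ^ 2 / (4 * s)) by ring, ← r]
  simp only [radial, e1, e2, pow_succ (-1 / 2 : ℝ)]
  push_cast
  field_simp
  ring

/-- A kernel proportional to the heat kernel divided by the time. -/
def heat5 (z : E3) (s : ℝ) : ℝ := 5 * radial 2 z s + ∑ m, z m * (z m * radial 3 z s)

theorem isKer_heat5 : IsKer 5 heat5 :=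
  ((isKer_radial 2).const_mul 5).add
    (IsKer.sum fun m => ((isKer_radial 3).coord_mul m).coord_mul m)

theorem heat5_eq (z : E3) {s : ℝ} (hs : 0 < s) :
    heat5 z s = 1 / (4 * Real.pi ^ (3 / 2 : ℝ)) * (1 / 4) * s ^ (-(5 / 2) : ℝ) *
      Real.exp (-(1 / (4 * s)) * ‖z‖ ^ 2) := by
  have h := radial_heat 1 z hs
  have e : heat5 z s = (2 * (1 : ℕ) + 3) * radial (1 + 1) z s + ‖z‖ ^ 2 * radial (1 + 2) z s := by
    rw [heat5, norm_sq_eq_sum_coord, Fin.sum_univ_three]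
    push_cast
    ring
  rw [e, h]
  norm_num

/-- The left side is `ΔΨ`, and `2 s heat5` is the heat kernel. The factor `s` is split off so that
`heat5` has order 5 and the Hölder estimate for that order can be reused. -/
theorem sum_psi2_eq (z : E3) {s : ℝ} (hs : 0 < s) :
    ∑ m, psi2 m m z s = -2 * s * heat5 z s := by
  have h := radial_heat 0 z hs
  have e : ∑ m, psi2 m m z s = (2 * (0 : ℕ) + 3) * radial (0 + 1) z s +
      ‖z‖ ^ 2 * radial (0 + 2) z s := by
    simp only [psi2, norm_sq_eq_sum_coord, Fin.sum_univ_three, kd]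
    push_cast
    simp
    ring
  have e2 : s ^ (-((0 : ℕ) : ℝ) - 3 / 2) = s * s ^ (-(5 / 2) : ℝ) := by
    rw [mul_comm, ← Real.rpow_add_one hs.ne']
    norm_num
  rw [e, h, heat5_eq z hs, e2]
  ring

theorem integral_heat5 {s : ℝ} (hs : 0 < s) : ∫ z, heat5 z s = 1 / (2 * s) := by
  simp_rw [heat5_eq _ hs]
  rw [integral_const_mul, GaussianFourier.integral_rexp_neg_mul_sq_norm (by positivity)]
  have e1 : (Real.pi / (1 / (4 * s))) = Real.pi * (4 * s) := by field_simp
  have e2 : (4 : ℝ) ^ (3 / 2 : ℝ) = 8 := by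
    rw [show (4 : ℝ) = 2 ^ (2 : ℝ) by norm_num, ← Real.rpow_mul (by norm_num)]
    norm_num
  have e3 : s ^ (-(5 / 2) : ℝ) * s ^ (3 / 2 : ℝ) = 1 / s := by
    rw [← Real.rpow_add hs, one_div, ← Real.rpow_neg_one]
    norm_num
  have hpi : Real.pi ^ (3 / 2 : ℝ) ≠ 0 := by positivity
  rw [e1, finrank_euclideanSpace_fin, Nat.cast_ofNat, Real.mul_rpow Real.pi_pos.le (by positivity),
    Real.mul_rpow (by norm_num) hs.le, e2]
  calc 1 / (4 * Real.pi ^ (3 / 2 : ℝ)) * (1 / 4) * s ^ (-(5 / 2) : ℝ) *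
        (Real.pi ^ (3 / 2 : ℝ) * (8 * s ^ (3 / 2 : ℝ)))
      = (1 / 2) * (s ^ (-(5 / 2) : ℝ) * s ^ (3 / 2 : ℝ)) := by field_simp; ring
    _ = _ := by rw [e3]; ring

theorem tendsto_cv_psi2 (a b : Fin 3) (hG : IsDens t₁ t₂ G) (hH : IsHolder t₁ t₂ G) (x : E3)
    {τ : ℝ} (hτ : τ ∈ Ioo t₁ t₂) :
    Tendsto (fun s => cv (psi2 a b) G x s τ) (𝓝[>] 0) (𝓝 (newton a b G x τ)) := by
  have hF := isField_cv_psi2t a b hG hH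
  obtain ⟨D, β, hD, hβ, hb⟩ := hF.bound
  have hlim : Tendsto (fun s : ℝ => D * (s ^ β / β)) (𝓝[>] 0) (𝓝 0) := by
    have h : Tendsto (fun s : ℝ => D * (s ^ β / β)) (𝓝 0) (𝓝 (D * ((0 : ℝ) ^ β / β))) :=
      ((Real.continuousAt_rpow_const 0 β (Or.inr hβ.le)).tendsto.div_const β).const_mul D
    rw [Real.zero_rpow hβ.ne', zero_div, mul_zero] at h
    exact h.mono_left nhdsWithin_le_nhds
  refine tendsto_iff_norm_sub_tendsto_zero.2 (squeeze_zero' (Eventually.of_forall fun s =>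
    norm_nonneg _) ?_ hlim)
  filter_upwards [self_mem_nhdsWithin] with s hs
  have hs : 0 < s := hs
  rw [cv_psi2_eq_newton a b hG hH x hs hτ, add_sub_cancel_left,
    intervalIntegral.integral_of_le hs.le, integral_Ioc_eq_integral_Ioo]
  have h1 := norm_integral_le_of_norm_le (f := fun σ => cv (psi2t a b) G x σ τ)
    ((integrableOn_rpow_Ioo hβ s).const_mul D)
    ((ae_restrict_iff' measurableSet_Ioo).2 (Eventually.of_forall fun σ hσ => hb x σ τ hσ.1 hτ))
  refine h1.trans_eq ?_
  rw [integral_const_mul, ← integral_Ioc_eq_integral_Ioo, ← intervalIntegral.integral_of_le hs.le,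
    integral_rpow (Or.inl (by linarith)), sub_add_cancel, Real.zero_rpow hβ.ne', sub_zero]

/-- In the limit `-ΔΨ` acts as an approximate identity: the trace of the convolutions with `psi2`
tends to `-G`, and limits are unique. -/
theorem sum_newton_eq (hG : IsDens t₁ t₂ G) (hH : IsHolder t₁ t₂ G) (x : E3)
    {τ : ℝ} (hτ : τ ∈ Ioo t₁ t₂) : ∑ m, newton m m G x τ = -G x τ := by
  have h1 := tendsto_finsetSum Finset.univ fun m _ => tendsto_cv_psi2 m m hG hH x hτ
  refine tendsto_nhds_unique h1 ?_
  obtain ⟨D, β, hD, hβ, hb⟩ := exists_abs_cv_sub_le isKer_heat5 hG hH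
  have hlim : Tendsto (fun s : ℝ => 2 * D * s ^ β) (𝓝[>] 0) (𝓝 0) := by
    have h : Tendsto (fun s : ℝ => 2 * D * s ^ β) (𝓝 0) (𝓝 (2 * D * (0 : ℝ) ^ β)) :=
      (Real.continuousAt_rpow_const 0 β (Or.inr hβ.le)).tendsto.const_mul _
    rw [Real.zero_rpow hβ.ne', mul_zero] at h
    exact h.mono_left nhdsWithin_le_nhds
  refine tendsto_iff_norm_sub_tendsto_zero.2 (squeeze_zero' (Eventually.of_forall fun s =>
    norm_nonneg _) ?_ hlim)
  filter_upwards [self_mem_nhdsWithin] with s hs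
  have hs : 0 < s := hs
  have e : ∑ m, cv (psi2 m m) G x s τ = -2 * s * cv heat5 G x s τ := by
    simp only [cv]
    rw [← integral_finsetSum _ fun m _ =>
      integrable_conv_integrand (isKer_psi2 m m) hG x hs hτ, ← integral_const_mul]
    refine integral_congr_ae (Eventually.of_forall fun y => ?_)
    simp only [← Finset.sum_mul]
    rw [sum_psi2_eq _ hs]
    ring
  have h2 := hb x s τ hs hτ
  rw [integral_heat5 hs] at h2
  -- The mean `1/(2s)` of `heat5` makes the error exactly `-2s` times a quantity of size `s^(β-1)`,
  -- hence of size `s^β`.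
  have e3 : -2 * s * cv heat5 G x s τ - -G x τ = -2 * s * (cv heat5 G x s τ - 1 / (2 * s) * G x τ) := by
    field_simp
    ring
  rw [e, e3, norm_mul, Real.norm_eq_abs, Real.norm_eq_abs]
  have e4 : |(-2 * s)| = 2 * s := by rw [abs_mul, abs_of_pos hs]; norm_num
  rw [e4]
  calc 2 * s * |cv heat5 G x s τ - 1 / (2 * s) * G x τ| ≤ 2 * s * (D * s ^ (β - 1)) := by gcongr
    _ = 2 * D * s ^ β := by
      rw [Real.rpow_sub_one hs.ne']
      field_simp

/-- For `s > 0` both sides come from convolution of `f` with the same symmetric third derivative of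
`Ψ`; the equality passes to the limit. -/
theorem newton_dd_symm (a b c : Fin 3) (hf : IsSmoothDens t₁ t₂ f) (x : E3) {τ : ℝ}
    (hτ : τ ∈ Ioo t₁ t₂) : newton a b (dd c f) x τ = newton c b (dd a f) x τ := by
  have h1 := tendsto_cv_psi2 a b (hf.dens_dd c) (hf.holder_dd c) x hτ
  have h2 := tendsto_cv_psi2 c b (hf.dens_dd a) (hf.holder_dd a) x hτ
  refine tendsto_nhds_unique h1 (h2.congr' ?_)
  filter_upwards [self_mem_nhdsWithin] with s hs
  rw [← cv_psi3_eq a b c hf x hs hτ, ← cv_psi3_eq c b a hf x hs hτ, (psi3_perm a b c).1,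
    (psi3_perm b a c).2, (psi3_perm b c a).1]

end HeatLimit

/-! ### Components of an admissible tensor field -/

section Admissible

variable {t₁ t₂ : ℝ}

/-- Each value is compared with the one at a fixed point of norm `|R| + 1`, outside the support,
where `G` vanishes for all times. -/
theorem exists_bound_of_isHolder {G : E3 → ℝ → ℝ} (hH : IsHolder t₁ t₂ G)
    (hs : ∃ R : ℝ, ∀ t ∈ Ioo t₁ t₂, ∀ x : E3, R < ‖x‖ → G x t = 0) :
    ∃ M : ℝ, 0 ≤ M ∧ ∀ t ∈ Ioo t₁ t₂, ∀ x, |G x t| ≤ M := by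
  obtain ⟨H, α, hH0, hα, -, hH⟩ := hH
  obtain ⟨R, hR⟩ := hs
  have hy : ‖(EuclideanSpace.single 0 (|R| + 1) : E3)‖ = |R| + 1 := by
    rw [PiLp.norm_single, Real.norm_eq_abs, abs_of_nonneg (by positivity)]
  set y : E3 := EuclideanSpace.single 0 (|R| + 1)
  refine ⟨H * (|R| + (|R| + 1)) ^ α, by positivity, fun t ht x => ?_⟩
  by_cases hx : R < ‖x‖
  · rw [hR t ht x hx, abs_zero]
    positivity
  · have h1 := hH t ht x y
    rw [hR t ht y (by rw [hy]; linarith [le_abs_self R]), sub_zero] at h1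
    refine h1.trans (mul_le_mul_of_nonneg_left (Real.rpow_le_rpow (norm_nonneg _) ?_ hα.le) hH0)
    refine (norm_sub_le _ _).trans ?_
    rw [hy]
    linarith [le_abs_self R]

/-- Continuity of the spatial derivatives in time is not assumed. It follows because the difference
quotients are jointly continuous and converge uniformly on the slab. -/
theorem continuousOn_dd {f : E3 → ℝ → ℝ} (c : Fin 3)
    (hc : ContinuousOn (fun p : E3 × ℝ => f p.1 p.2) (slab t₁ t₂))
    (hd : ∀ t ∈ Ioo t₁ t₂, Differentiable ℝ fun y => f y t) (hH : IsHolder t₁ t₂ (dd c f)) :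
    ContinuousOn (fun p : E3 × ℝ => dd c f p.1 p.2) (slab t₁ t₂) := by
  obtain ⟨H, α, hH0, hα, -, hH⟩ := hH
  obtain ⟨e, he⟩ : ∃ e : E3, e = EuclideanSpace.single c 1 := ⟨_, rfl⟩
  have hnorm : ‖e‖ = 1 := by simp [he]
  have hquot : ∀ h : ℝ, ContinuousOn (fun p : E3 × ℝ => (f (p.1 + h • e) p.2 - f p.1 p.2) / h)
      (slab t₁ t₂) := fun h =>
    ((hc.comp (f := fun p : E3 × ℝ => (p.1 + h • e, p.2)) (by fun_prop)
      fun p hp => ⟨mem_univ _, hp.2⟩).sub hc).div_const h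
  have hlim : Tendsto (fun h : ℝ => H * h ^ α) (𝓝[>] 0) (𝓝 0) := by
    have h : Tendsto (fun h : ℝ => H * h ^ α) (𝓝 0) (𝓝 (H * (0 : ℝ) ^ α)) :=
      (Real.continuousAt_rpow_const 0 α (Or.inr hα.le)).tendsto.const_mul _
    rw [Real.zero_rpow hα.ne', mul_zero] at h
    exact h.mono_left nhdsWithin_le_nhds
  -- By the mean value theorem a quotient with step `h` is a derivative at distance less than `h`,
  -- so the Hölder bound gives the uniform error `H h^α`.
  suffices hu : TendstoUniformlyOn (fun (h : ℝ) (p : E3 × ℝ) => (f (p.1 + h • e) p.2 - f p.1 p.2) / h)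
      (fun p => dd c f p.1 p.2) (𝓝[>] (0 : ℝ)) (slab t₁ t₂) by
    exact hu.continuousOn (Frequently.of_forall hquot)
  rw [Metric.tendstoUniformlyOn_iff]
  intro ε hε
  filter_upwards [hlim.eventually (gt_mem_nhds hε), self_mem_nhdsWithin] with h hh h0 p hp
  have h0 : 0 < h := h0
  have hderiv : ∀ s : ℝ, HasDerivAt (fun s : ℝ => f (p.1 + s • e) p.2)
      (dd c f (p.1 + s • e) p.2) s := fun s => by
    have h1 : HasDerivAt (fun s : ℝ => p.1 + s • e) e s := by
      simpa using ((hasDerivAt_id s).smul_const e).const_add p.1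
    have h2 := (hd p.2 hp.2 (p.1 + s • e)).hasFDerivAt.comp_hasDerivAt s h1
    rw [he] at h2 ⊢
    exact h2
  obtain ⟨θ, hθ, hslope⟩ := exists_hasDerivAt_eq_slope (fun s : ℝ => f (p.1 + s • e) p.2)
    (fun s => dd c f (p.1 + s • e) p.2) h0
    (fun s _ => (hderiv s).continuousAt.continuousWithinAt) (fun s _ => hderiv s)
  simp only [zero_smul, add_zero, sub_zero] at hslope
  rw [← hslope, dist_comm, Real.dist_eq]
  refine (hH p.2 hp.2 _ _).trans_lt (lt_of_le_of_lt ?_ hh)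
  rw [add_sub_cancel_left, norm_smul, hnorm, mul_one, Real.norm_eq_abs, abs_of_pos hθ.1]
  exact mul_le_mul_of_nonneg_left (Real.rpow_le_rpow hθ.1.le hθ.2.le hα.le) hH0

theorem abs_coord_tensor_le (A : Tensor3) (p : Fin 3 × Fin 3) : |A p| ≤ ‖A‖ :=
  PiLp.norm_apply_le A p

theorem Admissible.isSmoothDens {F : E3 → ℝ → Tensor3} (hF : Admissible t₁ t₂ F)
    (p : Fin 3 × Fin 3) : IsSmoothDens t₁ t₂ fun x t => F x t p := by
  obtain ⟨C, α, hα, hα1, hhol⟩ := hF.holder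
  obtain ⟨R, hR⟩ := hF.support
  have hα' : (0 : ℝ) < α := hα
  have hα1' : (α : ℝ) ≤ 1 := hα1
  have hpd : ∀ c, ∀ t ∈ Ioo t₁ t₂, ∀ x, dd c (fun x t => F x t p) x t =
      (fderiv ℝ (fun x => F x t) x (EuclideanSpace.single c 1)) p := fun c t ht x => by
    have h1 : HasFDerivAt (fun x => F x t p)
        ((EuclideanSpace.proj p : Tensor3 →L[ℝ] ℝ).comp (fderiv ℝ (fun x => F x t) x)) x :=
      (EuclideanSpace.proj p : Tensor3 →L[ℝ] ℝ).hasFDerivAt.comp x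
        (hF.differentiable t ht x).hasFDerivAt
    rw [dd, pd, h1.fderiv]
    rfl
  have hcont : ContinuousOn (fun q : E3 × ℝ => F q.1 q.2 p) (slab t₁ t₂) :=
    (EuclideanSpace.proj p : Tensor3 →L[ℝ] ℝ).continuous.comp_continuousOn hF.continuousOn
  have hdiff : ∀ t ∈ Ioo t₁ t₂, Differentiable ℝ fun y => F y t p := fun t ht =>
    (EuclideanSpace.proj p : Tensor3 →L[ℝ] ℝ).differentiable.comp (hF.differentiable t ht)
  have hH : IsHolder t₁ t₂ fun x t => F x t p := by
    refine ⟨C, α, C.2, hα', hα1', fun t ht x y => ?_⟩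
    have h := (hhol t ht).1.dist_le x y
    rw [dist_eq_norm, dist_eq_norm] at h
    exact (abs_coord_tensor_le (F x t - F y t) p).trans h
  have hH' : ∀ c, IsHolder t₁ t₂ (dd c fun x t => F x t p) := fun c => by
    refine ⟨C, α, C.2, hα', hα1', fun t ht x y => ?_⟩
    have h := (hhol t ht).2.dist_le x y
    rw [dist_eq_norm, dist_eq_norm] at h
    rw [hpd c t ht, hpd c t ht]
    refine (abs_coord_tensor_le ((fderiv ℝ (fun x => F x t) x - fderiv ℝ (fun x => F x t) y)
      (EuclideanSpace.single c 1)) p).trans ((ContinuousLinearMap.le_opNorm _ _).trans ?_)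
    simpa using h
  have hs : ∃ R : ℝ, ∀ t ∈ Ioo t₁ t₂, ∀ x : E3, R < ‖x‖ → F x t p = 0 :=
    ⟨R, fun t ht x hx => by rw [hR t ht x hx]; rfl⟩
  have hs' : ∀ c, ∃ R : ℝ, ∀ t ∈ Ioo t₁ t₂, ∀ x : E3, R < ‖x‖ →
      dd c (fun x t => F x t p) x t = 0 := fun c => by
    refine ⟨R, fun t ht x hx => ?_⟩
    have hev : (fun y => F y t p) =ᶠ[𝓝 x] fun _ => 0 := by
      filter_upwards [(isOpen_lt continuous_const continuous_norm).mem_nhds hx] with y hy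
      rw [hR t ht y hy]; rfl
    rw [dd, pd, hev.fderiv_eq]
    simp
  exact ⟨⟨hcont, exists_bound_of_isHolder hH hs, hs⟩, hH, hdiff, fun c =>
    ⟨continuousOn_dd c hcont hdiff (hH' c), exists_bound_of_isHolder (hH' c) (hs' c), hs' c⟩, hH'⟩

end Admissible

end Oseen

end

/-! ### Assembling the Oseen potential and the Stokes system -/

noncomputable section

namespace Oseen

open Filter Topology

/-- The function `u` is twice differentiable in space with gradient `g`, and differentiable in time
with time derivative `Δ u + e`, everything being continuous in the slab. -/
structure HasJet (t₁ t₂ : ℝ) (u : E3 → ℝ → ℝ) (g : Fin 3 → E3 → ℝ → ℝ) (l e : E3 → ℝ → ℝ) :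
    Prop where
  reg : SpaceRegular 2 t₁ t₂ u
  grad : ∀ t ∈ Ioo t₁ t₂, ∀ x, HasFDerivAt (fun x => u x t) (covec fun c => g c x t) x
  lap : ∀ t ∈ Ioo t₁ t₂, ∀ x, Laplacian.laplacian (fun x => u x t) x = l x t
  time : ∀ t ∈ Ioo t₁ t₂, ∀ x, HasDerivAt (fun t => u x t) (l x t + e x t) t
  contl : ContinuousOn (fun p : E3 × ℝ => l p.1 p.2) (slab t₁ t₂)
  conte : ContinuousOn (fun p : E3 × ℝ => e p.1 p.2) (slab t₁ t₂)

section

variable {t₁ t₂ : ℝ} {u u' : E3 → ℝ → ℝ} {g g' : Fin 3 → E3 → ℝ → ℝ} {l l' e e' : E3 → ℝ → ℝ}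

theorem HasJet.add (h : HasJet t₁ t₂ u g l e) (h' : HasJet t₁ t₂ u' g' l' e') :
    HasJet t₁ t₂ (fun x t => u x t + u' x t) (fun c x t => g c x t + g' c x t)
      (fun x t => l x t + l' x t) (fun x t => e x t + e' x t) where
  reg := h.reg.add h'.reg
  grad t ht x := by
    refine ((h.grad t ht x).add (h'.grad t ht x)).congr_fderiv ?_
    ext v
    simp only [covec_apply, Fin.sum_univ_three, add_apply]
    ring
  lap t ht x := by
    rw [← h.lap t ht, ← h'.lap t ht]
    exact ((h.reg.1 t ht).contDiffAt).laplacian_add ((h'.reg.1 t ht).contDiffAt)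
  time t ht x := ((h.time t ht x).add (h'.time t ht x)).congr_deriv (by ring)
  contl := h.contl.add h'.contl
  conte := h.conte.add h'.conte

theorem HasJet.const_mul (h : HasJet t₁ t₂ u g l e) (a : ℝ) :
    HasJet t₁ t₂ (fun x t => a * u x t) (fun c x t => a * g c x t)
      (fun x t => a * l x t) (fun x t => a * e x t) where
  reg := h.reg.const_mul a
  grad t ht x := by
    refine ((h.grad t ht x).const_mul a).congr_fderiv ?_
    ext v
    simp only [covec_apply, Fin.sum_univ_three, smul_apply, smul_eq_mul]
    ring
  lap t ht x := by
    rw [← h.lap t ht]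
    exact InnerProductSpace.laplacian_smul a ((h.reg.1 t ht).contDiffAt (x := x))
  time t ht x := ((h.time t ht x).const_mul a).congr_deriv (by ring)
  contl := continuousOn_const.mul h.contl
  conte := continuousOn_const.mul h.conte

theorem HasJet.sum {u : Fin 3 → E3 → ℝ → ℝ} {g : Fin 3 → Fin 3 → E3 → ℝ → ℝ}
    {l e : Fin 3 → E3 → ℝ → ℝ} (h : ∀ m, HasJet t₁ t₂ (u m) (g m) (l m) (e m)) :
    HasJet t₁ t₂ (fun x t => ∑ m, u m x t) (fun c x t => ∑ m, g m c x t)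
      (fun x t => ∑ m, l m x t) (fun x t => ∑ m, e m x t) := by
  simpa only [Fin.sum_univ_three] using ((h 0).add (h 1)).add (h 2)

theorem HasJet.congr {v : E3 → ℝ → ℝ} (h : HasJet t₁ t₂ u g l e)
    (hv : ∀ t ∈ Ioo t₁ t₂, ∀ x, v x t = u x t) : HasJet t₁ t₂ v g l e := by
  have hfun : ∀ t ∈ Ioo t₁ t₂, (fun x => v x t) = fun x => u x t := fun t ht => funext (hv t ht)
  refine ⟨h.reg.congr hv, fun t ht x => ?_, fun t ht x => ?_, fun t ht x => ?_, h.contl, h.conte⟩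
  · rw [hfun t ht]; exact h.grad t ht x
  · rw [hfun t ht]; exact h.lap t ht x
  · refine (h.time t ht x).congr_of_eventuallyEq ?_
    filter_upwards [Ioo_mem_nhds ht.1 ht.2] with s hs using hv s hs x

theorem hasJet_pot (a b c : Fin 3) {f : E3 → ℝ → ℝ} (hf : IsSmoothDens t₁ t₂ f) :
    HasJet t₁ t₂ (pot a b c t₁ f) (fun m => pot a b m t₁ (dd c f))
      (duhamel t₁ (cv (psi2t a b) (dd c f))) (newton a b (dd c f)) where
  reg := spaceRegular_pot a b c hf
  grad t ht x := hasFDerivAt_pot a b c hf x ht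
  lap t ht x := laplacian_pot a b c hf x ht
  time t ht x := (hasDerivAt_pot a b c hf x ht).congr_deriv (by ring)
  contl := (isField_cv_psi2t a b (hf.dens_dd c) (hf.holder_dd c)).continuousOn_duhamel
  conte := continuousOn_newton a b (hf.dens_dd c) (hf.holder_dd c)

end

section

variable {t₁ t₂ : ℝ} {F : E3 → ℝ → Tensor3}

/-- Tonelli: the spatial integral of the absolute value is at most `D (t-τ)^(-1/2)`, which is
integrable up to `τ = t`. -/
theorem integrable_kernel_mul {k f : E3 → ℝ → ℝ} (hk : IsKer 4 k) (hf : IsDens t₁ t₂ f) (x : E3)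
    {t : ℝ} (ht : t ∈ Ioo t₁ t₂) :
    IntegrableOn (fun p : E3 × ℝ => k (x - p.1) (t - p.2) * f p.1 p.2) (slab t₁ t) := by
  have hcont : ContinuousOn (fun p : E3 × ℝ => k (x - p.1) (t - p.2) * f p.1 p.2)
      (slab t₁ t) := by
    refine ContinuousOn.mul ?_ (hf.cont.mono (prod_mono_right (Ioo_subset_Ioo_right ht.2.le)))
    exact hk.cont.comp (f := fun p : E3 × ℝ => (x - p.1, t - p.2)) (by fun_prop)
      fun p hp => ⟨mem_univ _, sub_pos.2 hp.2.2⟩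
  have hmeas := hcont.aestronglyMeasurable (μ := volume) isOpen_slab.measurableSet
  have hμ : (volume : Measure (E3 × ℝ)).restrict (slab t₁ t) =
      (volume : Measure E3).prod (volume.restrict (Ioo t₁ t)) := by
    rw [slab, Measure.volume_eq_prod, ← Measure.prod_restrict, Measure.restrict_univ]
  obtain ⟨D, hD, hb⟩ := exists_abs_cv_le hk (by norm_num) hf
  rw [IntegrableOn]
  rw [hμ] at hmeas ⊢
  rw [integrable_prod_iff' hmeas]
  constructor
  · exact (ae_restrict_iff' measurableSet_Ioo).2 (Eventually.of_forall fun τ hτ =>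
      integrable_conv_integrand hk hf x (sub_pos.2 hτ.2) ⟨hτ.1, hτ.2.trans ht.2⟩)
  · refine ((integrableOn_rpow_sub_Ioo (β := 1 / 2) (by norm_num) t₁ t).const_mul D).mono'
      hmeas.norm.prod_swap.integral_prod_right' ?_
    refine (ae_restrict_iff' measurableSet_Ioo).2 (Eventually.of_forall fun τ hτ => ?_)
    rw [Real.norm_of_nonneg (integral_nonneg fun _ => norm_nonneg _)]
    refine (hb x (t - τ) τ (sub_pos.2 hτ.2) ⟨hτ.1, hτ.2.trans ht.2⟩).trans_eq ?_
    norm_num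

theorem integrableOn_integrand (hF : Admissible t₁ t₂ F) (i : Fin 3) (x : E3) {t : ℝ}
    (ht : t ∈ Ioo t₁ t₂) :
    IntegrableOn (fun p : E3 × ℝ => integrand F i x t p.1 p.2) (slab t₁ t) := by
  have h : IntegrableOn (fun p : E3 × ℝ => ∑ ℓ, ∑ j,
      gamD ℓ i j (x - p.1) (t - p.2) * F p.1 p.2 (ℓ, j)) (slab t₁ t) :=
    integrable_finsetSum _ fun ℓ _ => integrable_finsetSum _ fun j _ =>
      integrable_kernel_mul (isKer_gamD ℓ i j) (hF.isSmoothDens (ℓ, j)).dens x ht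
  exact h.congr_fun (fun p hp => (integrand_eq F i x p.1 hp.2.2).symm) isOpen_slab.measurableSet

theorem cv_gamD (ℓ i j : Fin 3) {f : E3 → ℝ → ℝ} (hf : IsDens t₁ t₂ f) (x : E3) {s τ : ℝ}
    (hs : 0 < s) (hτ : τ ∈ Ioo t₁ t₂) :
    cv (gamD ℓ i j) f x s τ = -(kd i j) * ∑ m, cv (psi3 m m ℓ) f x s τ + cv (psi3 i j ℓ) f x s τ := by
  have hi := fun a b c => integrable_conv_integrand (isKer_psi3 a b c) hf x hs hτ
  simp only [cv]
  rw [← integral_finsetSum _ fun m _ => hi m m ℓ, ← integral_const_mul,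
    ← integral_add ((integrable_finsetSum _ fun m _ => hi m m ℓ).const_mul _) (hi i j ℓ)]
  refine integral_congr_ae (Eventually.of_forall fun y => ?_)
  simp only [gamD, ← Finset.sum_mul]
  ring

theorem duhamel_gamD (ℓ i j : Fin 3) {f : E3 → ℝ → ℝ} (hf : IsDens t₁ t₂ f) (x : E3) {t : ℝ}
    (ht : t ∈ Ioo t₁ t₂) :
    duhamel t₁ (cv (gamD ℓ i j) f) x t =
      -(kd i j) * ∑ m, pot m m ℓ t₁ f x t + pot i j ℓ t₁ f x t := by
  have hi := fun a b c => (isField_cv_four (isKer_psi3 a b c) hf).integrableOn_duhamel x ht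
  simp only [pot, duhamel_eq ht.1]
  rw [← integral_finsetSum _ fun m _ => hi m m ℓ, ← integral_const_mul,
    ← integral_add ((integrable_finsetSum _ fun m _ => hi m m ℓ).const_mul _) (hi i j ℓ)]
  exact setIntegral_congr_fun measurableSet_Ioo fun τ hτ =>
    cv_gamD ℓ i j hf x (sub_pos.2 hτ.2) ⟨hτ.1, hτ.2.trans ht.2⟩

theorem potential_apply (hF : Admissible t₁ t₂ F) (i : Fin 3) (x : E3) {t : ℝ}
    (ht : t ∈ Ioo t₁ t₂) :
    potential t₁ F x t i = ∑ ℓ, ∑ j, (-(kd i j) * ∑ m, pot m m ℓ t₁ (fun x t => F x t (ℓ, j)) x t +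
      pot i j ℓ t₁ (fun x t => F x t (ℓ, j)) x t) := by
  have hd := fun ℓ j => (hF.isSmoothDens (ℓ, j)).dens
  simp only [← duhamel_gamD _ i _ (hd _ _) x ht]
  simp only [duhamel_eq ht.1]
  have hi := fun ℓ j =>
    (isField_cv_four (isKer_gamD ℓ i j) (hd ℓ j)).integrableOn_duhamel x ht
  rw [← Finset.sum_congr rfl fun ℓ _ => integral_finsetSum Finset.univ fun j _ => hi ℓ j,
    ← integral_finsetSum _ fun ℓ _ => integrable_finsetSum _ fun j _ => hi ℓ j]
  change ∫ τ in t₁..t, ∫ y, integrand F i x t y τ = _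
  rw [intervalIntegral.integral_of_le ht.1.le, integral_Ioc_eq_integral_Ioo]
  refine setIntegral_congr_fun measurableSet_Ioo fun τ hτ => ?_
  have hs : 0 < t - τ := sub_pos.2 hτ.2
  have hτ' : τ ∈ Ioo t₁ t₂ := ⟨hτ.1, hτ.2.trans ht.2⟩
  have hi2 := fun ℓ j => integrable_conv_integrand (isKer_gamD ℓ i j) (hd ℓ j) x hs hτ'
  simp only [integrand_eq F i x _ hτ.2, cv]
  rw [integral_finsetSum _ fun ℓ _ => integrable_finsetSum _ fun j _ => hi2 ℓ j]
  exact Finset.sum_congr rfl fun ℓ _ => integral_finsetSum _ fun j _ => hi2 ℓ j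

/-- The pressure associated with the density `F`. -/
def pressure (F : E3 → ℝ → Tensor3) (x : E3) (t : ℝ) : ℝ :=
  ∑ ℓ, ∑ j, newton ℓ j (fun x t => F x t (ℓ, j)) x t

theorem hasJet_potential (hF : Admissible t₁ t₂ F) (i : Fin 3) :
    ∃ l : E3 → ℝ → ℝ, HasJet t₁ t₂ (fun x t => potential t₁ F x t i)
      (fun c x t => ∑ ℓ, ∑ j, (-(kd i j) * ∑ m, pot m m c t₁ (dd ℓ fun x t => F x t (ℓ, j)) x t +
        pot i j c t₁ (dd ℓ fun x t => F x t (ℓ, j)) x t)) l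
      (fun x t => ∑ ℓ, ∑ j, (-(kd i j) * ∑ m, newton m m (dd ℓ fun x t => F x t (ℓ, j)) x t +
        newton i j (dd ℓ fun x t => F x t (ℓ, j)) x t)) :=
  ⟨_, (HasJet.sum fun ℓ => HasJet.sum fun j =>
    ((HasJet.sum fun m => hasJet_pot m m ℓ (hF.isSmoothDens (ℓ, j))).const_mul (-(kd i j))).add
      (hasJet_pot i j ℓ (hF.isSmoothDens (ℓ, j)))).congr fun _ ht x => potential_apply hF i x ht⟩

theorem spaceRegular_potential (hF : Admissible t₁ t₂ F) :
    SpaceRegular 2 t₁ t₂ (potential t₁ F) := by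
  choose l h using hasJet_potential hF
  exact SpaceRegular.toE3 fun i => (h i).reg

theorem timeRegular_potential (hF : Admissible t₁ t₂ F) :
    TimeRegular t₁ t₂ (potential t₁ F) := by
  choose l h using hasJet_potential hF
  set e : Fin 3 → E3 → ℝ → ℝ := fun i x t => ∑ ℓ, ∑ j,
    (-(kd i j) * ∑ m, newton m m (dd ℓ fun x t => F x t (ℓ, j)) x t +
        newton i j (dd ℓ fun x t => F x t (ℓ, j)) x t) with he
  have hd : ∀ x, ∀ t ∈ Ioo t₁ t₂, HasDerivAt (potential t₁ F x)
      (WithLp.toLp 2 fun i => l i x t + e i x t : E3) t := fun x t ht => by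
    have h1 : HasDerivAt (fun t i => potential t₁ F x t i) (fun i => l i x t + e i x t) t :=
      hasDerivAt_pi.2 fun i => (h i).time t ht x
    exact (PiLp.continuousLinearEquiv 2 ℝ (fun _ : Fin 3 => ℝ)).symm.hasFDerivAt.comp_hasDerivAt t h1
  refine ⟨fun x t ht => (hd x t ht).differentiableAt, ?_⟩
  have hc : ContinuousOn (fun p : E3 × ℝ => (WithLp.toLp 2 fun i => l i p.1 p.2 + e i p.1 p.2 : E3))
      (slab t₁ t₂) :=
    (PiLp.continuous_toLp 2 _).comp_continuousOn
      (continuousOn_pi.2 fun i => (h i).contl.add (h i).conte)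
  exact hc.congr fun p hp => (hd p.1 p.2 hp.2).deriv

theorem hasFDerivAt_pressure (hF : Admissible t₁ t₂ F) (x : E3) {t : ℝ} (ht : t ∈ Ioo t₁ t₂) :
    HasFDerivAt (fun x => pressure F x t)
      (covec fun c => ∑ ℓ, ∑ j, newton ℓ j (dd c fun x t => F x t (ℓ, j)) x t) x := by
  refine (HasFDerivAt.fun_sum fun ℓ _ => HasFDerivAt.fun_sum fun j _ =>
    hasFDerivAt_newton ℓ j (hF.isSmoothDens (ℓ, j)) x ht).congr_fderiv ?_
  ext v
  simp only [Fin.sum_univ_three, add_apply, covec_apply]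
  ring

theorem spaceRegular_pressure (hF : Admissible t₁ t₂ F) :
    SpaceRegular 1 t₁ t₂ (pressure F) := by
  refine SpaceRegular.succ_covec ?_ (fun t ht x => hasFDerivAt_pressure hF x ht) fun c =>
    SpaceRegular.zero ?_
  · exact continuousOn_finsetSum _ fun ℓ _ => continuousOn_finsetSum _ fun j _ =>
      continuousOn_newton ℓ j (hF.isSmoothDens (ℓ, j)).dens (hF.isSmoothDens (ℓ, j)).holder
  · exact continuousOn_finsetSum _ fun ℓ _ => continuousOn_finsetSum _ fun j _ =>
      continuousOn_newton ℓ j ((hF.isSmoothDens (ℓ, j)).dens_dd c)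
        ((hF.isSmoothDens (ℓ, j)).holder_dd c)

theorem pot_perm (a b c : Fin 3) (f : E3 → ℝ → ℝ) : pot a b c t₁ f = pot b a c t₁ f ∧
    pot a b c t₁ f = pot a c b t₁ f := by
  rw [pot, pot, pot, ← (psi3_perm a b c).1, ← (psi3_perm a b c).2]
  exact ⟨rfl, rfl⟩

/-- The `newton` terms in the time derivative split in two: the trace part contributes `div F`, the
other part is the gradient of the pressure. The divergence vanishes because contracting either half
of `∂Γ` with the new derivative gives the same potential with opposite sign. -/
theorem solvesStokes_potential (hF : Admissible t₁ t₂ F) :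
    SolvesStokes t₁ t₂ (potential t₁ F) (pressure F) F := by
  choose l h using hasJet_potential hF
  intro x t ht
  refine ⟨fun i => ?_, ?_⟩
  · rw [((h i).time t ht x).deriv, (h i).lap t ht x,
      pd_eq_of_hasFDerivAt (hasFDerivAt_pressure hF x ht) i, add_assoc]
    congr 1
    have e1 : ∀ ℓ j, ∑ m, newton m m (dd ℓ fun x t => F x t (ℓ, j)) x t =
        -dd ℓ (fun x t => F x t (ℓ, j)) x t := fun ℓ j =>
      sum_newton_eq ((hF.isSmoothDens (ℓ, j)).dens_dd ℓ) ((hF.isSmoothDens (ℓ, j)).holder_dd ℓ) x ht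
    -- Exchanging `i` and `ℓ` moves the free index onto the density, where it becomes the derivative
    -- of the pressure.
    have e2 : ∀ ℓ j, newton i j (dd ℓ fun x t => F x t (ℓ, j)) x t =
        newton ℓ j (dd i fun x t => F x t (ℓ, j)) x t := fun ℓ j =>
      newton_dd_symm i j ℓ (hF.isSmoothDens (ℓ, j)) x ht
    simp only [e1, e2, neg_mul_neg, Finset.sum_add_distrib]
    rw [add_comm]
    congr 1
    refine Finset.sum_congr rfl fun ℓ _ => ?_
    simp [kd, dd]
  · have e : ∀ i, pd i (fun y => potential t₁ F y t i) x =
        ∑ ℓ, ∑ j, (-(kd i j) * ∑ m, pot m m i t₁ (dd ℓ fun x t => F x t (ℓ, j)) x t +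
          pot i j i t₁ (dd ℓ fun x t => F x t (ℓ, j)) x t) := fun i =>
      pd_eq_of_hasFDerivAt ((h i).grad t ht x) i
    simp only [e]
    rw [Finset.sum_comm]
    refine Finset.sum_eq_zero fun ℓ _ => ?_
    rw [Finset.sum_comm]
    refine Finset.sum_eq_zero fun j _ => ?_
    rw [Finset.sum_add_distrib]
    have e3 : ∀ i, pot i j i t₁ (dd ℓ fun x t => F x t (ℓ, j)) x t =
        pot i i j t₁ (dd ℓ fun x t => F x t (ℓ, j)) x t := fun i => by rw [(pot_perm i j i _).2]
    simp only [e3]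
    simp [kd]

end

end Oseen

end

/-! ### Minkowski's and Young's inequalities for nonnegative functions -/

noncomputable section

namespace Oseen

open Filter Topology ENNReal

section Inequalities

variable {X Y : Type*} [MeasurableSpace X] [MeasurableSpace Y] {μ : Measure X} {ν : Measure Y}

/-- Duality arguments divide by a power of `∫ g^r`, which may be infinite. Truncating in height and
to sets of finite measure makes it finite, and monotone convergence recovers `g`. -/
theorem lintegral_rpow_le_of_truncations [SigmaFinite μ] {g : X → ℝ≥0∞} (hg : Measurable g) {r : ℝ}
    (hr : 0 < r) {B : ℝ≥0∞}
    (h : ∀ u : X → ℝ≥0∞, Measurable u → (∀ x, u x ≤ g x) → (∀ x, u x ≠ ⊤) →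
      ∫⁻ x, u x ^ r ∂μ ≠ ⊤ → ∫⁻ x, u x ^ r ∂μ ≤ B) : ∫⁻ x, g x ^ r ∂μ ≤ B := by
  set u : ℕ → X → ℝ≥0∞ := fun n => (spanningSets μ n).indicator fun x => min (g x) n with hu
  have hin : ∀ n, ∀ x ∈ spanningSets μ n, u n x = min (g x) n := fun n x hx =>
    indicator_of_mem hx _
  have hout : ∀ n, ∀ x ∉ spanningSets μ n, u n x = 0 := fun n x hx => indicator_of_notMem hx _
  have hle : ∀ n x, u n x ≤ min (g x) n := fun n x => by
    by_cases hx : x ∈ spanningSets μ n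
    · exact (hin n x hx).le
    · rw [hout n x hx]; exact zero_le
  have hmeas : ∀ n, Measurable (u n) := fun n =>
    (hg.min measurable_const).indicator (measurableSet_spanningSets μ n)
  have hmono : Monotone fun n x => u n x ^ r := by
    intro n m hnm x
    refine ENNReal.rpow_le_rpow ?_ hr.le
    refine (indicator_le_indicator_of_subset (monotone_spanningSets μ hnm)
      (fun _ => zero_le) x).trans (indicator_le_indicator ?_)
    exact min_le_min le_rfl (by exact_mod_cast hnm)
  have hsup : ∀ x, ⨆ n, u n x ^ r = g x ^ r := by
    intro x
    refine iSup_eq_of_tendsto (fun n m hnm => hmono hnm x) ?_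
    refine Tendsto.ennrpow_const r ?_
    have h1 : Tendsto (fun n : ℕ => min (g x) (n : ℝ≥0∞)) atTop (𝓝 (min (g x) ⊤)) :=
      tendsto_const_nhds.min ENNReal.tendsto_nat_nhds_top
    rw [min_top_right] at h1
    refine h1.congr' ?_
    obtain ⟨N, hN⟩ := mem_iUnion.1 ((iUnion_spanningSets μ).symm ▸ mem_univ x)
    filter_upwards [eventually_ge_atTop N] with n hn
    exact (hin n x (monotone_spanningSets μ hn hN)).symm
  simp_rw [← hsup]
  rw [lintegral_iSup (fun n => (hmeas n).pow_const r) hmono]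
  refine iSup_le fun n => h _ (hmeas n) (fun x => (hle n x).trans (min_le_left _ _))
    (fun x => ne_top_of_le_ne_top (ENNReal.natCast_ne_top n) ((hle n x).trans (min_le_right _ _))) ?_
  · have h1 : ∫⁻ x, u n x ^ r ∂μ ≤ ∫⁻ x, (spanningSets μ n).indicator (fun _ => (n : ℝ≥0∞) ^ r) x ∂μ := by
      refine lintegral_mono fun x => ?_
      by_cases hx : x ∈ spanningSets μ n
      · rw [hin n x hx, indicator_of_mem hx]
        exact ENNReal.rpow_le_rpow (min_le_right _ _) hr.le
      · rw [hout n x hx, indicator_of_notMem hx, ENNReal.zero_rpow_of_pos hr]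
    refine ne_top_of_le_ne_top ?_ h1
    rw [lintegral_indicator_const (measurableSet_spanningSets μ n)]
    exact ENNReal.mul_ne_top (ENNReal.rpow_ne_top_of_nonneg hr.le (ENNReal.natCast_ne_top n))
      (measure_spanningSets_lt_top μ n).ne

theorem rpow_inv_le_of_le_mul_rpow {U B : ℝ≥0∞} {r : ℝ} (hr : 1 < r) (hU : U ≠ ⊤)
    (h : U ≤ U ^ (1 - 1 / r) * B) : U ^ (1 / r) ≤ B := by
  have hr0 : 0 < 1 / r := by positivity
  rcases eq_or_ne U 0 with h0 | h0
  · rw [h0, ENNReal.zero_rpow_of_pos hr0]; exact zero_le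
  have e : U = U ^ (1 - 1 / r) * U ^ (1 / r) := by
    rw [← ENNReal.rpow_add _ _ h0 hU, sub_add_cancel, ENNReal.rpow_one]
  have h1 : U ^ (1 - 1 / r) ≠ 0 := by simp [ENNReal.rpow_eq_zero_iff, h0, hU]
  have h2 : U ^ (1 - 1 / r) ≠ ⊤ := by simp [ENNReal.rpow_eq_top_iff, h0, hU]
  rw [← ENNReal.mul_le_mul_iff_right h1 h2]
  exact e.symm.trans_le h

/-- Minkowski's integral inequality. -/
theorem lintegral_rpow_lintegral_le [SigmaFinite μ] [SFinite ν] {f : X → Y → ℝ≥0∞}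
    (hf : Measurable (Function.uncurry f)) {r : ℝ} (hr : 1 < r) :
    (∫⁻ x, (∫⁻ y, f x y ∂ν) ^ r ∂μ) ^ (1 / r) ≤ ∫⁻ y, (∫⁻ x, f x y ^ r ∂μ) ^ (1 / r) ∂ν := by
  set B := ∫⁻ y, (∫⁻ x, f x y ^ r ∂μ) ^ (1 / r) ∂ν
  have hr0 : 0 < r := by linarith
  have hconj : (Real.conjExponent r).HolderConjugate r :=
    (Real.HolderConjugate.conjExponent hr).symm
  have hce : 1 / Real.conjExponent r = 1 - 1 / r := by
    have := hconj.inv_add_inv_eq_one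
    rw [one_div, one_div]
    linarith
  have hce2 : (r - 1) * Real.conjExponent r = r := by
    rw [Real.conjExponent]; field_simp [(by linarith : r - 1 ≠ 0)]
  have key : ∫⁻ x, (∫⁻ y, f x y ∂ν) ^ r ∂μ ≤ B ^ r := by
    refine lintegral_rpow_le_of_truncations hf.lintegral_prod_right' hr0 fun u hu hug htop hfin => ?_
    -- Only one of the `r` factors of `u` is replaced by the larger inner integral. Hölder then
    -- returns `(∫ u^r)^(1-1/r)`, which can be divided out.
    have h1 : ∫⁻ x, u x ^ r ∂μ ≤ (∫⁻ x, u x ^ r ∂μ) ^ (1 - 1 / r) * B := by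
      calc ∫⁻ x, u x ^ r ∂μ = ∫⁻ x, u x ^ (r - 1) * u x ∂μ := by
            refine lintegral_congr fun x => ?_
            conv_rhs => rw [← ENNReal.rpow_one (u x), ← ENNReal.rpow_mul, one_mul,
              ← ENNReal.rpow_add_of_nonneg _ _ (by linarith) zero_le_one, sub_add_cancel]
        _ ≤ ∫⁻ x, u x ^ (r - 1) * ∫⁻ y, f x y ∂ν ∂μ :=
            lintegral_mono fun x => mul_le_mul_right (hug x) _
        _ = ∫⁻ x, ∫⁻ y, u x ^ (r - 1) * f x y ∂ν ∂μ := by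
            refine lintegral_congr fun x => ?_
            rw [lintegral_const_mul]
            exact hf.comp measurable_prodMk_left
        _ = ∫⁻ y, ∫⁻ x, u x ^ (r - 1) * f x y ∂μ ∂ν := by
            refine lintegral_lintegral_swap (Measurable.aemeasurable ?_)
            exact ((hu.pow_const _).comp measurable_fst).mul hf
        _ ≤ ∫⁻ y, (∫⁻ x, u x ^ r ∂μ) ^ (1 - 1 / r) * (∫⁻ x, f x y ^ r ∂μ) ^ (1 / r) ∂ν := by
            refine lintegral_mono fun y => ?_
            have := ENNReal.lintegral_mul_le_Lp_mul_Lq μ hconj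
              (f := fun x => u x ^ (r - 1)) (g := fun x => f x y) (hu.pow_const _).aemeasurable
              (hf.comp measurable_prodMk_right).aemeasurable
            simp only [← ENNReal.rpow_mul, hce2, hce] at this
            exact this
        _ = _ := by
            rw [lintegral_const_mul]
            exact (Measurable.lintegral_prod_left' (hf.pow_const r)).pow_const _
    have h2 := rpow_inv_le_of_le_mul_rpow hr hfin h1
    calc ∫⁻ x, u x ^ r ∂μ = ((∫⁻ x, u x ^ r ∂μ) ^ (1 / r)) ^ r := by
          rw [← ENNReal.rpow_mul, one_div_mul_cancel hr0.ne', ENNReal.rpow_one]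
      _ ≤ B ^ r := ENNReal.rpow_le_rpow h2 hr0.le
  calc (∫⁻ x, (∫⁻ y, f x y ∂ν) ^ r ∂μ) ^ (1 / r) ≤ (B ^ r) ^ (1 / r) :=
        ENNReal.rpow_le_rpow key (by positivity)
    _ = B := by rw [← ENNReal.rpow_mul, mul_one_div_cancel hr0.ne', ENNReal.rpow_one]

/-- Young's convolution inequality. -/
theorem lintegral_rpow_conv_le {k f : E3 → ℝ≥0∞} (hk : Measurable k) (hf : Measurable f)
    {a p r : ℝ} (ha : 0 < a) (hp : 0 < p) (hr : 0 < r) (har : 1 / r ≤ 1 / a)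
    (hpr : 1 / r ≤ 1 / p) (hsum : 1 + 1 / r = 1 / a + 1 / p) :
    (∫⁻ x, (∫⁻ y, k (x - y) * f y) ^ r) ^ (1 / r) ≤
      (∫⁻ x, k x ^ a) ^ (1 / a) * (∫⁻ x, f x ^ p) ^ (1 / p) := by
  set K := ∫⁻ x, k x ^ a with hK
  set P := ∫⁻ x, f x ^ p with hP
  have hr' : 0 < 1 / r := by positivity
  have split (z : ℝ≥0∞) {s : ℝ} (hs : 0 < s) (hsr : 1 / r ≤ 1 / s) :
      (z ^ s) ^ (1 / r) * (z ^ s) ^ (1 / s - 1 / r) = z := by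
    rw [← ENNReal.rpow_add_of_nonneg _ _ hr'.le (by linarith), ← ENNReal.rpow_mul]
    have : s * (1 / r + (1 / s - 1 / r)) = 1 := by field_simp; ring
    rw [this, ENNReal.rpow_one]
  have hpt : ∀ x, ∫⁻ y, k (x - y) * f y ≤ (∫⁻ y, k (x - y) ^ a * f y ^ p) ^ (1 / r) *
      (K ^ (1 / a - 1 / r) * P ^ (1 / p - 1 / r)) := by
    intro x
    have hkx : Measurable fun y => k (x - y) := hk.comp (by fun_prop)
    -- Hölder with three factors: `k f` is split as `(k^a f^p)^(1/r) (k^a)^(1/a-1/r)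
    -- (f^p)^(1/p-1/r)`. The exponents are nonnegative by hypothesis and add up to 1 by the Young
    -- relation.
    have h := ENNReal.lintegral_prod_norm_pow_le (μ := (volume : Measure E3)) Finset.univ
      (f := ![fun y => k (x - y) ^ a * f y ^ p, fun y => k (x - y) ^ a, fun y => f y ^ p])
      (p := ![1 / r, 1 / a - 1 / r, 1 / p - 1 / r])
      (fun i _ => by
        fin_cases i
        · exact ((hkx.pow_const a).mul (hf.pow_const p)).aemeasurable
        · exact (hkx.pow_const a).aemeasurable
        · exact (hf.pow_const p).aemeasurable)
      (by simp [Fin.sum_univ_three]; simp only [one_div] at hsum; linarith)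
      (fun i _ => by
        fin_cases i
        · exact hr'.le
        · exact sub_nonneg.2 har
        · exact sub_nonneg.2 hpr)
    simp only [Fin.prod_univ_three, Matrix.cons_val_zero, Matrix.cons_val_one,
      Matrix.cons_val] at h
    have e1 : ∫⁻ y, k (x - y) ^ a = K := lintegral_sub_left_eq_self (fun z => k z ^ a) x
    rw [e1, mul_assoc] at h
    refine le_trans (le_of_eq (lintegral_congr fun y => ?_)) h
    rw [ENNReal.mul_rpow_of_nonneg _ _ hr'.le]
    conv_lhs => rw [← split (k (x - y)) ha har, ← split (f y) hp hpr]
    ring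
  have hdouble : ∫⁻ x, ∫⁻ y, k (x - y) ^ a * f y ^ p = K * P := by
    rw [lintegral_lintegral_swap]
    · calc ∫⁻ y, ∫⁻ x, k (x - y) ^ a * f y ^ p = ∫⁻ y, K * f y ^ p := by
            refine lintegral_congr fun y => ?_
            have hky : Measurable fun x => k (x - y) := hk.comp (by fun_prop)
            rw [lintegral_mul_const _ (hky.pow_const a)]
            congr 1
            exact lintegral_sub_right_eq_self (fun z => k z ^ a) y
        _ = K * P := lintegral_const_mul _ (hf.pow_const p)
    · exact (((hk.comp (by fun_prop : Measurable fun z : E3 × E3 => z.1 - z.2)).pow_const a).mul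
        ((hf.comp measurable_snd).pow_const p)).aemeasurable
  have hmeas : Measurable fun x => ∫⁻ y, k (x - y) ^ a * f y ^ p :=
    Measurable.lintegral_prod_right' (f := fun z : E3 × E3 => k (z.1 - z.2) ^ a * f z.2 ^ p)
      (((hk.comp (by fun_prop : Measurable fun z : E3 × E3 => z.1 - z.2)).pow_const a).mul
        ((hf.comp measurable_snd).pow_const p))
  calc (∫⁻ x, (∫⁻ y, k (x - y) * f y) ^ r) ^ (1 / r)
      ≤ (∫⁻ x, (∫⁻ y, k (x - y) ^ a * f y ^ p) *
          (K ^ (1 / a - 1 / r) * P ^ (1 / p - 1 / r)) ^ r) ^ (1 / r) := by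
        refine ENNReal.rpow_le_rpow (lintegral_mono fun x => ?_) hr'.le
        refine (ENNReal.rpow_le_rpow (hpt x) hr.le).trans_eq ?_
        rw [ENNReal.mul_rpow_of_nonneg _ _ hr.le, ← ENNReal.rpow_mul, one_div_mul_cancel hr.ne',
          ENNReal.rpow_one]
    _ = (K * P) ^ (1 / r) * (K ^ (1 / a - 1 / r) * P ^ (1 / p - 1 / r)) := by
        rw [lintegral_mul_const _ hmeas, hdouble, ENNReal.mul_rpow_of_nonneg _ _ hr'.le,
          ← ENNReal.rpow_mul _ r, mul_one_div_cancel hr.ne', ENNReal.rpow_one]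
    _ = (K ^ (1 / r) * K ^ (1 / a - 1 / r)) * (P ^ (1 / r) * P ^ (1 / p - 1 / r)) := by
        rw [ENNReal.mul_rpow_of_nonneg _ _ hr'.le]
        ring
    _ = _ := by
        rw [← ENNReal.rpow_add_of_nonneg _ _ hr'.le (by linarith),
          ← ENNReal.rpow_add_of_nonneg _ _ hr'.le (by linarith)]
        congr 2 <;> ring

end Inequalities

end Oseen

end

/-! ### The bilinear Hardy–Littlewood–Sobolev inequality on the line -/

noncomputable section

namespace Oseen

open Filter Topology ENNReal

/-- The one-sided Riesz kernel `u ^ (-lam)`, `u > 0`. -/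
def riesz (lam : ℝ) : ℝ → ℝ≥0∞ := (Ioi 0).indicator fun u => ENNReal.ofReal (u ^ (-lam))

theorem measurable_riesz (lam : ℝ) : Measurable (riesz lam) :=
  (by fun_prop : Measurable fun u : ℝ => ENNReal.ofReal (u ^ (-lam))).indicator measurableSet_Ioi

theorem lintegral_rpow_Ioc {c T : ℝ} (hc : -1 < c) (hT : 0 ≤ T) :
    ∫⁻ u in Ioc 0 T, ENNReal.ofReal (u ^ c) = ENNReal.ofReal (T ^ (c + 1) / (c + 1)) := by
  have hint : IntegrableOn (fun u : ℝ => u ^ c) (Ioc 0 T) :=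
    (intervalIntegrable_iff_integrableOn_Ioc_of_le hT).1
      (intervalIntegral.intervalIntegrable_rpow' hc)
  rw [← ofReal_integral_eq_lintegral_ofReal hint
    ((ae_restrict_iff' measurableSet_Ioc).2 (Eventually.of_forall fun u hu =>
      Real.rpow_nonneg hu.1.le _)), ← intervalIntegral.integral_of_le hT, integral_rpow (Or.inl hc),
    Real.zero_rpow (by linarith), sub_zero]

/-- Among sets of given measure the kernel is largest in integral over an interval at its
singularity. The map `φ` stands for `t - s` as a function of either variable; only invariance of the
integral under it is used. -/
theorem lintegral_riesz_comp_le {lam : ℝ} (h0 : 0 < lam) (h1 : lam < 1) {φ : ℝ → ℝ}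
    (hinv : ∀ g : ℝ → ℝ≥0∞, ∫⁻ s, g (φ s) = ∫⁻ s, g s) (B : Set ℝ) :
    ∫⁻ s in B, riesz lam (φ s) ≤ ENNReal.ofReal (1 / (1 - lam) + 1) * volume B ^ (1 - lam) := by
  have hpos : 0 < 1 / (1 - lam) + 1 := by
    have : 0 < 1 - lam := by linarith
    positivity
  rcases eq_or_ne (volume B) 0 with hz | hz
  · rw [setLIntegral_measure_zero _ _ hz]; exact zero_le
  rcases eq_or_ne (volume B) ⊤ with ht | ht
  · rw [ht, ENNReal.top_rpow_of_pos (by linarith), ENNReal.mul_top (by simpa using hpos)]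
    exact le_top
  set d := (volume B).toReal with hd
  have hd0 : 0 < d := ENNReal.toReal_pos hz ht
  have hvol : volume B = ENNReal.ofReal d := (ENNReal.ofReal_toReal ht).symm
  -- The kernel is split at `d`, the measure of the set: below `d` it is integrated exactly, above
  -- `d` it is at most `d^(-lam)`. Both parts give `d^(1-lam)`.
  have hpt : ∀ u, riesz lam u ≤
      (Ioc 0 d).indicator (fun u => ENNReal.ofReal (u ^ (-lam))) u + ENNReal.ofReal (d ^ (-lam)) := by
    intro u
    by_cases hu : u ∈ Ioi (0 : ℝ)
    · rw [riesz, indicator_of_mem hu]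
      by_cases hud : u ≤ d
      · rw [indicator_of_mem (show u ∈ Ioc 0 d from ⟨hu, hud⟩)]
        exact le_self_add
      · refine le_add_left (ENNReal.ofReal_le_ofReal ?_)
        exact Real.rpow_le_rpow_of_nonpos hd0 (not_le.1 hud).le (by linarith)
    · rw [riesz, indicator_of_notMem hu]; exact zero_le
  calc ∫⁻ s in B, riesz lam (φ s)
      ≤ ∫⁻ s in B, ((Ioc 0 d).indicator (fun u => ENNReal.ofReal (u ^ (-lam))) (φ s) +
          ENNReal.ofReal (d ^ (-lam))) := lintegral_mono fun s => hpt _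
    _ = (∫⁻ s in B, (Ioc 0 d).indicator (fun u => ENNReal.ofReal (u ^ (-lam))) (φ s)) +
          ENNReal.ofReal (d ^ (-lam)) * volume B := by
        rw [lintegral_add_right _ measurable_const, setLIntegral_const]
    _ ≤ (∫⁻ s, (Ioc 0 d).indicator (fun u => ENNReal.ofReal (u ^ (-lam))) (φ s)) +
          ENNReal.ofReal (d ^ (-lam)) * volume B := by
        gcongr; exact Measure.restrict_le_self
    _ = ENNReal.ofReal (d ^ (-lam + 1) / (-lam + 1)) +
          ENNReal.ofReal (d ^ (-lam)) * ENNReal.ofReal d := by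
        rw [hinv, lintegral_indicator measurableSet_Ioc, lintegral_rpow_Ioc (by linarith) hd0.le,
          hvol]
    _ = _ := by
        rw [hvol, ENNReal.ofReal_rpow_of_pos hd0, ← ENNReal.ofReal_mul (by positivity),
          ← ENNReal.ofReal_mul hpos.le, ← ENNReal.ofReal_add
            (div_nonneg (by positivity) (by linarith)) (by positivity)]
        congr 1
        rw [← Real.rpow_add_one hd0.ne', show -lam + 1 = 1 - lam by ring]
        ring

/-- The layer cake formula for the measure with density `H`. -/
theorem lintegral_ofReal_mul_eq {X : Type*} [MeasurableSpace X] {μ : Measure X} {f : X → ℝ}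
    (hf : Measurable f) (hf0 : ∀ x, 0 ≤ f x) {H : X → ℝ≥0∞} (hH : Measurable H) :
    ∫⁻ x, H x * ENNReal.ofReal (f x) ∂μ = ∫⁻ a in Ioi (0 : ℝ), ∫⁻ x in {x | a < f x}, H x ∂μ := by
  have h := lintegral_eq_lintegral_meas_lt (μ.withDensity H) (f := f)
    (Eventually.of_forall hf0) hf.aemeasurable
  rw [lintegral_withDensity_eq_lintegral_mul μ hH hf.ennreal_ofReal] at h
  refine h.trans (lintegral_congr fun a => ?_)
  exact withDensity_apply _ (measurableSet_lt measurable_const hf)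

theorem lintegral_Ioc_rpow_le {lam q : ℝ} (h0 : 0 < lam) (h1 : lam < 1)
    (hql : q * (1 - lam) < 1) {β : ℝ → ℝ≥0∞} (hβ : Measurable β)
    (hβ1 : ∫⁻ b in Ioi (0 : ℝ), β b * ENNReal.ofReal (b ^ (q - 1)) ≤ 1) {T : ℝ} (hT : 0 < T) :
    ∫⁻ b in Ioc 0 T, β b ^ (1 - lam) ≤
      ENNReal.ofReal ((1 / (1 - (q - 1) * (1 - lam) / lam)) ^ lam) *
        ENNReal.ofReal (T ^ (1 - q * (1 - lam))) := by
  have hl : 0 < 1 - lam := by linarith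
  -- The weight `b^m` is chosen so that Hölder with exponent `1/(1-lam)` reproduces the normalised
  -- integrand `β b^(q-1)`. The dual weight `b^(-m/lam)` is integrable at 0 precisely because `q
  -- (1-lam) < 1`.
  set m := (q - 1) * (1 - lam) with hm
  have hm1 : m / lam < 1 := by
    rw [div_lt_one h0, hm]; nlinarith
  have hconj : (1 / (1 - lam)).HolderConjugate (1 / lam) := by
    rw [Real.holderConjugate_iff]
    refine ⟨by rw [lt_div_iff₀ hl]; linarith, by simp⟩
  have hmeas : Measurable fun b : ℝ => ENNReal.ofReal (b ^ m) := by fun_prop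
  have hmeas' : Measurable fun b : ℝ => ENNReal.ofReal (b ^ (-m)) := by fun_prop
  have hH := ENNReal.lintegral_mul_le_Lp_mul_Lq (volume.restrict (Ioc 0 T)) hconj
    (f := fun b => β b ^ (1 - lam) * ENNReal.ofReal (b ^ m))
    (g := fun b => ENNReal.ofReal (b ^ (-m)))
    ((hβ.pow_const _).mul hmeas).aemeasurable hmeas'.aemeasurable
  have e0 : ∫⁻ b in Ioc 0 T, β b ^ (1 - lam) = ∫⁻ b in Ioc 0 T,
      ((fun b => β b ^ (1 - lam) * ENNReal.ofReal (b ^ m)) *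
        fun b => ENNReal.ofReal (b ^ (-m))) b := by
    refine setLIntegral_congr_fun measurableSet_Ioc fun b hb => ?_
    rw [Pi.mul_apply, mul_assoc, ← ENNReal.ofReal_mul (Real.rpow_nonneg hb.1.le _), ← Real.rpow_add hb.1,
      add_neg_cancel, Real.rpow_zero, ENNReal.ofReal_one, mul_one]
  have e1 : ∫⁻ b in Ioc 0 T, (β b ^ (1 - lam) * ENNReal.ofReal (b ^ m)) ^ (1 / (1 - lam)) ≤ 1 := by
    calc ∫⁻ b in Ioc 0 T, (β b ^ (1 - lam) * ENNReal.ofReal (b ^ m)) ^ (1 / (1 - lam))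
        = ∫⁻ b in Ioc 0 T, β b * ENNReal.ofReal (b ^ (q - 1)) := by
          refine setLIntegral_congr_fun measurableSet_Ioc fun b hb => ?_
          rw [ENNReal.mul_rpow_of_nonneg _ _ (by positivity), ← ENNReal.rpow_mul,
            mul_one_div_cancel hl.ne', ENNReal.rpow_one,
            ENNReal.ofReal_rpow_of_pos (Real.rpow_pos_of_pos hb.1 _), ← Real.rpow_mul hb.1.le, hm,
            mul_assoc, mul_one_div_cancel hl.ne', mul_one]
      _ ≤ ∫⁻ b in Ioi (0 : ℝ), β b * ENNReal.ofReal (b ^ (q - 1)) :=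
          lintegral_mono_set Ioc_subset_Ioi_self
      _ ≤ 1 := hβ1
  have e2 : ∫⁻ b in Ioc 0 T, ENNReal.ofReal (b ^ (-m)) ^ (1 / lam) =
      ENNReal.ofReal (T ^ (1 - m / lam) * (1 / (1 - m / lam))) := by
    have h2 : ∫⁻ b in Ioc 0 T, ENNReal.ofReal (b ^ (-m)) ^ (1 / lam) =
        ∫⁻ b in Ioc 0 T, ENNReal.ofReal (b ^ (-(m / lam))) := by
      refine setLIntegral_congr_fun measurableSet_Ioc fun b hb => ?_
      rw [ENNReal.ofReal_rpow_of_pos (Real.rpow_pos_of_pos hb.1 _), ← Real.rpow_mul hb.1.le]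
      congr 2
      ring
    rw [h2, lintegral_rpow_Ioc (by linarith) hT.le, show -(m / lam) + 1 = 1 - m / lam by ring,
      mul_one_div]
  have h3 : 0 < 1 - m / lam := by linarith
  rw [e0]
  refine hH.trans ?_
  rw [one_div_one_div, one_div_one_div, e2]
  calc (∫⁻ b in Ioc 0 T, (β b ^ (1 - lam) * ENNReal.ofReal (b ^ m)) ^ (1 / (1 - lam))) ^ (1 - lam) *
        ENNReal.ofReal (T ^ (1 - m / lam) * (1 / (1 - m / lam))) ^ lam
      ≤ 1 ^ (1 - lam) * ENNReal.ofReal (T ^ (1 - m / lam) * (1 / (1 - m / lam))) ^ lam := by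
        gcongr
    _ = _ := by
        rw [ENNReal.one_rpow, one_mul, ENNReal.ofReal_rpow_of_nonneg (by positivity) h0.le,
          Real.mul_rpow (by positivity) (by positivity), mul_comm,
          ENNReal.ofReal_mul (by positivity), ← Real.rpow_mul hT.le]
        congr 3
        rw [hm]
        field_simp
        ring

theorem lintegral_lintegral_Ioc_rpow_le {lam p q : ℝ} (h0 : 0 < lam) (h1 : lam < 1) (hp : 1 < p)
    (hq : 1 < q) (hsum : 1 / p + 1 / q + lam = 2) {α β : ℝ → ℝ≥0∞} (hβ : Measurable β)
    (hα1 : ∫⁻ b in Ioi (0 : ℝ), α b * ENNReal.ofReal (b ^ (p - 1)) ≤ 1)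
    (hβ1 : ∫⁻ b in Ioi (0 : ℝ), β b * ENNReal.ofReal (b ^ (q - 1)) ≤ 1) :
    ∫⁻ a in Ioi (0 : ℝ), α a * ∫⁻ b in Ioc 0 (a ^ (p / q)), β b ^ (1 - lam) ≤
      ENNReal.ofReal ((1 / (1 - (q - 1) * (1 - lam) / lam)) ^ lam) := by
  have hp0 : 0 < p := by linarith
  have hq0 : 0 < q := by linarith
  have hp1 : 1 / p < 1 := by rw [div_lt_one hp0]; exact hp
  have hql : q * (1 - lam) < 1 := by
    have h2 : 1 - lam < 1 / q := by linarith
    calc q * (1 - lam) < q * (1 / q) := by gcongr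
      _ = 1 := by field_simp
  set C := ENNReal.ofReal ((1 / (1 - (q - 1) * (1 - lam) / lam)) ^ lam)
  calc ∫⁻ a in Ioi (0 : ℝ), α a * ∫⁻ b in Ioc 0 (a ^ (p / q)), β b ^ (1 - lam)
      ≤ ∫⁻ a in Ioi (0 : ℝ), C * (α a * ENNReal.ofReal (a ^ (p - 1))) := by
        refine setLIntegral_mono_ae' measurableSet_Ioi (Eventually.of_forall fun a ha => ?_)
        have ha : 0 < a := ha
        have h2 := lintegral_Ioc_rpow_le h0 h1 hql hβ hβ1 (Real.rpow_pos_of_pos ha (p / q))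
        rw [← Real.rpow_mul ha.le] at h2
        -- The cut at `a^(p/q)` is the right one: the exponent relation turns the inner bound into
        -- `a^(p-1)`, the weight in the normalisation of `α`.
        have e : p / q * (1 - q * (1 - lam)) = p - 1 := by
          have : lam = 2 - 1 / p - 1 / q := by linarith
          rw [this]
          field_simp
          ring
        rw [e] at h2
        calc α a * ∫⁻ b in Ioc 0 (a ^ (p / q)), β b ^ (1 - lam)
            ≤ α a * (C * ENNReal.ofReal (a ^ (p - 1))) := by gcongr
          _ = _ := by ring
    _ = C * ∫⁻ a in Ioi (0 : ℝ), α a * ENNReal.ofReal (a ^ (p - 1)) :=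
        lintegral_const_mul' _ _ ENNReal.ofReal_ne_top
    _ ≤ C * 1 := by gcongr
    _ = C := mul_one C

/-- The layer cake formula for `f^p`, with its factor `p ≥ 1` discarded. -/
theorem lintegral_meas_lt_mul_le {f : ℝ → ℝ} (hf : Measurable f) (hf0 : ∀ x, 0 ≤ f x) {p : ℝ}
    (hp : 1 < p) (h1 : ∫⁻ t, ENNReal.ofReal (f t ^ p) ≤ 1) :
    ∫⁻ b in Ioi (0 : ℝ), volume {t | b < f t} * ENNReal.ofReal (b ^ (p - 1)) ≤ 1 := by
  rw [lintegral_rpow_eq_lintegral_meas_lt_mul volume (Eventually.of_forall hf0) hf.aemeasurable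
    (by linarith)] at h1
  refine le_trans ?_ h1
  exact le_mul_of_one_le_left zero_le (by simpa using hp.le)

theorem measurable_meas_lt (f : ℝ → ℝ) : Measurable fun b => volume {t | b < f t} :=
  Antitone.measurable fun _ _ hab => measure_mono fun _ ht => lt_of_le_of_lt hab ht

/-- The bilinear Hardy–Littlewood–Sobolev inequality for normalised functions. -/
theorem lintegral_riesz_bilinear_le {lam p q : ℝ} (h0 : 0 < lam) (h1 : lam < 1) (hp : 1 < p)
    (hq : 1 < q) (hsum : 1 / p + 1 / q + lam = 2) : ∃ C : ℝ, 0 < C ∧ ∀ f h : ℝ → ℝ,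
      Measurable f → Measurable h → (∀ t, 0 ≤ f t) → (∀ t, 0 ≤ h t) →
      ∫⁻ t, ENNReal.ofReal (f t ^ p) ≤ 1 → ∫⁻ t, ENNReal.ofReal (h t ^ q) ≤ 1 →
      ∫⁻ t, (∫⁻ s, riesz lam (t - s) * ENNReal.ofReal (f s)) * ENNReal.ofReal (h t) ≤
        ENNReal.ofReal C := by
  have hl : 0 < 1 - lam := by linarith
  have hp0 : 0 < p := by linarith
  have hq0 : 0 < q := by linarith
  set c := 1 / (1 - lam) + 1 with hc
  have hc0 : 0 < c := by positivity
  -- The absolute values make nonnegativity immediate, without checking the sign of the base.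
  set C₁ := |(1 / (1 - (q - 1) * (1 - lam) / lam)) ^ lam|
  set C₂ := |(1 / (1 - (p - 1) * (1 - lam) / lam)) ^ lam|
  refine ⟨c * (C₁ + C₂) + 1, by positivity, fun f h hf hh hf0 hh0 hf1 hh1 => ?_⟩
  set α : ℝ → ℝ≥0∞ := fun a => volume {t | a < f t} with hα
  set β : ℝ → ℝ≥0∞ := fun b => volume {t | b < h t} with hβ
  have hαm : Measurable α := measurable_meas_lt f
  have hβm : Measurable β := measurable_meas_lt h
  have hα1 := lintegral_meas_lt_mul_le hf hf0 hp hf1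
  have hβ1 := lintegral_meas_lt_mul_le hh hh0 hq hh1
  have hA : ∀ a, MeasurableSet {t | a < f t} := fun a => measurableSet_lt measurable_const hf
  have hrz : Measurable fun z : ℝ × ℝ => riesz lam (z.1 - z.2) :=
    (measurable_riesz lam).comp (by fun_prop)
  have hstep1 : ∫⁻ t, (∫⁻ s, riesz lam (t - s) * ENNReal.ofReal (f s)) * ENNReal.ofReal (h t) =
      ∫⁻ b in Ioi (0 : ℝ), ∫⁻ a in Ioi (0 : ℝ), ∫⁻ t in {t | b < h t}, ∫⁻ s in {s | a < f s},
        riesz lam (t - s) := by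
    have e1 : ∀ t, ∫⁻ s, riesz lam (t - s) * ENNReal.ofReal (f s) =
        ∫⁻ a in Ioi (0 : ℝ), ∫⁻ s in {s | a < f s}, riesz lam (t - s) := fun t =>
      lintegral_ofReal_mul_eq hf hf0 ((measurable_riesz lam).comp (by fun_prop))
    rw [lintegral_ofReal_mul_eq hh hh0]
    · refine lintegral_congr fun b => ?_
      simp_rw [e1]
      refine lintegral_lintegral_swap (Measurable.aemeasurable ?_)
      have hS : MeasurableSet {z : (ℝ × ℝ) × ℝ | z.1.2 < f z.2} :=
        measurableSet_lt (by fun_prop) (hf.comp measurable_snd)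
      have e2 : (Function.uncurry fun t a => ∫⁻ s in {s | a < f s}, riesz lam (t - s)) =
          fun z : ℝ × ℝ => ∫⁻ s, {z : (ℝ × ℝ) × ℝ | z.1.2 < f z.2}.indicator
            (fun z => riesz lam (z.1.1 - z.2)) (z, s) := by
        ext z
        rw [Function.uncurry, ← lintegral_indicator (hA z.2)]
        rfl
      rw [e2]
      exact (((measurable_riesz lam).comp (by fun_prop)).indicator hS).lintegral_prod_right'
    · exact Measurable.lintegral_prod_right'
        (f := fun z : ℝ × ℝ => riesz lam (z.1 - z.2) * ENNReal.ofReal (f z.2))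
        (hrz.mul (hf.comp measurable_snd).ennreal_ofReal)
  -- Two competing bounds for a pair of level sets: the kernel is integrated over one set first and
  -- the other contributes its measure, in either order.
  have hb1 : ∀ a b, ∫⁻ t in {t | b < h t}, ∫⁻ s in {s | a < f s}, riesz lam (t - s) ≤
      ENNReal.ofReal c * (α a ^ (1 - lam) * β b) := fun a b => by
    calc ∫⁻ t in {t | b < h t}, ∫⁻ s in {s | a < f s}, riesz lam (t - s)
        ≤ ∫⁻ t in {t | b < h t}, ENNReal.ofReal c * α a ^ (1 - lam) :=
          lintegral_mono fun t => lintegral_riesz_comp_le h0 h1 (φ := fun s => t - s)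
            (fun g => lintegral_sub_left_eq_self g t) _
      _ = _ := by rw [setLIntegral_const, mul_assoc]
  have hb2 : ∀ a b, ∫⁻ t in {t | b < h t}, ∫⁻ s in {s | a < f s}, riesz lam (t - s) ≤
      ENNReal.ofReal c * (β b ^ (1 - lam) * α a) := fun a b => by
    rw [lintegral_lintegral_swap hrz.aemeasurable]
    calc ∫⁻ s in {s | a < f s}, ∫⁻ t in {t | b < h t}, riesz lam (t - s)
        ≤ ∫⁻ s in {s | a < f s}, ENNReal.ofReal c * β b ^ (1 - lam) :=
          lintegral_mono fun s => lintegral_riesz_comp_le h0 h1 (φ := fun t => t - s)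
            (fun g => lintegral_sub_right_eq_self g s) _
      _ = _ := by rw [setLIntegral_const, mul_assoc]
  -- Neither bound alone is integrable over all levels. The curve `b = a^(p/q)` separates the
  -- regions where each is used, and the two regions are exchanged by swapping `p` and `q`.
  have hb3 : ∀ b ∈ Ioi (0 : ℝ), ∀ a ∈ Ioi (0 : ℝ),
      ∫⁻ t in {t | b < h t}, ∫⁻ s in {s | a < f s}, riesz lam (t - s) ≤
      ENNReal.ofReal c * ((Ioc 0 (a ^ (p / q))).indicator (fun b => β b ^ (1 - lam) * α a) b +
        (Ioc 0 (b ^ (q / p))).indicator (fun a => α a ^ (1 - lam) * β b) a) := by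
    intro b hb a ha
    have hb : 0 < b := hb
    have ha : 0 < a := ha
    by_cases hba : b ≤ a ^ (p / q)
    · rw [indicator_of_mem (show b ∈ Ioc 0 (a ^ (p / q)) from ⟨hb, hba⟩)]
      exact (hb2 a b).trans (by gcongr; exact le_self_add)
    · have hab : a ≤ b ^ (q / p) := by
        have h2 := Real.rpow_le_rpow (by positivity) (not_le.1 hba).le (by positivity : 0 ≤ q / p)
        rwa [← Real.rpow_mul ha.le, show p / q * (q / p) = 1 by field_simp, Real.rpow_one] at h2
      rw [indicator_of_mem (show a ∈ Ioc 0 (b ^ (q / p)) from ⟨ha, hab⟩)]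
      exact (hb1 a b).trans (by gcongr; exact le_add_self)
  have hm1 : Measurable fun z : ℝ × ℝ =>
      (Ioc 0 (z.2 ^ (p / q))).indicator (fun b => β b ^ (1 - lam) * α z.2) z.1 := by
    have hS : MeasurableSet {z : ℝ × ℝ | z.1 ∈ Ioc 0 (z.2 ^ (p / q))} :=
      (measurableSet_lt measurable_const measurable_fst).inter
        (measurableSet_le measurable_fst (by fun_prop))
    exact (((hβm.comp measurable_fst).pow_const _).mul (hαm.comp measurable_snd)).indicator hS
  have hm2 : Measurable fun z : ℝ × ℝ =>
      (Ioc 0 (z.1 ^ (q / p))).indicator (fun a => α a ^ (1 - lam) * β z.1) z.2 := by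
    have hS : MeasurableSet {z : ℝ × ℝ | z.2 ∈ Ioc 0 (z.1 ^ (q / p))} :=
      (measurableSet_lt measurable_const measurable_snd).inter
        (measurableSet_le measurable_snd (by fun_prop))
    exact (((hαm.comp measurable_snd).pow_const _).mul (hβm.comp measurable_fst)).indicator hS
  have hI1 : ∫⁻ b in Ioi (0 : ℝ), ∫⁻ a in Ioi (0 : ℝ),
      (Ioc 0 (a ^ (p / q))).indicator (fun b => β b ^ (1 - lam) * α a) b ≤ ENNReal.ofReal C₁ := by
    rw [lintegral_lintegral_swap hm1.aemeasurable]
    refine le_trans (le_of_eq ?_) ((lintegral_lintegral_Ioc_rpow_le h0 h1 hp hq hsum hβm hα1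
      hβ1).trans (ENNReal.ofReal_le_ofReal (le_abs_self _)))
    refine lintegral_congr fun a => ?_
    rw [lintegral_indicator measurableSet_Ioc, Measure.restrict_restrict measurableSet_Ioc,
      inter_eq_left.2 Ioc_subset_Ioi_self, lintegral_mul_const _ (hβm.pow_const _), mul_comm]
  have hI2 : ∫⁻ b in Ioi (0 : ℝ), ∫⁻ a in Ioi (0 : ℝ),
      (Ioc 0 (b ^ (q / p))).indicator (fun a => α a ^ (1 - lam) * β b) a ≤ ENNReal.ofReal C₂ := by
    refine le_trans (le_of_eq ?_) ((lintegral_lintegral_Ioc_rpow_le h0 h1 hq hp (by linarith) hαm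
      hβ1 hα1).trans (ENNReal.ofReal_le_ofReal (le_abs_self _)))
    refine lintegral_congr fun b => ?_
    rw [lintegral_indicator measurableSet_Ioc, Measure.restrict_restrict measurableSet_Ioc,
      inter_eq_left.2 Ioc_subset_Ioi_self, lintegral_mul_const _ (hαm.pow_const _), mul_comm]
  rw [hstep1]
  calc _ ≤ ∫⁻ b in Ioi (0 : ℝ), ∫⁻ a in Ioi (0 : ℝ), ENNReal.ofReal c *
        ((Ioc 0 (a ^ (p / q))).indicator (fun b => β b ^ (1 - lam) * α a) b +
        (Ioc 0 (b ^ (q / p))).indicator (fun a => α a ^ (1 - lam) * β b) a) :=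
        setLIntegral_mono_ae' measurableSet_Ioi (Eventually.of_forall fun b hb =>
          setLIntegral_mono_ae' measurableSet_Ioi (Eventually.of_forall fun a ha => hb3 b hb a ha))
    _ = ENNReal.ofReal c * ((∫⁻ b in Ioi (0 : ℝ), ∫⁻ a in Ioi (0 : ℝ),
          (Ioc 0 (a ^ (p / q))).indicator (fun b => β b ^ (1 - lam) * α a) b) +
        ∫⁻ b in Ioi (0 : ℝ), ∫⁻ a in Ioi (0 : ℝ),
          (Ioc 0 (b ^ (q / p))).indicator (fun a => α a ^ (1 - lam) * β b) a) := by
        rw [← lintegral_add_left hm1.lintegral_prod_right',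
          ← lintegral_const_mul' _ _ ENNReal.ofReal_ne_top]
        refine lintegral_congr fun b => ?_
        have hmb : Measurable fun a =>
            (Ioc 0 (a ^ (p / q))).indicator (fun b => β b ^ (1 - lam) * α a) b :=
          hm1.comp measurable_prodMk_left
        rw [lintegral_const_mul' _ _ ENNReal.ofReal_ne_top, lintegral_add_left hmb]
    _ ≤ ENNReal.ofReal c * (ENNReal.ofReal C₁ + ENNReal.ofReal C₂) := by gcongr
    _ ≤ ENNReal.ofReal (c * (C₁ + C₂) + 1) := by
        rw [← ENNReal.ofReal_add (abs_nonneg _) (abs_nonneg _), ← ENNReal.ofReal_mul hc0.le]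
        exact ENNReal.ofReal_le_ofReal (by linarith)

end Oseen

end

/-! ### From the bilinear form to the Hardy–Littlewood–Sobolev inequality -/

noncomputable section

namespace Oseen

open Filter Topology ENNReal

theorem exists_normalized {f : ℝ → ℝ≥0∞} (hf : Measurable f) {p : ℝ} (hp : 0 < p)
    (hA : ∫⁻ t, f t ^ p ≠ ⊤) : ∃ g : ℝ → ℝ, Measurable g ∧ (∀ t, 0 ≤ g t) ∧
      ∫⁻ t, ENNReal.ofReal (g t ^ p) ≤ 1 ∧
      f =ᵐ[volume] fun t => (∫⁻ t, f t ^ p) ^ (1 / p) * ENNReal.ofReal (g t) := by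
  have hfin : ∀ᵐ t, f t ≠ ⊤ := by
    filter_upwards [ae_lt_top (hf.pow_const p) hA] with t ht h
    rw [h, ENNReal.top_rpow_of_pos hp] at ht
    exact lt_irrefl _ ht
  set A := ∫⁻ t, f t ^ p with hAdef
  have hp' : 0 < 1 / p := by positivity
  refine ⟨fun t => (f t / A ^ (1 / p)).toReal, (hf.div_const _).ennreal_toReal,
    fun t => ENNReal.toReal_nonneg, ?_, ?_⟩
  · have h1 : ∀ t, ENNReal.ofReal ((f t / A ^ (1 / p)).toReal ^ p) ≤ f t ^ p * A⁻¹ := fun t => by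
      rw [← ENNReal.ofReal_rpow_of_nonneg ENNReal.toReal_nonneg hp.le]
      calc ENNReal.ofReal (f t / A ^ (1 / p)).toReal ^ p ≤ (f t / A ^ (1 / p)) ^ p := by
            gcongr; exact ENNReal.ofReal_toReal_le
        _ = _ := by
            rw [ENNReal.div_rpow_of_nonneg _ _ hp.le, ← ENNReal.rpow_mul,
              one_div_mul_cancel hp.ne', ENNReal.rpow_one, div_eq_mul_inv]
    calc ∫⁻ t, ENNReal.ofReal ((f t / A ^ (1 / p)).toReal ^ p) ≤ ∫⁻ t, f t ^ p * A⁻¹ :=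
          lintegral_mono h1
      _ = A * A⁻¹ := by rw [lintegral_mul_const _ (hf.pow_const p)]
      _ ≤ 1 := ENNReal.mul_inv_le_one A
  -- When the norm vanishes the quotient is meaningless, but then `f` is zero almost everywhere and
  -- the factor in front is zero as well.
  · rcases eq_or_ne A 0 with h0 | h0
    · have h2 := (lintegral_eq_zero_iff (hf.pow_const p)).1 (hAdef.symm.trans h0)
      filter_upwards [h2] with t ht
      rw [h0, ENNReal.zero_rpow_of_pos hp', zero_mul]
      simpa [ENNReal.rpow_eq_zero_iff, hp, hp.not_gt] using ht
    · have h3 : A ^ (1 / p) ≠ 0 := by simp [ENNReal.rpow_eq_zero_iff, h0, hA]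
      have h4 : A ^ (1 / p) ≠ ⊤ := ENNReal.rpow_ne_top_of_nonneg hp'.le hA
      filter_upwards [hfin] with t ht
      rw [ENNReal.ofReal_toReal (ENNReal.div_ne_top ht h3), ENNReal.mul_div_cancel h3 h4]

/-- The bilinear Hardy–Littlewood–Sobolev inequality. -/
theorem lintegral_riesz_mul_le {lam p q : ℝ} (h0 : 0 < lam) (h1 : lam < 1) (hp : 1 < p)
    (hq : 1 < q) (hsum : 1 / p + 1 / q + lam = 2) : ∃ C : ℝ, 0 < C ∧ ∀ f h : ℝ → ℝ≥0∞,
      Measurable f → Measurable h → ∫⁻ t, f t ^ p ≠ ⊤ → ∫⁻ t, h t ^ q ≠ ⊤ →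
      ∫⁻ t, (∫⁻ s, riesz lam (t - s) * f s) * h t ≤
        (∫⁻ t, h t ^ q) ^ (1 / q) * (ENNReal.ofReal C * (∫⁻ t, f t ^ p) ^ (1 / p)) := by
  obtain ⟨C, hC, hb⟩ := lintegral_riesz_bilinear_le h0 h1 hp hq hsum
  refine ⟨C, hC, fun f h hf hh hfA hhA => ?_⟩
  obtain ⟨f', hf'm, hf'0, hf'1, hf'e⟩ := exists_normalized hf (by linarith) hfA
  obtain ⟨h', hh'm, hh'0, hh'1, hh'e⟩ := exists_normalized hh (by linarith) hhA
  set a := (∫⁻ t, f t ^ p) ^ (1 / p)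
  set b := (∫⁻ t, h t ^ q) ^ (1 / q)
  have ha : a ≠ ⊤ := ENNReal.rpow_ne_top_of_nonneg (by positivity) hfA
  have hbt : b ≠ ⊤ := ENNReal.rpow_ne_top_of_nonneg (by positivity) hhA
  have e1 : ∀ t, ∫⁻ s, riesz lam (t - s) * f s =
      a * ∫⁻ s, riesz lam (t - s) * ENNReal.ofReal (f' s) := fun t => by
    rw [← lintegral_const_mul' _ _ ha]
    refine lintegral_congr_ae ?_
    filter_upwards [hf'e] with s hs
    rw [hs]; ring
  calc ∫⁻ t, (∫⁻ s, riesz lam (t - s) * f s) * h t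
      = ∫⁻ t, b * a * ((∫⁻ s, riesz lam (t - s) * ENNReal.ofReal (f' s)) *
          ENNReal.ofReal (h' t)) := by
        refine lintegral_congr_ae ?_
        filter_upwards [hh'e] with t ht
        rw [ht, e1]; ring
    _ = b * a * ∫⁻ t, (∫⁻ s, riesz lam (t - s) * ENNReal.ofReal (f' s)) *
          ENNReal.ofReal (h' t) := lintegral_const_mul' _ _ (ENNReal.mul_ne_top hbt ha)
    _ ≤ b * a * ENNReal.ofReal C := by
        gcongr; exact hb f' h' hf'm hh'm hf'0 hh'0 hf'1 hh'1
    _ = _ := by ring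

/-- The Hardy–Littlewood–Sobolev inequality on the line, for the one-sided kernel. -/
theorem lintegral_rpow_riesz_le {lam p r : ℝ} (h0 : 0 < lam) (h1 : lam < 1) (hp : 1 < p)
    (hr : 1 < r) (hsum : 1 / r = 1 / p + lam - 1) : ∃ C : ℝ, 0 < C ∧ ∀ f : ℝ → ℝ≥0∞,
      Measurable f → (∫⁻ t, (∫⁻ s, riesz lam (t - s) * f s) ^ r) ^ (1 / r) ≤
        ENNReal.ofReal C * (∫⁻ t, f t ^ p) ^ (1 / p) := by
  have hconj : (Real.conjExponent r).HolderConjugate r :=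
    (Real.HolderConjugate.conjExponent hr).symm
  set q := Real.conjExponent r with hq
  have hr0 : 0 < r := by linarith
  have hce : 1 / q = 1 - 1 / r := by
    have := hconj.inv_add_inv_eq_one
    rw [one_div, one_div]; linarith
  have hqr : (r - 1) * q = r := by
    have hq0 : 0 < q := hconj.pos
    field_simp at hce
    linarith
  obtain ⟨C, hC, hb⟩ := lintegral_riesz_mul_le h0 h1 hp hconj.lt (by rw [hce, hsum]; ring)
  refine ⟨C, hC, fun f hf => ?_⟩
  have hp' : 0 < 1 / p := by positivity
  rcases eq_or_ne (∫⁻ t, f t ^ p) ⊤ with hA | hA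
  · rw [hA, ENNReal.top_rpow_of_pos hp', ENNReal.mul_top (by simpa using hC)]
    exact le_top
  set B := ENNReal.ofReal C * (∫⁻ t, f t ^ p) ^ (1 / p) with hB
  have hg : Measurable fun t => ∫⁻ s, riesz lam (t - s) * f s :=
    Measurable.lintegral_prod_right' (f := fun z : ℝ × ℝ => riesz lam (z.1 - z.2) * f z.2)
      (((measurable_riesz lam).comp (by fun_prop)).mul (hf.comp measurable_snd))
  have key : ∫⁻ t, (∫⁻ s, riesz lam (t - s) * f s) ^ r ≤ B ^ r := by
    -- Duality with the test function `u^(r-1)`, whose `q`-th power is `u^r`; truncation ensures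
    -- that its norm is finite.
    refine lintegral_rpow_le_of_truncations hg hr0 fun u hu hug hut hU => ?_
    have e1 : ∫⁻ t, (u t ^ (r - 1)) ^ q = ∫⁻ t, u t ^ r := by
      simp_rw [← ENNReal.rpow_mul, hqr]
    have h2 : ∫⁻ t, u t ^ r ≤ (∫⁻ t, u t ^ r) ^ (1 - 1 / r) * B := by
      calc ∫⁻ t, u t ^ r ≤ ∫⁻ t, (∫⁻ s, riesz lam (t - s) * f s) * u t ^ (r - 1) := by
            refine lintegral_mono fun t => ?_
            calc u t ^ r = u t * u t ^ (r - 1) := by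
                  have h3 := ENNReal.rpow_add_of_nonneg (x := u t) 1 (r - 1) zero_le_one (by linarith)
                  rwa [add_sub_cancel, ENNReal.rpow_one] at h3
              _ ≤ _ := by gcongr; exact hug t
        _ ≤ _ := by
            have h3 := hb f (fun t => u t ^ (r - 1)) hf (hu.pow_const _) hA (by rwa [e1])
            rwa [e1, hce] at h3
    have h4 := ENNReal.rpow_le_rpow (rpow_inv_le_of_le_mul_rpow hr hU h2) hr0.le
    rwa [← ENNReal.rpow_mul, one_div_mul_cancel hr0.ne', ENNReal.rpow_one] at h4
  calc _ ≤ (B ^ r) ^ (1 / r) := by gcongr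
    _ = B := by rw [← ENNReal.rpow_mul, mul_one_div_cancel hr0.ne', ENNReal.rpow_one]

end Oseen

end

/-! ### The mixed-norm estimate -/

noncomputable section

namespace Oseen

open Filter Topology ENNReal

variable {t₁ t₂ : ℝ} {F : E3 → ℝ → Tensor3}

/-- The parabolic majorant `(|z|² + s)⁻²` of the gradient of the Oseen tensor. -/
def majorant (s : ℝ) (z : E3) : ℝ≥0∞ := ENNReal.ofReal ((‖z‖ ^ 2 + s) ^ (-2 : ℝ))

theorem norm_le_sum_abs (z : E3) : ‖z‖ ≤ ∑ i, |z i| := by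
  have h : z = ∑ i, z i • EuclideanSpace.single i (1 : ℝ) := by
    ext j
    simp [Pi.single_apply]
  calc ‖z‖ = ‖∑ i, z i • EuclideanSpace.single i (1 : ℝ)‖ := by rw [← h]
    _ ≤ ∑ i, ‖z i • EuclideanSpace.single i (1 : ℝ)‖ := norm_sum_le _ _
    _ = _ := by simp [norm_smul]

theorem exists_enorm_integrand_le : ∃ C : ℝ, 0 < C ∧ ∀ (F : E3 → ℝ → Tensor3) (i : Fin 3)
    (x y : E3) (t τ : ℝ), τ < t →
      ‖integrand F i x t y τ‖ₑ ≤ ENNReal.ofReal C * (majorant (t - τ) (x - y) * ‖F y τ‖ₑ) := by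
  choose C hC0 hC using fun ℓ i j => (isKer_gamD ℓ i j).bound
  -- Summing over `i` too makes the constant independent of the component, and adding 1 makes it
  -- positive.
  refine ⟨∑ i, ∑ ℓ, ∑ j, C ℓ i j + 1, by
    have : 0 ≤ ∑ i, ∑ ℓ, ∑ j, C ℓ i j := Finset.sum_nonneg fun i _ =>
      Finset.sum_nonneg fun ℓ _ => Finset.sum_nonneg fun j _ => hC0 ℓ i j
    linarith, fun F i x y t τ h => ?_⟩
  have hs : 0 < t - τ := sub_pos.2 h
  rw [integrand_eq F i x y h, ← ofReal_norm, ← ofReal_norm, majorant,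
    ← ENNReal.ofReal_mul (by positivity), ← ENNReal.ofReal_mul (by
      have : 0 ≤ ∑ i, ∑ ℓ, ∑ j, C ℓ i j := Finset.sum_nonneg fun i _ =>
        Finset.sum_nonneg fun ℓ _ => Finset.sum_nonneg fun j _ => hC0 ℓ i j
      linarith)]
  refine ENNReal.ofReal_le_ofReal ?_
  set b := (‖x - y‖ ^ 2 + (t - τ)) ^ (-2 : ℝ) * ‖F y τ‖ with hb
  have hb0 : 0 ≤ b := by positivity
  have hterm : ∀ ℓ j, ‖gamD ℓ i j (x - y) (t - τ) * F y τ (ℓ, j)‖ ≤ C ℓ i j * b := fun ℓ j => by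
    have h1 := hC ℓ i j (x - y) (t - τ) hs
    rw [show (-((4 : ℕ) : ℝ) / 2) = -2 by norm_num] at h1
    rw [norm_mul, hb, ← mul_assoc]
    exact mul_le_mul h1 (abs_coord_tensor_le _ _) (norm_nonneg _)
      (mul_nonneg (hC0 _ _ _) (by positivity))
  calc ‖∑ ℓ, ∑ j, gamD ℓ i j (x - y) (t - τ) * F y τ (ℓ, j)‖
      ≤ ∑ ℓ, ∑ j, C ℓ i j * b := (norm_sum_le _ _).trans (Finset.sum_le_sum fun ℓ _ =>
        (norm_sum_le _ _).trans (Finset.sum_le_sum fun j _ => hterm ℓ j))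
    _ = (∑ ℓ, ∑ j, C ℓ i j) * b := by simp_rw [Finset.sum_mul]
    _ ≤ (∑ i, ∑ ℓ, ∑ j, C ℓ i j + 1) * b := by
        gcongr
        have := Finset.single_le_sum (f := fun i => ∑ ℓ, ∑ j, C ℓ i j) (fun i _ =>
          Finset.sum_nonneg fun ℓ _ => Finset.sum_nonneg fun j _ => hC0 ℓ i j) (Finset.mem_univ i)
        linarith

/-- The pointwise size of a tensor field, extended by zero outside the slab. -/
def slabSize (t₁ t₂ : ℝ) (F : E3 → ℝ → Tensor3) : E3 × ℝ → ℝ≥0∞ :=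
  (slab t₁ t₂).indicator fun p => ‖F p.1 p.2‖ₑ

theorem Admissible.measurable_slabSize (hF : Admissible t₁ t₂ F) :
    Measurable (slabSize t₁ t₂ F) := by
  classical
  have h : slabSize t₁ t₂ F = (slab t₁ t₂).piecewise (fun p => ‖F p.1 p.2‖ₑ) fun _ => 0 := by
    ext p
    rw [slabSize, indicator, piecewise]
  rw [h]
  exact hF.continuousOn.enorm.measurable_piecewise continuousOn_const isOpen_slab.measurableSet

theorem slabSize_of_mem {τ : ℝ} (h : τ ∈ Ioo t₁ t₂) (y : E3) :
    slabSize t₁ t₂ F (y, τ) = ‖F y τ‖ₑ := 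
  indicator_of_mem (show (y, τ) ∈ slab t₁ t₂ from ⟨mem_univ _, h⟩) _

theorem slabSize_of_notMem {τ : ℝ} (h : τ ∉ Ioo t₁ t₂) (y : E3) :
    slabSize t₁ t₂ F (y, τ) = 0 := indicator_of_notMem (fun h' => h h'.2) _

theorem exists_enorm_potential_le : ∃ C : ℝ, 0 < C ∧ ∀ (t₁ t₂ : ℝ) (F : E3 → ℝ → Tensor3) (x : E3),
    ∀ t ∈ Ioo t₁ t₂, ‖potential t₁ F x t‖ₑ ≤ ENNReal.ofReal C *
      ∫⁻ τ in Ioo t₁ t, ∫⁻ y, majorant (t - τ) (x - y) * slabSize t₁ t₂ F (y, τ) := by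
  obtain ⟨C, hC, hb⟩ := exists_enorm_integrand_le
  refine ⟨3 * C, by positivity, fun t₁ t₂ F x t ht => ?_⟩
  set J := ∫⁻ τ in Ioo t₁ t, ∫⁻ y, majorant (t - τ) (x - y) * slabSize t₁ t₂ F (y, τ) with hJ
  have hcoord : ∀ i, ‖potential t₁ F x t i‖ₑ ≤ ENNReal.ofReal C * J := fun i => by
    have e : potential t₁ F x t i = ∫ τ in Ioo t₁ t, ∫ y, integrand F i x t y τ := by
      rw [← integral_Ioc_eq_integral_Ioo, ← intervalIntegral.integral_of_le ht.1.le]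
      rfl
    rw [e, hJ, ← lintegral_const_mul' _ _ ENNReal.ofReal_ne_top]
    refine (enorm_integral_le_lintegral_enorm _).trans
      (setLIntegral_mono_ae' measurableSet_Ioo (Eventually.of_forall fun τ hτ => ?_))
    rw [← lintegral_const_mul' _ _ ENNReal.ofReal_ne_top]
    refine (enorm_integral_le_lintegral_enorm _).trans (lintegral_mono fun y => ?_)
    rw [slabSize_of_mem ⟨hτ.1, hτ.2.trans ht.2⟩]
    exact hb F i x y t τ hτ.2
  calc ‖potential t₁ F x t‖ₑ ≤ ENNReal.ofReal (∑ i, |potential t₁ F x t i|) := by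
        rw [← ofReal_norm]
        exact ENNReal.ofReal_le_ofReal (norm_le_sum_abs _)
    _ = ∑ i, ‖potential t₁ F x t i‖ₑ := by
        rw [ENNReal.ofReal_sum_of_nonneg fun i _ => abs_nonneg _]
        exact Finset.sum_congr rfl fun i _ => (Real.enorm_eq_ofReal_abs _).symm
    _ ≤ ∑ _i : Fin 3, ENNReal.ofReal C * J := Finset.sum_le_sum fun i _ => hcoord i
    _ = _ := by
        rw [ENNReal.ofReal_mul (by norm_num)]
        simp [mul_assoc]

/-- Parabolic scaling: the `a`-th power of the majorant has order `4a`, which is spatially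
integrable exactly when `a > 3/4`. -/
theorem lintegral_majorant_rpow {a s : ℝ} (ha : 3 / 4 < a) (hs : 0 < s) :
    (∫⁻ z, majorant s z ^ a) ^ (1 / a) =
      ENNReal.ofReal ((∫ z : E3, (1 + ‖z‖ ^ 2) ^ (-(4 * a) / 2)) ^ (1 / a)) *
        ENNReal.ofReal (s ^ (3 / (2 * a) - 2)) := by
  have ha0 : 0 < a := by linarith
  have hI : 0 ≤ ∫ z : E3, (1 + ‖z‖ ^ 2) ^ (-(4 * a) / 2) := integral_nonneg fun z => by positivity
  have e : ∫⁻ z, majorant s z ^ a = ∫⁻ z : E3, ENNReal.ofReal ((‖z‖ ^ 2 + s) ^ (-(4 * a) / 2)) := by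
    refine lintegral_congr fun z => ?_
    have : 0 < ‖z‖ ^ 2 + s := by positivity
    rw [majorant, ENNReal.ofReal_rpow_of_pos (by positivity), ← Real.rpow_mul this.le]
    congr 2; ring
  rw [e, ← ofReal_integral_eq_lintegral_ofReal (integrable_parabolic (by linarith) hs)
    (Eventually.of_forall fun z => by positivity), integral_parabolic hs,
    ENNReal.ofReal_rpow_of_nonneg (by positivity) (by positivity),
    Real.mul_rpow (by positivity) hI, mul_comm, ENNReal.ofReal_mul (by positivity),
    ← Real.rpow_mul hs.le]
  congr 3
  field_simp
  ring

/-- The `L^p` norm of the time slices of a tensor field, extended by zero. -/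
def sliceNorm (p t₁ t₂ : ℝ) (F : E3 → ℝ → Tensor3) (τ : ℝ) : ℝ≥0∞ :=
  (∫⁻ y, slabSize t₁ t₂ F (y, τ) ^ p) ^ (1 / p)

theorem Admissible.measurable_sliceNorm (hF : Admissible t₁ t₂ F) (p : ℝ) :
    Measurable (sliceNorm p t₁ t₂ F) :=
  (Measurable.lintegral_prod_left' (hF.measurable_slabSize.pow_const p)).pow_const _

theorem eLpNorm_ofReal_eq {V : Type*} [NormedAddCommGroup V] {p : ℝ} (hp : 0 < p) (f : E3 → V) :
    eLpNorm f (ENNReal.ofReal p) volume = (∫⁻ x, ‖f x‖ₑ ^ p) ^ (1 / p) := by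
  rw [eLpNorm_eq_lintegral_rpow_enorm_toReal (by simpa using hp) ENNReal.ofReal_ne_top,
    ENNReal.toReal_ofReal hp.le]

theorem lintegral_sliceNorm_rpow {p m : ℝ} (hp : 0 < p) (hm : 0 < m) :
    (∫⁻ τ, sliceNorm p t₁ t₂ F τ ^ m) ^ (1 / m) = mixedNorm m p t₁ t₂ F := by
  rw [mixedNorm, ← lintegral_indicator measurableSet_Ioo]
  congr 1
  refine lintegral_congr fun τ => ?_
  by_cases h : τ ∈ Ioo t₁ t₂
  · rw [indicator_of_mem h, eLpNorm_ofReal_eq hp, sliceNorm]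
    simp_rw [slabSize_of_mem h]
  · rw [indicator_of_notMem h, sliceNorm]
    simp_rw [slabSize_of_notMem h, ENNReal.zero_rpow_of_pos hp, lintegral_zero]
    rw [ENNReal.zero_rpow_of_pos (by positivity), ENNReal.zero_rpow_of_pos hm]

theorem measurable_majorant_sub (t : ℝ) :
    Measurable fun z : (E3 × ℝ) × E3 => majorant (t - z.1.2) (z.1.1 - z.2) := by
  unfold majorant
  fun_prop

/-- Minkowski brings the `L^r` norm inside the time integral and Young is applied on each time
slice. This reduces the space-time estimate to a fractional integral on the line. -/
theorem exists_eLpNorm_potential_le {p r : ℝ} (hp : 1 < p) (hr : 1 < r) (hpr : 1 / r ≤ 1 / p)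
    (hlam : 1 / p - 1 / r < 1 / 3) : ∃ C : ℝ, 0 < C ∧ ∀ (t₁ t₂ : ℝ) (F : E3 → ℝ → Tensor3),
      Admissible t₁ t₂ F → ∀ t ∈ Ioo t₁ t₂,
        eLpNorm (fun x => potential t₁ F x t) (ENNReal.ofReal r) volume ≤ ENNReal.ofReal C *
          ∫⁻ τ, riesz (1 / 2 + 3 / 2 * (1 / p - 1 / r)) (t - τ) * sliceNorm p t₁ t₂ F τ := by
  obtain ⟨C, hC, hb⟩ := exists_enorm_potential_le
  have hp0 : 0 < p := by linarith
  have hr0 : 0 < r := by linarith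
  have hd : 0 < 1 + 1 / r - 1 / p := by linarith
  -- The exponent dictated by Young's inequality; the majorant then contributes `(t-τ)^(3/(2a)-2)`,
  -- that is `(t-τ)^(-lam)`.
  set a := (1 + 1 / r - 1 / p)⁻¹ with ha
  have ha0 : 0 < a := inv_pos.2 hd
  have hainv : 1 / a = 1 + 1 / r - 1 / p := by rw [ha, one_div, inv_inv]
  have ha1 : 3 / 4 < a := by
    rw [ha, lt_inv_comm₀ (by norm_num) hd]
    linarith
  have hp1 : 1 / p < 1 := by rw [div_lt_one hp0]; exact hp
  set I := (∫ z : E3, (1 + ‖z‖ ^ 2) ^ (-(4 * a) / 2)) ^ (1 / a)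
  set lam := 1 / 2 + 3 / 2 * (1 / p - 1 / r) with hlamdef
  have hexp : 3 / (2 * a) - 2 = -lam := by
    have : 3 / (2 * a) = 3 / 2 * (1 / a) := by field_simp
    rw [this, hainv, hlamdef]; ring
  refine ⟨C * (|I| + 1), by positivity, fun t₁ t₂ F hF t ht => ?_⟩
  have hm := hF.measurable_slabSize
  have hf : Measurable (Function.uncurry fun x τ =>
      ∫⁻ y, majorant (t - τ) (x - y) * slabSize t₁ t₂ F (y, τ)) :=
    Measurable.lintegral_prod_right' (f := fun z : (E3 × ℝ) × E3 =>
      majorant (t - z.1.2) (z.1.1 - z.2) * slabSize t₁ t₂ F (z.2, z.1.2))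
      ((measurable_majorant_sub t).mul (hm.comp (by fun_prop)))
  have hyoung : ∀ τ ∈ Ioo t₁ t,
      (∫⁻ x, (∫⁻ y, majorant (t - τ) (x - y) * slabSize t₁ t₂ F (y, τ)) ^ r) ^ (1 / r) ≤
        ENNReal.ofReal (|I| + 1) * (riesz lam (t - τ) * sliceNorm p t₁ t₂ F τ) := fun τ hτ => by
    have hs : 0 < t - τ := sub_pos.2 hτ.2
    refine (lintegral_rpow_conv_le (k := majorant (t - τ)) (f := fun y => slabSize t₁ t₂ F (y, τ))
      (by unfold majorant; fun_prop) (hm.comp measurable_prodMk_right) ha0 hp0 hr0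
      (by linarith) hpr (by linarith)).trans ?_
    rw [lintegral_majorant_rpow ha1 hs, hexp, ← mul_assoc, sliceNorm, riesz,
      indicator_of_mem (show t - τ ∈ Ioi 0 from hs)]
    gcongr
    exact (le_abs_self I).trans (by linarith)
  rw [eLpNorm_ofReal_eq hr0]
  calc (∫⁻ x, ‖potential t₁ F x t‖ₑ ^ r) ^ (1 / r)
      ≤ (∫⁻ x, (ENNReal.ofReal C *
          ∫⁻ τ in Ioo t₁ t, ∫⁻ y, majorant (t - τ) (x - y) * slabSize t₁ t₂ F (y, τ)) ^ r) ^
            (1 / r) := by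
        gcongr with x
        exact hb t₁ t₂ F x t ht
    _ = ENNReal.ofReal C * (∫⁻ x,
          (∫⁻ τ in Ioo t₁ t, ∫⁻ y, majorant (t - τ) (x - y) * slabSize t₁ t₂ F (y, τ)) ^ r) ^
            (1 / r) := by
        simp_rw [ENNReal.mul_rpow_of_nonneg _ _ hr0.le]
        rw [lintegral_const_mul' _ _ (ENNReal.rpow_ne_top_of_nonneg hr0.le ENNReal.ofReal_ne_top),
          ENNReal.mul_rpow_of_nonneg _ _ (by positivity), ← ENNReal.rpow_mul,
          mul_one_div_cancel hr0.ne', ENNReal.rpow_one]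
    _ ≤ ENNReal.ofReal C * ∫⁻ τ in Ioo t₁ t, (∫⁻ x,
          (∫⁻ y, majorant (t - τ) (x - y) * slabSize t₁ t₂ F (y, τ)) ^ r) ^ (1 / r) := by
        gcongr
        exact lintegral_rpow_lintegral_le hf hr
    _ ≤ ENNReal.ofReal C * ∫⁻ τ in Ioo t₁ t,
          ENNReal.ofReal (|I| + 1) * (riesz lam (t - τ) * sliceNorm p t₁ t₂ F τ) := by
        refine mul_le_mul_right ?_ _
        exact setLIntegral_mono_ae' measurableSet_Ioo (Eventually.of_forall hyoung)
    _ ≤ ENNReal.ofReal C * ∫⁻ τ,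
          ENNReal.ofReal (|I| + 1) * (riesz lam (t - τ) * sliceNorm p t₁ t₂ F τ) := by
        gcongr
        exact Measure.restrict_le_self
    _ = _ := by
        rw [lintegral_const_mul' _ _ ENNReal.ofReal_ne_top, ← mul_assoc,
          ← ENNReal.ofReal_mul hC.le]

/-- The hypothesis on `1/l` is the Hardy–Littlewood–Sobolev relation `1/l = 1/m + lam - 1`, and the
gap below `1/3` is the condition `lam < 1`. -/
theorem exists_mixedNorm_potential_le {p m r l : ℝ} (hp : 1 < p) (hm : 1 < m) (hr : 1 < r)
    (hl : 1 < l) (hpr : 1 / r ≤ 1 / p) (hlam : 1 / p - 1 / r < 1 / 3)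
    (hsum : 1 / l = 1 / m + 3 / 2 * (1 / p - 1 / r) - 1 / 2) : ∃ C : ℝ, 0 < C ∧
      ∀ (t₁ t₂ : ℝ) (F : E3 → ℝ → Tensor3), Admissible t₁ t₂ F →
        mixedNorm l r t₁ t₂ (potential t₁ F) ≤ ENNReal.ofReal C * mixedNorm m p t₁ t₂ F := by
  obtain ⟨C, hC, hb⟩ := exists_eLpNorm_potential_le hp hr hpr hlam
  set lam := 1 / 2 + 3 / 2 * (1 / p - 1 / r) with hlamdef
  obtain ⟨C', hC', hb'⟩ := lintegral_rpow_riesz_le (lam := lam) (p := m) (r := l)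
    (by rw [hlamdef]; linarith) (by rw [hlamdef]; linarith) hm hl (by rw [hsum, hlamdef]; ring)
  have hl0 : 0 < l := by linarith
  refine ⟨C * C', by positivity, fun t₁ t₂ F hF => ?_⟩
  rw [mixedNorm]
  calc (∫⁻ t in Ioo t₁ t₂, eLpNorm (fun x => potential t₁ F x t) (ENNReal.ofReal r) volume ^ l) ^
        (1 / l)
      ≤ (∫⁻ t in Ioo t₁ t₂, (ENNReal.ofReal C *
          ∫⁻ τ, riesz lam (t - τ) * sliceNorm p t₁ t₂ F τ) ^ l) ^ (1 / l) := by
        refine ENNReal.rpow_le_rpow ?_ (by positivity)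
        refine setLIntegral_mono_ae' measurableSet_Ioo (Eventually.of_forall fun t ht => ?_)
        exact ENNReal.rpow_le_rpow (hb t₁ t₂ F hF t ht) hl0.le
    _ ≤ (∫⁻ t, (ENNReal.ofReal C *
          ∫⁻ τ, riesz lam (t - τ) * sliceNorm p t₁ t₂ F τ) ^ l) ^ (1 / l) := by
        gcongr
        exact Measure.restrict_le_self
    _ = ENNReal.ofReal C *
          (∫⁻ t, (∫⁻ τ, riesz lam (t - τ) * sliceNorm p t₁ t₂ F τ) ^ l) ^ (1 / l) := by
        simp_rw [ENNReal.mul_rpow_of_nonneg _ _ hl0.le]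
        rw [lintegral_const_mul' _ _ (ENNReal.rpow_ne_top_of_nonneg hl0.le ENNReal.ofReal_ne_top),
          ENNReal.mul_rpow_of_nonneg _ _ (by positivity), ← ENNReal.rpow_mul,
          mul_one_div_cancel hl0.ne', ENNReal.rpow_one]
    _ ≤ ENNReal.ofReal C * (ENNReal.ofReal C' *
          (∫⁻ τ, sliceNorm p t₁ t₂ F τ ^ m) ^ (1 / m)) := by
        gcongr
        exact hb' _ (hF.measurable_sliceNorm p)
    _ = _ := by
        rw [lintegral_sliceNorm_rpow (by linarith) (by linarith), ← mul_assoc,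
          ← ENNReal.ofReal_mul hC.le]

theorem exists_memMixed_potential {q q' r r' : ℝ} (hq : 3 < q) (hq' : 2 / q' + 3 / q = 1)
    (hr : 3 < r) (hr' : 2 / r' + 3 / r = 1) (hqr : q ≤ 2 * r) (hrq : 6 * r / (3 + r) < q) :
    ∃ c : ℝ, 0 < c ∧ ∀ t₁ t₂ : ℝ, t₁ < t₂ → ∀ F : E3 → ℝ → Tensor3, Admissible t₁ t₂ F →
      MemMixed (q' / 2) (q / 2) t₁ t₂ F → MemMixed r' r t₁ t₂ (potential t₁ F) ∧
        mixedNorm r' r t₁ t₂ (potential t₁ F) ≤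
          ENNReal.ofReal c * mixedNorm (q' / 2) (q / 2) t₁ t₂ F := by
  have hq0 : 0 < q := by linarith
  have hr0 : 0 < r := by linarith
  have h3q : 3 / q < 1 := by rwa [div_lt_one hq0]
  have h3r : 3 / r < 1 := by rwa [div_lt_one hr0]
  have h3q0 : 0 < 3 / q := by positivity
  have h3r0 : 0 < 3 / r := by positivity
  have hm : 1 < q' / 2 := by
    have h1 : 0 < 2 / q' := by linarith
    have h2 : 0 < q' := by
      by_contra h
      exact absurd h1 (not_lt.2 (div_nonpos_of_nonneg_of_nonpos (by norm_num) (not_lt.1 h)))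
    have h3 : 2 / q' < 1 := by linarith
    rw [div_lt_one h2] at h3
    linarith
  have hl : 1 < r' := by
    have h1 : 0 < 2 / r' := by linarith
    have h2 : 0 < r' := by
      by_contra h
      exact absurd h1 (not_lt.2 (div_nonpos_of_nonneg_of_nonpos (by norm_num) (not_lt.1 h)))
    have h3 : 2 / r' < 1 := by linarith
    rw [div_lt_one h2] at h3
    linarith
  have e1 : 1 / (q / 2) = 2 / 3 * (3 / q) := by field_simp
  have e2 : 1 / r = 1 / 3 * (3 / r) := by field_simp
  have e3 : 1 / (q' / 2) = 2 / q' := by field_simp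
  have e4 : 1 / r' = 1 / 2 * (2 / r') := by field_simp
  -- This restates `q > 6r/(3+r)` as `2/q - 1/r < 1/3`, which is `lam < 1` for `p = q/2`.
  have hgap : 3 / q < 3 / (2 * r) + 1 / 2 := by
    have h4 : 6 * r < q * (3 + r) := by rwa [div_lt_iff₀ (by linarith)] at hrq
    rw [div_add_div _ _ (by positivity) (by norm_num), div_lt_div_iff₀ hq0 (by positivity)]
    nlinarith
  have e5 : 3 / (2 * r) = 1 / 2 * (3 / r) := by field_simp
  obtain ⟨c, hc, hb⟩ := exists_mixedNorm_potential_le (p := q / 2) (m := q' / 2) (r := r) (l := r')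
    (by linarith) hm (by linarith) hl
    (one_div_le_one_div_of_le (by linarith) (by linarith)) (by rw [e1, e2]; linarith)
    (by rw [e1, e2, e3, e4]; linarith)
  refine ⟨c, hc, fun t₁ t₂ _ F hF hFm => ⟨⟨?_, ?_⟩, hb t₁ t₂ F hF⟩⟩
  · exact (spaceRegular_potential hF).continuousOn.aestronglyMeasurable isOpen_slab.measurableSet
  · exact (hb t₁ t₂ F hF).trans_lt (ENNReal.mul_lt_top ENNReal.ofReal_lt_top hFm.2)

end Oseen

end

theorem lemma2p3 :
    (∀ t₁ t₂ : ℝ, t₁ < t₂ → ∀ F : Oseen.E3 → ℝ → Oseen.Tensor3, Oseen.Admissible t₁ t₂ F →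
      (∀ (i : Fin 3) (x : Oseen.E3), ∀ t ∈ Set.Ioo t₁ t₂,
        MeasureTheory.IntegrableOn
          (fun p : Oseen.E3 × ℝ => Oseen.integrand F i x t p.1 p.2) (Oseen.slab t₁ t)) ∧
      Oseen.SpaceRegular 2 t₁ t₂ (Oseen.potential t₁ F) ∧
      Oseen.TimeRegular t₁ t₂ (Oseen.potential t₁ F) ∧
      ∃ Φ : Oseen.E3 → ℝ → ℝ, Oseen.SpaceRegular 1 t₁ t₂ Φ ∧
        Oseen.SolvesStokes t₁ t₂ (Oseen.potential t₁ F) Φ F) ∧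
    (∀ q q' r r' : ℝ, 3 < q → 2 / q' + 3 / q = 1 → 3 < r → 2 / r' + 3 / r = 1 →
      q ≤ 2 * r → 6 * r / (3 + r) < q →
      ∃ c : ℝ, 0 < c ∧
        ∀ t₁ t₂ : ℝ, t₁ < t₂ → ∀ F : Oseen.E3 → ℝ → Oseen.Tensor3, Oseen.Admissible t₁ t₂ F →
          Oseen.MemMixed (q' / 2) (q / 2) t₁ t₂ F →
          Oseen.MemMixed r' r t₁ t₂ (Oseen.potential t₁ F) ∧
          Oseen.mixedNorm r' r t₁ t₂ (Oseen.potential t₁ F) ≤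
            ENNReal.ofReal c * Oseen.mixedNorm (q' / 2) (q / 2) t₁ t₂ F) :=
  ⟨fun _ _ _ F hF => ⟨fun i x _ ht => Oseen.integrableOn_integrand hF i x ht,
    Oseen.spaceRegular_potential hF, Oseen.timeRegular_potential hF, Oseen.pressure F,
    Oseen.spaceRegular_pressure hF, Oseen.solvesStokes_potential hF⟩,
  fun _ _ _ _ hq hq' hr hr' hqr hrq => Oseen.exists_memMixed_potential hq hq' hr hr' hqr hrq⟩
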